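/- **Setting.** Fix $\alpha,\beta,a\ge 0$ and, for every integer $N\ge 1$, consider the Klein–Gordon chain $$H=H_0+H_1+H_2,\quad H_0=\sum_j\frac{p_j^2+q_j^2}{2}+\sum_j a\frac{(q_j-q_{j-1})^2}{2},\quad H_1=\alpha\sum_j\frac{q_j^3}{3},\quad H_2=\beta\sum_j\frac{q_j^4}{4},$$ either with periodic boundary conditions (PBC: sites $j=-(N+1),\dots,N$, $q$ extended $(2N+2)$-periodically) or with Dirichlet boundary conditions (DBC: sites $j=1,\dots,N$, $q_0=q_{N+1}=0$, the springs being $q_j-q_{j-1}$, $j=1,\dots,N+1$). Let $\mu=1/N$, and let $k$ vary in the same set as $j$. The Fourier basis is $\hat e_k(j)=\frac{\delta}{\sqrt{N+1}}\sin\frac{jk\pi}{N+1}$ for $k\geq 1$ ($\delta=1$ for PBC, $\delta=\sqrt2$ for DBC) and, for PBC only, $\hat e_k(j)=\frac{1}{\sqrt{N+1}}\cos\frac{jk\pi}{N+1}$ for $-N\le k\le -1$, $\hat e_0(j)=\frac1{\sqrt{2N+2}}$, $\hat e_{-N-1}(j)=\frac{(-1)^j}{\sqrt{2N+2}}$. Put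 $\omega_k=\sqrt{1+4a\sin^2\frac{k\pi}{2N+2}}$ and introduce $\hat p_k,\hat q_k$ and $\psi$ by $$p_j=\sum_k\sqrt{\omega_k}\,\hat p_k\hat e_k(j),\quad q_j=\sum_k\frac{\hat q_k}{\sqrt{\omega_k}}\hat e_k(j),\quad \hat\psi_k=\frac{\hat p_k+\mathrm i\hat q_k}{\sqrt2},\quad \psi_j=\sum_k\hat\psi_k\hat e_k(j).$$ All functions are regarded as functions of $\psi$. Let $$\|\psi\|_{s,\sigma}^2=\mu\sum_k[k]^{2s}e^{2\sigma|k|}|\hat\psi_k|^2,\qquad [k]=\max\{1,|k|\}.$$ The Hamiltonian vector field $X_f$ has components $(-\partial f/\partial\hat q_k,\ \partial f/\partial\hat p_k)$, and $\{f,g\}=df\,X_g$. A polynomial $Z$ is in normal form if $\{H_{00},Z\}\equiv0$, where $H_{00}=\sum_k\frac{\hat p_k^2+\hat q_k^2}{2}$. A canonical transformation on an open set is an injective map whose differential preserves $\sum_k d\hat p_k\wedge d\hat q_k$ at every point. The parameters $(s,\sigma)$ are called admissible if $s>\frac12$, $\sigma\ge0$ (PBC), respectively $\frac12<s<\frac52$,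 $\sigma=0$ (DBC). **Theorem.** Assume $a<1/3$. Then, for every $N\ge1$, there are a map $\mathcal T$, a homogeneous polynomial $Z$ of degree $4$ in normal form, and a function $\mathcal R$ (depending on $N$ but not on $s,\sigma$), such that for all admissible $(s,\sigma)$ there are $\rho>0$ and constants $C_{\mathcal R},C_Z,C_{\mathcal T}$, all independent of $N$, with the following properties for every $N\ge 1$. On the ball $B=\{\|\psi\|_{s,\sigma}<\rho\}$ the map $\mathcal T$ is an analytic canonical transformation, $\mathcal R$ is analytic, and $$H\circ\mathcal T=H_0+Z+\mathcal R .$$ 1) For $\psi\in B$, $$\|X_{\mathcal R}(\psi)\|_{s,\sigma}\le C_{\mathcal R}\|\psi\|_{s,\sigma}^4,\qquad \|\psi-\mathcal T(\psi)\|_{s,\sigma}\le C_{\mathcal T}\|\psi\|_{s,\sigma}^2,$$ and $\|X_Z(\psi)\|_{s,\sigma}\le C_Z\|\psi\|_{s,\sigma}^3$ for all $\psi$. 2) One has $\mathcal T=\mathbb I+X_{\chi_{01}}+\mathcal R_{\mathcal T}$ with $$\chi_{01}(\psi)=\frac{\alpha}{6\sqrt2}\sum_j\Big(\tfrac13\psi_j^3+\tfrac13\bar\psi_j^3-3\psi_j\bar\psi_j^2-3\psi_j^2\bar\psi_j\Big),$$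 and for every $s_1$ with $0\le s_1<s-\frac12$ and, for PBC, $s_1\le2$, there is a constant $C_{\mathcal R_{\mathcal T}}$ independent of $N$ such that $$\|\mathcal R_{\mathcal T}(\psi)\|_{s-s_1,\sigma}\le C_{\mathcal R_{\mathcal T}}\big(\mu^{s_1}\|\psi\|_{s,\sigma}^2+\|\psi\|_{s,\sigma}^3\big)\qquad\text{for }\|\psi\|_{s,\sigma}<\rho,$$ and in particular $$\|\mathcal R_{\mathcal T}(\psi)\|_{s-s_1,\sigma}\le C_{\mathcal R_{\mathcal T}}\,\mu^{s_1}\|\psi\|_{s,\sigma}^2\qquad\text{for }\|\psi\|_{s,\sigma}<\rho\,\mu^{s_1}.$$ 3) $Z=Z_0+Z_r$ with $$Z_0=\tilde\gamma\sum_j|\psi_j|^4,\qquad \tilde\gamma=\frac38\Big(\beta-\frac{10}9\alpha^2\Big),$$ and for every $s_1$ as in 2) there is a constant $C_r$ independent of $N$ such that, for all $\psi$, $$\|X_{Z_r}(\psi)\|_{s-s_1,\sigma}\le C_r\,\mu^{s_1}\|\psi\|_{s,\sigma}^3 .$$ -/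

import Mathlib

namespace KGChain

noncomputable section

/-- The two boundary conditions of the chain. -/
inductive BC where
  | periodic
  | dirichlet

/-- The finite set in which both the site index `j` and the mode index `k` vary:
`-(N+1), …, N` for periodic and `1, …, N` for Dirichlet boundary conditions. -/
def idx : BC → ℕ → Finset ℤ
  | .periodic, N => Finset.Icc (-((N : ℤ) + 1)) N
  | .dirichlet, N => Finset.Icc 1 (N : ℤ)

/-- Real sequences on the lattice. -/
abbrev Seq (bc : BC) (N : ℕ) : Type := ↥(idx bc N) → ℝ

/-- The phase space, in the complex Fourier coordinates
`ψ̂_k = (p̂_k + i q̂_k) / √2`. -/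
abbrev Phase (bc : BC) (N : ℕ) : Type := ↥(idx bc N) → ℂ

/-- Reduction of an integer modulo `2N+2` to the interval `-(N+1), …, N`. -/
def wrap (N : ℕ) (j : ℤ) : ℤ := (j + ((N : ℤ) + 1)) % (2 * (N : ℤ) + 2) - ((N : ℤ) + 1)

theorem wrap_mem (N : ℕ) (j : ℤ) : wrap N j ∈ idx .periodic N := by
  have h1 := Int.emod_nonneg (j + ((N : ℤ) + 1)) (show (2 * (N : ℤ) + 2) ≠ 0 by omega)
  have h2 := Int.emod_lt_of_pos (j + ((N : ℤ) + 1)) (show 0 < (2 * (N : ℤ) + 2) by omega)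
  simp only [idx, wrap, Finset.mem_Icc]
  omega

/-- The extension of a lattice sequence to all integers that is dictated by the boundary
conditions: `(2N+2)`-periodic, respectively `q_0 = q_{N+1} = 0`. -/
def ext : (bc : BC) → (N : ℕ) → Seq bc N → ℤ → ℝ
  | .periodic, N, q => fun j => q ⟨wrap N j, wrap_mem N j⟩
  | .dirichlet, N, q => fun j => if h : j ∈ idx .dirichlet N then q ⟨j, h⟩ else 0

/-- The indices `j` of the springs joining the particles `j - 1` and `j`. -/
def bonds : BC → ℕ → Finset ℤ
  | .periodic, N => Finset.Icc (-((N : ℤ) + 1)) N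
  | .dirichlet, N => Finset.Icc 1 ((N : ℤ) + 1)

/-- The quadratic part `H₀(p,q)` of the Hamiltonian. -/
def latticeH0 (bc : BC) (N : ℕ) (a : ℝ) (p q : Seq bc N) : ℝ :=
  (∑ j, (p j ^ 2 + q j ^ 2) / 2) +
    ∑ j ∈ bonds bc N, a * (ext bc N q j - ext bc N q (j - 1)) ^ 2 / 2

/-- The cubic part `H₁`. -/
def latticeH1 (bc : BC) (N : ℕ) (α : ℝ) (q : Seq bc N) : ℝ := α * ∑ j, q j ^ 3 / 3

/-- The quartic part `H₂`. -/
def latticeH2 (bc : BC) (N : ℕ) (β : ℝ) (q : Seq bc N) : ℝ := β * ∑ j, q j ^ 4 / 4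

/-- The Fourier basis vector `ê_k`, evaluated at the site `j`. -/
def mode (bc : BC) (N : ℕ) (k j : ℤ) : ℝ :=
  if 0 < k then
    (match bc with
      | .periodic => 1
      | .dirichlet => √2) / √((N : ℝ) + 1) * Real.sin (j * k * Real.pi / ((N : ℝ) + 1))
  else if k = 0 then 1 / √(2 * (N : ℝ) + 2)
  else if k = -((N : ℤ) + 1) then (-1) ^ j / √(2 * (N : ℝ) + 2)
  else 1 / √((N : ℝ) + 1) * Real.cos (j * k * Real.pi / ((N : ℝ) + 1))

/-- The frequency `ω_k`. -/
def freq (N : ℕ) (a : ℝ) (k : ℤ) : ℝ :=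
  √(1 + 4 * a * Real.sin (k * Real.pi / (2 * (N : ℝ) + 2)) ^ 2)

section coordinates

variable {bc : BC} {N : ℕ}

/-- The Fourier momentum `p̂_k = √2 Re ψ̂_k`. -/
def pHat (ψ : Phase bc N) (k : ↥(idx bc N)) : ℝ := √2 * (ψ k).re

/-- The Fourier position `q̂_k = √2 Im ψ̂_k`. -/
def qHat (ψ : Phase bc N) (k : ↥(idx bc N)) : ℝ := √2 * (ψ k).im

/-- The momenta of the particles, `p_j = ∑_k √ω_k p̂_k ê_k(j)`. -/
def momentum (a : ℝ) (ψ : Phase bc N) : Seq bc N :=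
  fun j => ∑ k : ↥(idx bc N), √(freq N a k) * pHat ψ k * mode bc N k j

/-- The displacements of the particles, `q_j = ∑_k q̂_k / √ω_k ê_k(j)`. -/
def position (a : ℝ) (ψ : Phase bc N) : Seq bc N :=
  fun j => ∑ k : ↥(idx bc N), qHat ψ k / √(freq N a k) * mode bc N k j

/-- The real space variables `ψ_j = ∑_k ψ̂_k ê_k(j)`. -/
def site (ψ : Phase bc N) (j : ↥(idx bc N)) : ℂ := ∑ k, ψ k * (mode bc N k j : ℂ)

/-- `H₀` as a function on the phase space. -/
def H0 (a : ℝ) (ψ : Phase bc N) : ℝ := latticeH0 bc N a (momentum a ψ) (position a ψ)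

/-- The Hamiltonian `H = H₀ + H₁ + H₂` as a function on the phase space. -/
def H (a α β : ℝ) (ψ : Phase bc N) : ℝ :=
  H0 a ψ + latticeH1 bc N α (position a ψ) + latticeH2 bc N β (position a ψ)

/-- `H₀₀ = ∑_k (p̂_k² + q̂_k²) / 2`. -/
def H00 (ψ : Phase bc N) : ℝ := ∑ k, (pHat ψ k ^ 2 + qHat ψ k ^ 2) / 2

/-- `∂f/∂p̂_k`. -/
def dP (f : Phase bc N → ℝ) (ψ : Phase bc N) (k : ↥(idx bc N)) : ℝ :=
  fderiv ℝ f ψ (Pi.single k (1 / (√2 : ℂ)))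

/-- `∂f/∂q̂_k`. -/
def dQ (f : Phase bc N → ℝ) (ψ : Phase bc N) (k : ↥(idx bc N)) : ℝ :=
  fderiv ℝ f ψ (Pi.single k (Complex.I / (√2 : ℂ)))

/-- The Hamiltonian vector field `X_f = (-∂f/∂q̂, ∂f/∂p̂)`, in the coordinates `ψ̂`. -/
def hamVF (f : Phase bc N → ℝ) (ψ : Phase bc N) : Phase bc N :=
  fun k => (-(dQ f ψ k : ℂ) + Complex.I * (dP f ψ k : ℂ)) / (√2 : ℂ)

/-- The Poisson bracket `{f, g} = df X_g`. -/
def poisson (f g : Phase bc N → ℝ) (ψ : Phase bc N) : ℝ :=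
  ∑ k, (dQ f ψ k * dP g ψ k - dP f ψ k * dQ g ψ k)

/-- The symplectic form `∑_k dp̂_k ∧ dq̂_k`. -/
def symp (u v : Phase bc N) : ℝ := ∑ k, (pHat u k * qHat v k - qHat u k * pHat v k)

/-- The small parameter `μ = 1/N`. -/
def mu (N : ℕ) : ℝ := 1 / (N : ℝ)

/-- The norm `‖ψ‖_{s,σ}`, with `‖ψ‖²_{s,σ} = μ ∑_k [k]^{2s} e^{2σ|k|} |ψ̂_k|²` and
`[k] = max {1, |k|}`. -/
def wnorm (s σ : ℝ) (ψ : Phase bc N) : ℝ :=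
  √(mu N * ∑ k : ↥(idx bc N), (max 1 |((k : ℤ) : ℝ)|) ^ (2 * s) *
    Real.exp (2 * σ * |((k : ℤ) : ℝ)|) * ‖ψ k‖ ^ 2)

/-- The open ball of radius `ρ` in the norm `‖·‖_{s,σ}`. -/
def wball (bc : BC) (N : ℕ) (s σ ρ : ℝ) : Set (Phase bc N) := {ψ | wnorm s σ ψ < ρ}

/-- `f` is a homogeneous polynomial of degree `n` on the phase space. -/
def IsHomPoly (n : ℕ) (f : Phase bc N → ℝ) : Prop :=
  ∃ M : MultilinearMap ℝ (fun _ : Fin n => Phase bc N) ℝ, ∀ ψ, f ψ = M (fun _ => ψ)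

/-- `Z` Poisson commutes with `H₀₀`. -/
def IsNormalForm (Z : Phase bc N → ℝ) : Prop := ∀ ψ, poisson H00 Z ψ = 0

/-- `T` is an analytic canonical transformation on `U`: it is analytic and injective there, and
its differential preserves the symplectic form. -/
def IsAnalyticCanonicalOn (T : Phase bc N → Phase bc N) (U : Set (Phase bc N)) : Prop :=
  AnalyticOnNhd ℝ T U ∧ Set.InjOn T U ∧
    ∀ ψ ∈ U, ∀ u v, symp (fderiv ℝ T ψ u) (fderiv ℝ T ψ v) = symp u v

/-- The function
`χ₀₁ = α/(6√2) ∑_j (ψ_j³/3 + ψ̄_j³/3 - 3 ψ_j ψ̄_j² - 3 ψ_j² ψ̄_j)`; the summands are real. -/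
def chi01 (α : ℝ) (ψ : Phase bc N) : ℝ :=
  α / (6 * √2) * ∑ j, (site ψ j ^ 3 / 3 + star (site ψ j) ^ 3 / 3
    - 3 * site ψ j * star (site ψ j) ^ 2 - 3 * site ψ j ^ 2 * star (site ψ j)).re

/-- `γ̃ = (3/8)(β - (10/9) α²)`. -/
def gammaTilde (α β : ℝ) : ℝ := 3 / 8 * (β - 10 / 9 * α ^ 2)

/-- `Z₀ = γ̃ ∑_j |ψ_j|⁴`. -/
def Z0 (α β : ℝ) (ψ : Phase bc N) : ℝ := gammaTilde α β * ∑ j, ‖site ψ j‖ ^ 4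

end coordinates

/-- The range of the parameters `s, σ`. -/
def Admissible : BC → ℝ → ℝ → Prop
  | .periodic, s, σ => 1 / 2 < s ∧ 0 ≤ σ
  | .dirichlet, s, σ => 1 / 2 < s ∧ s < 5 / 2 ∧ σ = 0

/-- The range of the loss of derivatives `s₁`, for given `s`. -/
def AdmissibleLoss : BC → ℝ → ℝ → Prop
  | .periodic, s, s₁ => 0 ≤ s₁ ∧ s₁ < s - 1 / 2 ∧ s₁ ≤ 2
  | .dirichlet, s, s₁ => 0 ≤ s₁ ∧ s₁ < s - 1 / 2 ∧ s - 1 / 2 < 2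

end

end KGChain

open KGChain

/-!
# The resonant normal form of the Klein–Gordon chain, uniformly in the number of particles

In the complex Fourier coordinates `ψ_k`, `ψ̄_k` the Hamiltonian is a polynomial: `H₀` is
`∑_k ω_k |ψ_k|²`, and `H₁`, `H₂` are given by symmetric tensors on the index set
`modes × {ψ, ψ̄}`. For `a < 1/3` all frequencies lie in an interval `[1, 2 - γ]` with `γ > 0`
(`isNonresonant_modeFreq`). Hence no combination of three signed frequencies is small, and a
combination of four can be small only if it has two signs of each kind
(`IsNonresonant.le_abs_add₃`, `IsNonresonant.le_abs_add₄`). The two homological equations, for a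
cubic generator that removes `H₁` and a quartic generator that removes the monomials of degree four
with different numbers of `ψ` and `ψ̄`, are therefore solved by division
(`homological_cubic`, `homological_quartic`). The monomials that remain form `Z`, which commutes
with `∑_k |ψ_k|²`.

**The transformation.** Let `X = Q + K` be the Hamiltonian field of the sum of the two generators,
with `Q` quadratic and `K` cubic. In place of the time-one flow of `X`, the transformation is one
step of the implicit midpoint rule (`midpointMap`), `m - X(m)/2 ↦ m + X(m)/2`. It is symplectic,
because `DX(m)` is infinitesimally symplectic (`midpointMap_symplectic`), it is analytic by the
inverse function theorem, and it differs from the flow only by terms of degree at least four in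
`ψ`, which affect `H ∘ T` in degree five and higher. The midpoint is defined as the limit of a
Picard iteration, so that one map, independent of `s` and `σ`, serves all norms. The Hamiltonian
field of `R = H ∘ T - H₀ - Z` solves `Y + DX(m) Y / 2 = G(m)`, and the two homological equations
cancel all terms of `G` of degree at most three (`remainder_field_eq`, `remainder_bound`).

**Uniformity in `N`.** All bounds follow from one fact, `prodMaj_bdd`: for admissible `(s, σ)` the
norm `‖·‖_{s,σ}`, normalized by `μ`, is an algebra norm for the pointwise product of sequences
`ψ_j`, with a constant independent of `N`, and this persists when the coefficients
`c_{mkl} = ∑_j ê_m(j) ê_k(j) ê_l(j)` are replaced by their absolute values. With periodic boundary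
conditions `c_{mkl}` lives on `m ± k ± l ≡ 0`, and the bound is Young's inequality. With Dirichlet
conditions the `ê_k` are not closed under products: `c_{mkl}` vanishes for even `m + k + l`, and
otherwise has the closed form of `sum_dirichlet_sin_mul_odd`. Where `m` is comparable to `k` or
`l`, this decays like a summable function of `m ± k ± l`. Where `m` dominates, it is of size
`k l / m³`, and the weighted kernel is square summable exactly for `s < 5/2`. The quartic
coefficients need no separate treatment, since by completeness of the basis they are the
contraction of `c` with itself (`isContraction_quadC`), as are the tensors of Poisson brackets.

**The leading terms.** The function `χ₀₁` is the cubic generator and `Z₀` the normal form that the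
same formulas give for `ω ≡ 1` (`chi01_eq`, `Z0_eq`). All tensors are Lipschitz in the
frequencies, and `0 ≤ ω_k - 1 ≤ 8 a (μ [k])^{s₁}` for `0 ≤ s₁ ≤ 2` (`freq_sub_one_le`). The
factor `[k]^{s₁}` is paid for by passing from `s` to `s - s₁`, with the algebra property at both
exponents (`IsLossy`, `isLossy_freq`).
-/

namespace KGChain

open Filter Topology
open scoped ComplexConjugate

/-! ### The implicit midpoint transformation -/

section Midpoint

open scoped ContDiff

variable {V : Type*} [NormedAddCommGroup V] [NormedSpace ℝ V]

/-- The vector field with quadratic part `Q` and cubic part `K`. -/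
noncomputable def polyField (Q : V →L[ℝ] V →L[ℝ] V) (K : V →L[ℝ] V →L[ℝ] V →L[ℝ] V) (m : V) : V :=
  Q m m + K m m m

/-- The derivative of `polyField Q K` at `m`, for symmetric `Q` and `K`. -/
noncomputable def polyFieldDeriv (Q : V →L[ℝ] V →L[ℝ] V) (K : V →L[ℝ] V →L[ℝ] V →L[ℝ] V) (m : V) :
    V →L[ℝ] V :=
  (2 : ℝ) • Q m + (3 : ℝ) • K m m

/-- The solution `m` of `m = ψ + X(m) / 2`, obtained as the limit of the Picard iteration started
at `0`. The limit is taken in the topology of `V`, so that the solution does not depend on the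
norm in which the iteration is shown to contract. -/
noncomputable def midpointOf (X : V → V) (ψ : V) : V :=
  limUnder atTop (fun n : ℕ => (fun m => ψ + (1 / 2 : ℝ) • X m)^[n] 0)

/-- One step of the implicit midpoint rule for the vector field `X`: it maps `m - X(m) / 2` to
`m + X(m) / 2`. -/
noncomputable def midpointMap (X : V → V) (ψ : V) : V :=
  midpointOf X ψ + (1 / 2 : ℝ) • X (midpointOf X ψ)

/-- The seminorm `p` induces the topology of `V`. -/
structure IsAdmissibleNorm (p : Seminorm ℝ V) : Prop where
  cont : Continuous p
  bound : ∃ C : ℝ, ∀ x, ‖x‖ ≤ C * p x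

/-- The field `X` is nonexpansive on the `p`-ball of radius `r`, and vanishes at `0`. -/
structure IsNonexpansive (p : Seminorm ℝ V) (r : ℝ) (X : V → V) : Prop where
  zero : X 0 = 0
  le : ∀ m m', p m ≤ r → p m' ≤ r → p (X m - X m') ≤ p (m - m')

theorem IsAdmissibleNorm.eq_zero {p : Seminorm ℝ V} (hp : IsAdmissibleNorm p) {x : V}
    (hx : p x ≤ 0) : x = 0 := by
  obtain ⟨C, hC⟩ := hp.bound
  have h0 : p x = 0 := le_antisymm hx (apply_nonneg p x)
  have := hC x
  rw [h0, mul_zero] at this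
  exact norm_le_zero_iff.1 this

theorem IsNonexpansive.self_le {p : Seminorm ℝ V} {r : ℝ} {X : V → V} (hX : IsNonexpansive p r X)
    {m : V} (hm : p m ≤ r) : p (X m) ≤ p m := by
  have hr : p (0 : V) ≤ r := by
    rw [map_zero]; exact (apply_nonneg p m).trans hm
  simpa [hX.zero] using hX.le m 0 hm hr

theorem seminorm_half_smul (p : Seminorm ℝ V) (x : V) : p ((1 / 2 : ℝ) • x) = p x / 2 := by
  rw [map_smul_eq_mul]
  norm_num
  ring

/-- The Picard iteration stays in the ball of radius `2 * p ψ`, where it is a contraction with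
constant `1 / 2`, so it converges to a solution. -/
theorem midpointOf_spec [CompleteSpace V] {p : Seminorm ℝ V} (hp : IsAdmissibleNorm p) {r : ℝ}
    {X : V → V} (hX : IsNonexpansive p r X) (hc : Continuous X) {ψ : V} (hψ : p ψ ≤ r / 2) :
    p (midpointOf X ψ) ≤ 2 * p ψ ∧ midpointOf X ψ = ψ + (1 / 2 : ℝ) • X (midpointOf X ψ) := by
  set Φ : V → V := fun m => ψ + (1 / 2 : ℝ) • X m with hΦ
  set u : ℕ → V := fun n => Φ^[n] 0 with hu
  have hus : ∀ n, u (n + 1) = Φ (u n) := fun n => by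
    simp only [hu, Function.iterate_succ_apply']
  have hub : ∀ n, p (u n) ≤ 2 * p ψ := by
    intro n
    induction n with
    | zero => simp [hu]
    | succ n ih =>
      rw [hus]
      have h1 := map_add_le_add p ψ ((1 / 2 : ℝ) • X (u n))
      rw [seminorm_half_smul] at h1
      have h2 := hX.self_le (m := u n) (by linarith)
      simp only [hΦ]
      linarith
  have hud : ∀ n, p (u n - u (n + 1)) ≤ p ψ / 2 ^ n := by
    intro n
    induction n with
    | zero =>
      have : u 0 - u 1 = -ψ := by
        rw [show (1 : ℕ) = 0 + 1 from rfl, hus]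
        simp [hu, hΦ, hX.zero]
      rw [this, map_neg_eq_map]
      simp
    | succ n ih =>
      have h1 : u (n + 1) - u (n + 1 + 1) = (1 / 2 : ℝ) • (X (u n) - X (u (n + 1))) := by
        rw [hus (n + 1), hus n]
        simp only [hΦ]
        module
      rw [h1, seminorm_half_smul]
      have h2 := hX.le (u n) (u (n + 1)) (by linarith [hub n]) (by linarith [hub (n + 1)])
      rw [pow_succ, ← div_div]
      linarith
  obtain ⟨C, hC⟩ := hp.bound
  have hcau : CauchySeq u := by
    refine cauchySeq_of_le_geometric_two (C := 2 * (|C| * p ψ)) fun n => ?_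
    rw [dist_eq_norm]
    have h3 : (0 : ℝ) ≤ p (u n - u (n + 1)) := apply_nonneg p _
    calc ‖u n - u (n + 1)‖ ≤ C * p (u n - u (n + 1)) := hC _
      _ ≤ |C| * p (u n - u (n + 1)) := by gcongr; exact le_abs_self C
      _ ≤ |C| * (p ψ / 2 ^ n) := by gcongr; exact hud n
      _ = 2 * (|C| * p ψ) / 2 / 2 ^ n := by ring
  have hlim : Tendsto u atTop (𝓝 (midpointOf X ψ)) := hcau.tendsto_limUnder
  constructor
  · exact le_of_tendsto (hp.cont.continuousAt.tendsto.comp hlim) (Eventually.of_forall hub)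
  · have h1 : Tendsto (fun n => u (n + 1)) atTop (𝓝 (Φ (midpointOf X ψ))) := by
      simp only [hus]
      have hΦc : Continuous Φ := by fun_prop
      exact hΦc.continuousAt.tendsto.comp hlim
    exact tendsto_nhds_unique ((tendsto_add_atTop_iff_nat 1).2 hlim) h1

/-- `m ↦ m - X(m) / 2` and `m ↦ m + X(m) / 2` are both injective with Lipschitz inverse. -/
theorem IsNonexpansive.sub_le {p : Seminorm ℝ V} {r : ℝ} {X : V → V} (hX : IsNonexpansive p r X)
    {m m' : V} (hm : p m ≤ r) (hm' : p m' ≤ r) {c : ℝ} (hc : |c| = 1 / 2) :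
    p (m - m') ≤ 2 * p ((m + c • X m) - (m' + c • X m')) := by
  have h1 : m - m' = ((m + c • X m) - (m' + c • X m')) - c • (X m - X m') := by module
  have h2 := map_sub_le_add p ((m + c • X m) - (m' + c • X m')) (c • (X m - X m'))
  rw [← h1, map_smul_eq_mul, Real.norm_eq_abs, hc] at h2
  linarith [hX.le m m' hm hm']

theorem midpointMap_injOn [CompleteSpace V] {p : Seminorm ℝ V} (hp : IsAdmissibleNorm p) {r : ℝ}
    {X : V → V} (hX : IsNonexpansive p r X) (hc : Continuous X) :
    Set.InjOn (midpointMap X) {ψ | p ψ < r / 2} := by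
  intro ψ hψ ψ' hψ' h
  simp only [Set.mem_ofPred_eq] at hψ hψ'
  obtain ⟨h1, h2⟩ := midpointOf_spec hp hX hc hψ.le
  obtain ⟨h1', h2'⟩ := midpointOf_spec hp hX hc hψ'.le
  have h3 := hX.sub_le (m := midpointOf X ψ) (m' := midpointOf X ψ') (by linarith) (by linarith)
    (c := 1 / 2) (by norm_num)
  simp only [midpointMap] at h
  rw [h, sub_self, map_zero, mul_zero] at h3
  have h4 := sub_eq_zero.1 (hp.eq_zero h3)
  rw [h4] at h2
  exact add_right_cancel (h2.symm.trans h2')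

theorem continuousAt_midpointOf [CompleteSpace V] {p : Seminorm ℝ V} (hp : IsAdmissibleNorm p)
    {r : ℝ} {X : V → V} (hX : IsNonexpansive p r X) (hc : Continuous X) {ψ : V}
    (hψ : p ψ < r / 2) : ContinuousAt (midpointOf X) ψ := by
  obtain ⟨C, hC⟩ := hp.bound
  have hev : ∀ᶠ φ in 𝓝 ψ, p φ < r / 2 := hp.cont.continuousAt.eventually_lt continuousAt_const hψ
  rw [ContinuousAt, tendsto_iff_norm_sub_tendsto_zero]
  have hlim : Tendsto (fun φ => |C| * (2 * p (φ - ψ))) (𝓝 ψ) (𝓝 0) := by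
    have : Continuous fun φ => |C| * (2 * p (φ - ψ)) :=
      continuous_const.mul (continuous_const.mul (hp.cont.comp (continuous_id.sub continuous_const)))
    simpa using this.tendsto ψ
  refine squeeze_zero' (Eventually.of_forall fun _ => norm_nonneg _) ?_ hlim
  filter_upwards [hev] with φ hφ
  obtain ⟨h1, h2⟩ := midpointOf_spec hp hX hc hψ.le
  obtain ⟨h1', h2'⟩ := midpointOf_spec hp hX hc hφ.le
  have h3 := hX.sub_le (m := midpointOf X φ) (m' := midpointOf X ψ) (by linarith) (by linarith)
    (c := -(1 / 2)) (by norm_num)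
  have h4 : ∀ χ : V, midpointOf X χ = χ + (1 / 2 : ℝ) • X (midpointOf X χ) →
      midpointOf X χ + (-(1 / 2) : ℝ) • X (midpointOf X χ) = χ := by
    intro χ h
    nth_rewrite 1 [h]
    module
  rw [h4 φ h2', h4 ψ h2] at h3
  have h5 : (0 : ℝ) ≤ p (midpointOf X φ - midpointOf X ψ) := apply_nonneg p _
  calc _ ≤ C * p (midpointOf X φ - midpointOf X ψ) := hC _
    _ ≤ |C| * p (midpointOf X φ - midpointOf X ψ) := by gcongr; exact le_abs_self C
    _ ≤ _ := by gcongr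

/-- The midpoint depends analytically on the initial point, and its derivative inverts that of
`m ↦ m - X(m) / 2`. -/
theorem analyticAt_midpointOf [FiniteDimensional ℝ V] {p : Seminorm ℝ V}
    (hp : IsAdmissibleNorm p) {r : ℝ} {X : V → V} (hX : IsNonexpansive p r X)
    (hXa : ContDiff ℝ ω X) {S : V → V →L[ℝ] V} (hS : ∀ m, HasFDerivAt X (S m) m)
    (hSp : ∀ m, p m ≤ r → ∀ v, p (S m v) ≤ p v) {ψ : V} (hψ : p ψ < r / 2) :
    AnalyticAt ℝ (midpointOf X) ψ ∧
      (∀ u, fderiv ℝ (midpointOf X) ψ u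
        - (1 / 2 : ℝ) • S (midpointOf X ψ) (fderiv ℝ (midpointOf X) ψ u) = u) ∧
      ∀ u, fderiv ℝ (midpointOf X) ψ (u - (1 / 2 : ℝ) • S (midpointOf X ψ) u) = u := by
  have : CompleteSpace V := FiniteDimensional.complete ℝ V
  have hc : Continuous X := hXa.continuous
  obtain ⟨h1, h2⟩ := midpointOf_spec hp hX hc hψ.le
  set m₀ := midpointOf X ψ with hm₀
  set A : V → V := fun m => m - (1 / 2 : ℝ) • X m with hA
  set A' : V →L[ℝ] V := ContinuousLinearMap.id ℝ V - (1 / 2 : ℝ) • S m₀ with hA'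
  have hAd : HasFDerivAt A A' m₀ := (hasFDerivAt_id m₀).sub ((hS m₀).const_smul (1 / 2 : ℝ))
  have hinj : Function.Injective A' := by
    rw [injective_iff_map_eq_zero]
    intro v hv
    apply hp.eq_zero
    have h3 : v = (1 / 2 : ℝ) • S m₀ v := by
      simpa [hA', sub_eq_zero] using hv
    have h4 := hSp m₀ (by linarith) v
    have h5 : p v = p (S m₀ v) / 2 := by
      nth_rewrite 1 [h3]
      rw [seminorm_half_smul]
    linarith
  set e : V ≃L[ℝ] V :=
    (LinearEquiv.ofInjectiveEndo A'.toLinearMap hinj).toContinuousLinearEquiv with he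
  have hee : (e : V →L[ℝ] V) = A' := by ext v; rfl
  have hAe : HasFDerivAt A (e : V →L[ℝ] V) m₀ := hee ▸ hAd
  have hAc : ContDiffAt ℝ ω A m₀ :=
    (contDiff_id.sub (contDiff_const.smul hXa)).contDiffAt
  have hω : (ω : ℕ∞ω) ≠ 0 := by simp
  have hAψ : A m₀ = ψ := by
    simp only [hA]
    nth_rewrite 1 [h2]
    module
  have hloc := hAc.to_localInverse hAe hω
  have hleft := (hAc.hasStrictFDerivAt' hAe hω).eventually_left_inverse
  have hev : ∀ᶠ φ in 𝓝 ψ, p φ < r / 2 := hp.cont.continuousAt.eventually_lt continuousAt_const hψ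
  have hAφ : ∀ᶠ φ in 𝓝 ψ, A (midpointOf X φ) = φ := by
    filter_upwards [hev] with φ hφ
    simp only [hA]
    nth_rewrite 1 [(midpointOf_spec hp hX hc hφ.le).2]
    module
  have heq : midpointOf X =ᶠ[𝓝 ψ] hAc.localInverse hAe hω := by
    have := (continuousAt_midpointOf hp hX hc hψ).eventually hleft
    filter_upwards [this, hAφ] with φ h3 h4
    rw [h4] at h3
    exact h3.symm
  rw [hAψ] at hloc
  have han : AnalyticAt ℝ (midpointOf X) ψ := (hloc.congr_of_eventuallyEq heq).analyticAt
  have hmd := han.differentiableAt.hasFDerivAt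
  have hcomp : HasFDerivAt (A ∘ midpointOf X) (A' ∘L fderiv ℝ (midpointOf X) ψ) ψ :=
    HasFDerivAt.comp ψ hAd hmd
  have hid : HasFDerivAt (A ∘ midpointOf X) (ContinuousLinearMap.id ℝ V) ψ :=
    (hasFDerivAt_id ψ).congr_of_eventuallyEq hAφ
  have hAM := hcomp.unique hid
  have hr : ∀ u, A' (fderiv ℝ (midpointOf X) ψ u) = u := fun u => congrArg (fun f => f u) hAM
  refine ⟨han, fun u => ?_, fun u => ?_⟩
  · simpa [hA'] using hr u
  · apply hinj
    have := hr (u - (1 / 2 : ℝ) • S m₀ u)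
    rw [this]
    simp [hA']

theorem midpointMap_fderiv [FiniteDimensional ℝ V] {p : Seminorm ℝ V}
    (hp : IsAdmissibleNorm p) {r : ℝ} {X : V → V} (hX : IsNonexpansive p r X)
    (hXa : ContDiff ℝ ω X) {S : V → V →L[ℝ] V} (hS : ∀ m, HasFDerivAt X (S m) m)
    (hSp : ∀ m, p m ≤ r → ∀ v, p (S m v) ≤ p v) {ψ : V} (hψ : p ψ < r / 2) :
    AnalyticAt ℝ (midpointMap X) ψ ∧
      ∀ u, fderiv ℝ (midpointMap X) ψ u = fderiv ℝ (midpointOf X) ψ u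
        + (1 / 2 : ℝ) • S (midpointOf X ψ) (fderiv ℝ (midpointOf X) ψ u) := by
  obtain ⟨han, -, -⟩ := analyticAt_midpointOf hp hX hXa hS hSp hψ
  have hXan : AnalyticAt ℝ X (midpointOf X ψ) := hXa.contDiffAt.analyticAt
  refine ⟨han.add ((analyticAt_const).smul (hXan.comp han)), fun u => ?_⟩
  have hmd := han.differentiableAt.hasFDerivAt
  have h1 : HasFDerivAt (midpointMap X) (fderiv ℝ (midpointOf X) ψ
      + (1 / 2 : ℝ) • (S (midpointOf X ψ) ∘L fderiv ℝ (midpointOf X) ψ)) ψ :=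
    hmd.add (((hS _).comp ψ hmd).const_smul (1 / 2 : ℝ))
  rw [h1.fderiv]
  simp

/-- The implicit midpoint rule of a Hamiltonian field is symplectic: if `S` is infinitesimally
symplectic, then `1 + S / 2` and `1 - S / 2` pull the symplectic form back to the same form. -/
theorem midpointMap_symplectic [FiniteDimensional ℝ V] {p : Seminorm ℝ V}
    (hp : IsAdmissibleNorm p) {r : ℝ} {X : V → V} (hX : IsNonexpansive p r X)
    (hXa : ContDiff ℝ ω X) {S : V → V →L[ℝ] V} (hS : ∀ m, HasFDerivAt X (S m) m)
    (hSp : ∀ m, p m ≤ r → ∀ v, p (S m v) ≤ p v) (Ω : V →L[ℝ] V →L[ℝ] ℝ)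
    (hΩ : ∀ m u v, Ω (S m u) v = -Ω u (S m v)) {ψ : V} (hψ : p ψ < r / 2) (u v : V) :
    Ω (fderiv ℝ (midpointMap X) ψ u) (fderiv ℝ (midpointMap X) ψ v) = Ω u v := by
  obtain ⟨-, h1, -⟩ := analyticAt_midpointOf hp hX hXa hS hSp hψ
  obtain ⟨-, h2⟩ := midpointMap_fderiv hp hX hXa hS hSp hψ
  rw [h2, h2]
  nth_rewrite 3 [← h1 u]
  nth_rewrite 3 [← h1 v]
  simp only [map_add, map_sub, map_smul, add_apply, sub_apply,
    smul_apply, smul_eq_mul, hΩ]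
  ring

end Midpoint

/-! ### Polynomial fields and the remainder of the transformed Hamiltonian -/

section Remainder

open scoped ContDiff

variable {V : Type*} [NormedAddCommGroup V] [NormedSpace ℝ V]

/-- `Q` is a symmetric bilinear map. -/
def IsSymm₂ (Q : V →L[ℝ] V →L[ℝ] V) : Prop := ∀ u v, Q u v = Q v u

/-- `K` is a symmetric trilinear map. -/
def IsSymm₃ (K : V →L[ℝ] V →L[ℝ] V →L[ℝ] V) : Prop :=
  ∀ u v w, K u v w = K v u w ∧ K u v w = K u w v

/-- The bilinear map `Q` is bounded by `b` in the seminorm `p`. -/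
def Bdd₂ (p : Seminorm ℝ V) (b : ℝ) (Q : V →L[ℝ] V →L[ℝ] V) : Prop :=
  ∀ u v, p (Q u v) ≤ b * p u * p v

/-- The trilinear map `K` is bounded by `b` in the seminorm `p`. -/
def Bdd₃ (p : Seminorm ℝ V) (b : ℝ) (K : V →L[ℝ] V →L[ℝ] V →L[ℝ] V) : Prop :=
  ∀ u v w, p (K u v w) ≤ b * p u * p v * p w

theorem contDiff_polyField (Q : V →L[ℝ] V →L[ℝ] V) (K : V →L[ℝ] V →L[ℝ] V →L[ℝ] V) :
    ContDiff ℝ ω (polyField Q K) := by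
  unfold polyField
  fun_prop

theorem hasFDerivAt_polyField {Q : V →L[ℝ] V →L[ℝ] V} {K : V →L[ℝ] V →L[ℝ] V →L[ℝ] V}
    (hQ : IsSymm₂ Q) (hK : IsSymm₃ K) (m : V) :
    HasFDerivAt (polyField Q K) (polyFieldDeriv Q K m) m := by
  have hid := hasFDerivAt_id (𝕜 := ℝ) m
  have h1 : HasFDerivAt (fun x => Q x x) _ m := (Q.hasFDerivAt (x := m)).clm_apply hid
  have h2 : HasFDerivAt (fun x => K x x x) _ m :=
    ((K.hasFDerivAt (x := m)).clm_apply hid).clm_apply hid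
  refine (h1.add h2).congr_fderiv ?_
  ext v
  simp only [polyFieldDeriv, add_apply, ContinuousLinearMap.comp_apply,
    ContinuousLinearMap.flip_apply, ContinuousLinearMap.id_apply, smul_apply, id]
  rw [hQ v m, (hK v m m).1, (hK m v m).2]
  module

theorem trilinear_sub (K : V →L[ℝ] V →L[ℝ] V →L[ℝ] V) (m m' : V) :
    K m m m - K m' m' m' = K m m (m - m') + K m (m - m') m' + K (m - m') m' m' := by
  simp only [map_sub, sub_apply]
  abel

theorem polyField_sub_le {p : Seminorm ℝ V} {b : ℝ} {Q : V →L[ℝ] V →L[ℝ] V}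
    {K : V →L[ℝ] V →L[ℝ] V →L[ℝ] V} (hb : 0 ≤ b) (hQ : Bdd₂ p b Q) (hK : Bdd₃ p b K) {r : ℝ}
    (hr : r ≤ 1) {m m' : V} (hm : p m ≤ r) (hm' : p m' ≤ r) :
    p (polyField Q K m - polyField Q K m') ≤ 5 * b * r * p (m - m') := by
  have h0 := apply_nonneg p m
  have h0' := apply_nonneg p m'
  have hd := apply_nonneg p (m - m')
  have hr0 : 0 ≤ r := h0.trans hm
  have h1 : polyField Q K m - polyField Q K m'
      = Q m (m - m') + Q (m - m') m' + K m m (m - m') + K m (m - m') m' + K (m - m') m' m' := by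
    have := trilinear_sub K m m'
    have h2 : Q m m - Q m' m' = Q m (m - m') + Q (m - m') m' := by
      simp only [map_sub, sub_apply]
      abel
    simp only [polyField]
    rw [add_sub_add_comm, this, h2]
    abel
  have e1 : p (Q m (m - m')) ≤ b * r * p (m - m') := (hQ _ _).trans (by gcongr)
  have e2 : p (Q (m - m') m') ≤ b * r * p (m - m') :=
    (hQ _ _).trans (by rw [mul_right_comm]; gcongr)
  have hrr : r * r ≤ r := by nlinarith
  have hbd : 0 ≤ b * p (m - m') := by positivity
  have e3 : p (K m m (m - m')) ≤ b * r * p (m - m') := by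
    calc _ ≤ _ := hK _ _ _
      _ ≤ b * r * r * p (m - m') := by gcongr
      _ = (r * r) * (b * p (m - m')) := by ring
      _ ≤ r * (b * p (m - m')) := by gcongr
      _ = _ := by ring
  have e4 : p (K m (m - m') m') ≤ b * r * p (m - m') := by
    calc _ ≤ _ := hK _ _ _
      _ ≤ b * r * p (m - m') * r := by gcongr
      _ = (r * r) * (b * p (m - m')) := by ring
      _ ≤ r * (b * p (m - m')) := by gcongr
      _ = _ := by ring
  have e5 : p (K (m - m') m' m') ≤ b * r * p (m - m') := by
    calc _ ≤ _ := hK _ _ _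
      _ ≤ b * p (m - m') * r * r := by gcongr
      _ = (r * r) * (b * p (m - m')) := by ring
      _ ≤ r * (b * p (m - m')) := by gcongr
      _ = _ := by ring
  rw [h1]
  have t1 := map_add_le_add p (Q m (m - m') + Q (m - m') m' + K m m (m - m') + K m (m - m') m')
    (K (m - m') m' m')
  have t2 := map_add_le_add p (Q m (m - m') + Q (m - m') m' + K m m (m - m')) (K m (m - m') m')
  have t3 := map_add_le_add p (Q m (m - m') + Q (m - m') m') (K m m (m - m'))
  have t4 := map_add_le_add p (Q m (m - m')) (Q (m - m') m')
  linarith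

theorem polyFieldDeriv_le {p : Seminorm ℝ V} {b : ℝ} {Q : V →L[ℝ] V →L[ℝ] V}
    {K : V →L[ℝ] V →L[ℝ] V →L[ℝ] V} (hb : 0 ≤ b) (hQ : Bdd₂ p b Q) (hK : Bdd₃ p b K)
    {m : V} (hm : p m ≤ 1) (v : V) :
    p (polyFieldDeriv Q K m v) ≤ 5 * b * p m * p v := by
  have h0 := apply_nonneg p m
  have hv := apply_nonneg p v
  simp only [polyFieldDeriv, add_apply, smul_apply]
  have t1 := map_add_le_add p ((2 : ℝ) • Q m v) ((3 : ℝ) • K m m v)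
  rw [map_smul_eq_mul, map_smul_eq_mul, Real.norm_ofNat, Real.norm_ofNat] at t1
  have e1 := hQ m v
  have e2 : p (K m m v) ≤ b * p m * p v := by
    calc _ ≤ _ := hK _ _ _
      _ ≤ b * p m * 1 * p v := by gcongr
      _ = _ := by ring
  linarith

/-- On the `p`-ball of radius `r ≤ 1` the field `Q + K` has Lipschitz constant `5 * b * r`, which
is `1` for `r = 1 / (5 * b)`. -/
theorem isNonexpansive_polyField {p : Seminorm ℝ V} {b : ℝ} {Q : V →L[ℝ] V →L[ℝ] V}
    {K : V →L[ℝ] V →L[ℝ] V →L[ℝ] V} (hb : 1 ≤ b) (hQ : Bdd₂ p b Q) (hK : Bdd₃ p b K) :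
    IsNonexpansive p (1 / (5 * b)) (polyField Q K) := by
  refine ⟨by simp [polyField], fun m m' hm hm' => ?_⟩
  have hr : 1 / (5 * b) ≤ 1 := by
    rw [div_le_one (by positivity)]; linarith
  have := polyField_sub_le (by linarith) hQ hK hr hm hm'
  rwa [mul_one_div_cancel (by positivity), one_mul] at this

theorem polyField_le {p : Seminorm ℝ V} {b : ℝ} {Q : V →L[ℝ] V →L[ℝ] V}
    {K : V →L[ℝ] V →L[ℝ] V →L[ℝ] V} (hb : 0 ≤ b) (hQ : Bdd₂ p b Q) (hK : Bdd₃ p b K)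
    {m : V} (hm : p m ≤ 1) : p (polyField Q K m) ≤ 2 * b * p m ^ 2 := by
  have h0 := apply_nonneg p m
  have t1 := map_add_le_add p (Q m m) (K m m m)
  have e1 := hQ m m
  have e2 : p (K m m m) ≤ b * p m ^ 2 := by
    calc _ ≤ _ := hK _ _ _
      _ ≤ b * p m * p m * 1 := by gcongr
      _ = _ := by ring
  simp only [polyField]
  nlinarith

/-- The algebraic identity behind the normal form: once the two homological equations hold, the
terms of degree at most three cancel in the field that governs the remainder. -/
theorem remainder_field_eq {L : V →L[ℝ] V} {B Q : V →L[ℝ] V →L[ℝ] V}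
    {C K W : V →L[ℝ] V →L[ℝ] V →L[ℝ] V} (hB : IsSymm₂ B) {m : V}
    (hom₂ : L (Q m m) - (2 : ℝ) • Q m (L m) + B m m = 0)
    (hom₃ : L (K m m m) - (3 : ℝ) • K m m (L m) + C m m m + B (Q m m) m - Q (B m m) m = W m m m)
    (hQ : IsSymm₂ Q) {X c w : V} (hX : X = Q m m + K m m m) (S : V →L[ℝ] V)
    (hS : S = polyFieldDeriv Q K m) :
    (L (m + (1 / 2 : ℝ) • X) + B (m + (1 / 2 : ℝ) • X) (m + (1 / 2 : ℝ) • X) + c)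
      - (1 / 2 : ℝ) • S (L (m + (1 / 2 : ℝ) • X)
          + B (m + (1 / 2 : ℝ) • X) (m + (1 / 2 : ℝ) • X) + c)
      - ((L (m - (1 / 2 : ℝ) • X) + w) + (1 / 2 : ℝ) • S (L (m - (1 / 2 : ℝ) • X) + w))
    = B m (K m m m) + (1 / 4 : ℝ) • B X X + (c - C m m m)
      - (3 / 2 : ℝ) • K m m (B m m)
      - (1 / 2 : ℝ) • S (B m X + (1 / 4 : ℝ) • B X X + c)
      - (w - W m m m) - (1 / 2 : ℝ) • S w := by
  have e1 : L X = L (Q m m) + L (K m m m) := by rw [hX, map_add]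
  have e2 : S (L m) = (2 : ℝ) • Q m (L m) + (3 : ℝ) • K m m (L m) := by
    rw [hS]; simp [polyFieldDeriv]
  have e3 : S (B m m) = (2 : ℝ) • Q m (B m m) + (3 : ℝ) • K m m (B m m) := by
    rw [hS]; simp [polyFieldDeriv]
  have e4 : B m X = B m (Q m m) + B m (K m m m) := by rw [hX, map_add]
  have e5 : W m m m = L (K m m m) - (3 : ℝ) • K m m (L m) + C m m m + B m (Q m m)
      - Q m (B m m) := by rw [← hom₃, hB (Q m m) m, hQ (B m m) m]
  have e6 : B m m = (2 : ℝ) • Q m (L m) - L (Q m m) := by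
    linear_combination (norm := module) (1 : ℝ) • hom₂
  have e7 : B (m + (1 / 2 : ℝ) • X) (m + (1 / 2 : ℝ) • X)
      = B m m + B m X + (1 / 4 : ℝ) • B X X := by
    simp only [map_add, map_smul, add_apply, smul_apply]
    rw [hB X m]
    module
  rw [e7]
  simp only [map_add, map_sub, map_smul]
  rw [e1, e2, e3, e5]
  have e8 : B m m - ((2 : ℝ) • Q m (L m) - L (Q m m)) = 0 := sub_eq_zero.2 e6
  rw [e4]
  simp only [map_add]
  linear_combination (norm := module) (1 : ℝ) • e8

/-- Every term on the right-hand side of `remainder_field_eq` is of order four in `m`. -/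
theorem remainder_field_le {p : Seminorm ℝ V} {b : ℝ} (hb : 1 ≤ b) {B Q : V →L[ℝ] V →L[ℝ] V}
    {C K W : V →L[ℝ] V →L[ℝ] V →L[ℝ] V}
    (hB : Bdd₂ p b B) (hQ : Bdd₂ p b Q) (hC : Bdd₃ p b C) (hK : Bdd₃ p b K) (hW : Bdd₃ p b W)
    {m : V} (htr : p m ≤ 1 / (5 * b)) :
    let X := polyField Q K m
    let S := polyFieldDeriv Q K m
    let c := C (m + (1 / 2 : ℝ) • X) (m + (1 / 2 : ℝ) • X) (m + (1 / 2 : ℝ) • X)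
    let w := W (m - (1 / 2 : ℝ) • X) (m - (1 / 2 : ℝ) • X) (m - (1 / 2 : ℝ) • X)
    p (B m (K m m m) + (1 / 4 : ℝ) • B X X + (c - C m m m)
      - (3 / 2 : ℝ) • K m m (B m m)
      - (1 / 2 : ℝ) • S (B m X + (1 / 4 : ℝ) • B X X + c)
      - (w - W m m m) - (1 / 2 : ℝ) • S w) ≤ 80 * (b ^ 4 * p m ^ 4) := by
  intro X S c w
  have hb0 : 0 ≤ b := by linarith
  have hX := isNonexpansive_polyField hb hQ hK
  have hr1 : 1 / (5 * b) ≤ 1 := by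
    rw [div_le_one (by positivity)]; linarith
  have hrb : 5 * b * (1 / (5 * b)) = 1 := by field_simp
  set t := p m with ht
  have ht0 : 0 ≤ t := apply_nonneg p m
  have ht1 : t ≤ 1 := htr.trans hr1
  have hx : p X ≤ 2 * b * t ^ 2 := polyField_le hb0 hQ hK ht1
  have hxt : p X ≤ t := hX.self_le htr
  have hx0 : 0 ≤ p X := apply_nonneg p X
  have hbt : b * t ≤ 1 := by
    have : 5 * b * t ≤ 1 := by rw [← hrb]; gcongr
    linarith
  have hbt0 : 0 ≤ b * t := by positivity
  have hSle : ∀ v, p (S v) ≤ 5 * b * t * p v := polyFieldDeriv_le hb0 hQ hK ht1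
  have hhalf : p ((1 / 2 : ℝ) • X) ≤ b * t ^ 2 := by rw [seminorm_half_smul]; linarith
  have hhalf' : p ((1 / 2 : ℝ) • X) ≤ t := by rw [seminorm_half_smul]; linarith
  have hpl : p (m + (1 / 2 : ℝ) • X) ≤ 2 * t := by
    linarith [map_add_le_add p m ((1 / 2 : ℝ) • X)]
  have hmi : p (m - (1 / 2 : ℝ) • X) ≤ 2 * t := by
    linarith [map_sub_le_add p m ((1 / 2 : ℝ) • X)]
  have tri : ∀ D : V →L[ℝ] V →L[ℝ] V →L[ℝ] V, Bdd₃ p b D → ∀ x, p x ≤ 2 * t →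
      p (x - m) ≤ b * t ^ 2 →
      p (D x x x) ≤ 8 * b * t ^ 3 ∧ p (D x x x - D m m m) ≤ 7 * (b ^ 2 * t ^ 4) := by
    intro D hD x hx1 hx2
    have hpx := apply_nonneg p x
    have hpxm := apply_nonneg p (x - m)
    constructor
    · calc _ ≤ _ := hD _ _ _
        _ ≤ b * (2 * t) * (2 * t) * (2 * t) := by gcongr
        _ = _ := by ring
    · rw [trilinear_sub]
      have e1 : p (D x x (x - m)) ≤ b * (2 * t) * (2 * t) * (b * t ^ 2) :=
        (hD _ _ _).trans (by gcongr)
      have e2 : p (D x (x - m) m) ≤ b * (2 * t) * (b * t ^ 2) * t := (hD _ _ _).trans (by gcongr)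
      have e3 : p (D (x - m) m m) ≤ b * (b * t ^ 2) * t * t := (hD _ _ _).trans (by gcongr)
      have t1 := map_add_le_add p (D x x (x - m) + D x (x - m) m) (D (x - m) m m)
      have t2 := map_add_le_add p (D x x (x - m)) (D x (x - m) m)
      linarith
  have hxp : (m + (1 / 2 : ℝ) • X) - m = (1 / 2 : ℝ) • X := by abel
  have hxm : p ((m - (1 / 2 : ℝ) • X) - m) ≤ b * t ^ 2 := by
    rw [show (m - (1 / 2 : ℝ) • X) - m = -((1 / 2 : ℝ) • X) by abel, map_neg_eq_map]
    exact hhalf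
  obtain ⟨hc1, hc2⟩ := tri C hC _ hpl (by rw [hxp]; exact hhalf)
  obtain ⟨hw1, hw2⟩ := tri W hW _ hmi hxm
  change p c ≤ _ at hc1
  change p (c - _) ≤ _ at hc2
  change p w ≤ _ at hw1
  change p (w - _) ≤ _ at hw2
  clear_value c w
  set q := b ^ 4 * t ^ 4 with hq
  have hq0 : 0 ≤ q := by positivity
  have hb12 : b ≤ b ^ 2 := by nlinarith
  have hb24 : b ^ 2 * t ^ 4 ≤ q := by
    have : b ^ 2 ≤ b ^ 4 := pow_le_pow_right₀ hb (by norm_num)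
    rw [hq]; gcongr
  have hb34 : b ^ 3 * t ^ 4 ≤ q := by
    have : b ^ 3 ≤ b ^ 4 := pow_le_pow_right₀ hb (by norm_num)
    rw [hq]; gcongr
  have e1 : p (B m (K m m m)) ≤ q := by
    calc _ ≤ _ := hB _ _
      _ ≤ b * t * (b * t * t * t) := by gcongr; exact hK _ _ _
      _ = b ^ 2 * t ^ 4 := by ring
      _ ≤ q := hb24
  have e2 : p ((1 / 4 : ℝ) • B X X) ≤ q := by
    rw [map_smul_eq_mul, show ‖(1 / 4 : ℝ)‖ = 1 / 4 by norm_num]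
    calc _ ≤ 1 / 4 * (b * p X * p X) := by gcongr; exact hB _ _
      _ ≤ 1 / 4 * (b * (2 * b * t ^ 2) * (2 * b * t ^ 2)) := by gcongr
      _ = b ^ 3 * t ^ 4 := by ring
      _ ≤ q := hb34
  have e3 : p (c - C m m m) ≤ 7 * q := by linarith
  have e4 : p ((3 / 2 : ℝ) • K m m (B m m)) ≤ 3 / 2 * q := by
    rw [map_smul_eq_mul, show ‖(3 / 2 : ℝ)‖ = 3 / 2 by norm_num]
    calc _ ≤ 3 / 2 * (b * t * t * (b * t * t)) := by
          gcongr; exact (hK _ _ _).trans (by gcongr; exact hB _ _)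
      _ = 3 / 2 * (b ^ 2 * t ^ 4) := by ring
      _ ≤ _ := by gcongr
  have e5 : p ((1 / 2 : ℝ) • S (B m X + (1 / 4 : ℝ) • B X X + c)) ≤ 35 * q := by
    rw [seminorm_half_smul]
    have f1 : p (B m X) ≤ 2 * b ^ 3 * t ^ 3 := by
      calc _ ≤ _ := hB _ _
        _ ≤ b * t * (2 * b * t ^ 2) := by gcongr
        _ = 2 * b ^ 2 * t ^ 3 := by ring
        _ ≤ _ := by gcongr; norm_num
    have f2 : p ((1 / 4 : ℝ) • B X X) ≤ b ^ 3 * t ^ 3 := by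
      rw [map_smul_eq_mul, show ‖(1 / 4 : ℝ)‖ = 1 / 4 by norm_num]
      calc _ ≤ 1 / 4 * (b * p X * p X) := by gcongr; exact hB _ _
        _ ≤ 1 / 4 * (b * (2 * b * t ^ 2) * (2 * b * t ^ 2)) := by gcongr
        _ = b ^ 3 * t ^ 3 * t := by ring
        _ ≤ b ^ 3 * t ^ 3 * 1 := by gcongr
        _ = _ := mul_one _
    have f3 : p c ≤ 8 * b ^ 3 * t ^ 3 := by
      refine hc1.trans ?_
      have : b ≤ b ^ 3 := le_self_pow₀ hb (by norm_num)
      gcongr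
    have t1 := map_add_le_add p (B m X + (1 / 4 : ℝ) • B X X) c
    have t2 := map_add_le_add p (B m X) ((1 / 4 : ℝ) • B X X)
    have f4 : p (B m X + (1 / 4 : ℝ) • B X X + c) ≤ 11 * b ^ 3 * t ^ 3 := by linarith
    have f5 : p (S (B m X + (1 / 4 : ℝ) • B X X + c)) ≤ 55 * q := by
      calc _ ≤ _ := hSle _
        _ ≤ 5 * b * t * (11 * b ^ 3 * t ^ 3) := by gcongr
        _ = 55 * q := by rw [hq]; ring
    linarith
  have e6 : p (w - W m m m) ≤ 7 * q := by linarith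
  have e7 : p ((1 / 2 : ℝ) • S w) ≤ 20 * q := by
    rw [seminorm_half_smul]
    have f5 : p (S w) ≤ 40 * q := by
      calc _ ≤ _ := hSle _
        _ ≤ 5 * b * t * (8 * b * t ^ 3) := by gcongr
        _ = 40 * (b ^ 2 * t ^ 4) := by ring
        _ ≤ _ := by gcongr
    linarith
  clear_value S
  have t1 := map_sub_le_add p (B m (K m m m) + (1 / 4 : ℝ) • B X X + (c - C m m m)
    - (3 / 2 : ℝ) • K m m (B m m) - (1 / 2 : ℝ) • S (B m X + (1 / 4 : ℝ) • B X X + c)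
    - (w - W m m m)) ((1 / 2 : ℝ) • S w)
  have t2 := map_sub_le_add p (B m (K m m m) + (1 / 4 : ℝ) • B X X + (c - C m m m)
    - (3 / 2 : ℝ) • K m m (B m m) - (1 / 2 : ℝ) • S (B m X + (1 / 4 : ℝ) • B X X + c))
    (w - W m m m)
  have t3 := map_sub_le_add p (B m (K m m m) + (1 / 4 : ℝ) • B X X + (c - C m m m)
    - (3 / 2 : ℝ) • K m m (B m m)) ((1 / 2 : ℝ) • S (B m X + (1 / 4 : ℝ) • B X X + c))
  have t4 := map_sub_le_add p (B m (K m m m) + (1 / 4 : ℝ) • B X X + (c - C m m m))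
    ((3 / 2 : ℝ) • K m m (B m m))
  have t5 := map_add_le_add p (B m (K m m m) + (1 / 4 : ℝ) • B X X) (c - C m m m)
  have t6 := map_add_le_add p (B m (K m m m)) ((1 / 4 : ℝ) • B X X)
  linarith

/-- If `H` has the Hamiltonian field `L + B + C` and `F` has the Hamiltonian field `L + W`, and
the homological equations hold, then `H ∘ T - F` has a Hamiltonian field of order four, where `T`
is the midpoint map of `Q + K`. With `T ψ = m + X(m) / 2` and `ψ = m - X(m) / 2`, this field `Y`
satisfies `Y + DX(m) Y / 2 = G(m)` for a field `G` which contains no terms of degree below four. -/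
theorem remainder_bound [FiniteDimensional ℝ V] {p : Seminorm ℝ V}
    (hp : IsAdmissibleNorm p) {b : ℝ} (hb : 1 ≤ b) {L : V →L[ℝ] V} {B Q : V →L[ℝ] V →L[ℝ] V}
    {C K W : V →L[ℝ] V →L[ℝ] V →L[ℝ] V} (hBs : IsSymm₂ B) (hQs : IsSymm₂ Q) (hKs : IsSymm₃ K)
    (hB : Bdd₂ p b B) (hQ : Bdd₂ p b Q) (hC : Bdd₃ p b C) (hK : Bdd₃ p b K) (hW : Bdd₃ p b W)
    (hom₂ : ∀ m, L (Q m m) - (2 : ℝ) • Q m (L m) + B m m = 0)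
    (hom₃ : ∀ m, L (K m m m) - (3 : ℝ) • K m m (L m) + C m m m + B (Q m m) m - Q (B m m) m
      = W m m m)
    (Ω : V →L[ℝ] V →L[ℝ] ℝ) (hnd : ∀ u, (∀ v, Ω u v = 0) → u = 0)
    (hΩ : ∀ m u v, Ω (polyFieldDeriv Q K m u) v = -Ω u (polyFieldDeriv Q K m v))
    {H F : V → ℝ} (hHd : Differentiable ℝ H) (hFd : Differentiable ℝ F)
    (hH : ∀ ψ w, fderiv ℝ H ψ w = -Ω (L ψ + B ψ ψ + C ψ ψ ψ) w)
    (hF : ∀ ψ w, fderiv ℝ F ψ w = -Ω (L ψ + W ψ ψ ψ) w)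
    {ψ Y : V} (hψ : p ψ < 1 / (10 * b))
    (hY : ∀ w, fderiv ℝ (fun φ => H (midpointMap (polyField Q K) φ) - F φ) ψ w = -Ω Y w) :
    p Y ≤ 2560 * (b ^ 4 * p ψ ^ 4) := by
  have hc : CompleteSpace V := FiniteDimensional.complete ℝ V
  have hb0 : 0 ≤ b := by linarith
  have hXa := contDiff_polyField Q K
  have hX := isNonexpansive_polyField hb hQ hK
  have hS := hasFDerivAt_polyField hQs hKs
  have hr1 : 1 / (5 * b) ≤ 1 := by
    rw [div_le_one (by positivity)]; linarith
  have hrb : 5 * b * (1 / (5 * b)) = 1 := by field_simp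
  have hSp : ∀ m, p m ≤ 1 / (5 * b) → ∀ v, p (polyFieldDeriv Q K m v) ≤ p v := by
    intro m hm v
    have h1 := polyFieldDeriv_le hb0 hQ hK (hm.trans hr1) v
    have h2 : 5 * b * p m ≤ 1 := by
      rw [← hrb]; gcongr
    nlinarith [apply_nonneg p v]
  have hψ' : p ψ < 1 / (5 * b) / 2 := by
    rw [div_div]; convert hψ using 2; ring
  obtain ⟨hm1, hm2⟩ := midpointOf_spec hp hX hXa.continuous hψ'.le
  obtain ⟨han, -, hM⟩ := analyticAt_midpointOf hp hX hXa hS hSp hψ'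
  obtain ⟨hTan, hT⟩ := midpointMap_fderiv hp hX hXa hS hSp hψ'
  have hTdef : midpointMap (polyField Q K) ψ = midpointOf (polyField Q K) ψ
    + (1 / 2 : ℝ) • polyField Q K (midpointOf (polyField Q K) ψ) := rfl
  set m := midpointOf (polyField Q K) ψ with hm
  set X := polyField Q K m with hXdef
  set S := polyFieldDeriv Q K m with hSdef
  have hψm : ψ = m - (1 / 2 : ℝ) • X := eq_sub_of_add_eq hm2.symm
  set c := C (m + (1 / 2 : ℝ) • X) (m + (1 / 2 : ℝ) • X) (m + (1 / 2 : ℝ) • X) with hcdef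
  set w := W (m - (1 / 2 : ℝ) • X) (m - (1 / 2 : ℝ) • X) (m - (1 / 2 : ℝ) • X) with hwdef
  set E := B m (K m m m) + (1 / 4 : ℝ) • B X X + (c - C m m m)
      - (3 / 2 : ℝ) • K m m (B m m)
      - (1 / 2 : ℝ) • S (B m X + (1 / 4 : ℝ) • B X X + c)
      - (w - W m m m) - (1 / 2 : ℝ) • S w with hE
  -- the field equation for `Y`
  have hYE : Y + (1 / 2 : ℝ) • S Y = E := by
    rw [← sub_eq_zero]
    apply hnd
    intro v
    have hd : fderiv ℝ (fun φ => H (midpointMap (polyField Q K) φ) - F φ) ψ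
        = fderiv ℝ H (midpointMap (polyField Q K) ψ) ∘L fderiv ℝ (midpointMap (polyField Q K)) ψ
          - fderiv ℝ F ψ := by
      have h1 := (hHd (midpointMap (polyField Q K) ψ)).hasFDerivAt.comp ψ
        hTan.differentiableAt.hasFDerivAt
      exact (h1.sub (hFd ψ).hasFDerivAt).fderiv
    have h1 := hY (v - (1 / 2 : ℝ) • S v)
    rw [hd] at h1
    simp only [sub_apply, ContinuousLinearMap.comp_apply] at h1
    rw [hT, hM, hH, hF, hTdef] at h1
    have h2 := remainder_field_eq hBs (hom₂ m) (hom₃ m) hQs (X := X) (c := c) (w := w) rfl S rfl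
    rw [← hE] at h2
    rw [← h2]
    have h4 : L ψ + W ψ ψ ψ = L (m - (1 / 2 : ℝ) • X) + w := by rw [hwdef, ← hψm]
    rw [h4, ← hcdef] at h1
    have h3 := hΩ m
    rw [← hSdef] at h3
    simp only [map_add, map_sub, map_smul, add_apply, sub_apply,
      smul_apply, smul_eq_mul, h3] at h1 ⊢
    linarith
  have hEle : p E ≤ 80 * (b ^ 4 * p m ^ 4) :=
    remainder_field_le hb hB hQ hC hK hW (hm1.trans (by linarith))
  have hY1 : p Y ≤ 2 * p E := by
    have h1 : Y = E - (1 / 2 : ℝ) • S Y := eq_sub_of_add_eq hYE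
    have h2 := map_sub_le_add p E ((1 / 2 : ℝ) • S Y)
    rw [← h1, seminorm_half_smul] at h2
    linarith [hSp m (hm1.trans (by linarith)) Y]
  have hq2 : b ^ 4 * p m ^ 4 ≤ b ^ 4 * (2 * p ψ) ^ 4 := by gcongr
  linarith [show b ^ 4 * (2 * p ψ) ^ 4 = 16 * (b ^ 4 * p ψ ^ 4) by ring]

end Remainder

/-! ### Hamiltonian polynomials -/

section Hamiltonians

variable {V : Type*} [NormedAddCommGroup V] [NormedSpace ℝ V]

theorem hasFDerivAt_quadratic (Ω : V →L[ℝ] V →L[ℝ] ℝ) (L : V →L[ℝ] V)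
    (hΩ : ∀ u v, Ω (L u) v = Ω (L v) u) (ψ : V) :
    HasFDerivAt (fun φ => -(1 / 2 : ℝ) * Ω (L φ) φ) (-Ω (L ψ)) ψ := by
  have hid := hasFDerivAt_id (𝕜 := ℝ) ψ
  have h1 : HasFDerivAt (fun x => Ω (L x) x) _ ψ :=
    ((Ω ∘L L).hasFDerivAt (x := ψ)).clm_apply hid
  refine (h1.const_mul _).congr_fderiv ?_
  ext v
  simp only [add_apply, ContinuousLinearMap.comp_apply, ContinuousLinearMap.flip_apply,
    ContinuousLinearMap.id_apply, smul_apply, smul_eq_mul, neg_apply]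
  rw [hΩ v ψ]
  ring

theorem hasFDerivAt_cubic (Ω : V →L[ℝ] V →L[ℝ] ℝ) {Q : V →L[ℝ] V →L[ℝ] V} (hQ : IsSymm₂ Q)
    (hΩ : ∀ u v w, Ω (Q u v) w = Ω (Q u w) v) (ψ : V) :
    HasFDerivAt (fun φ => -(1 / 3 : ℝ) * Ω (Q φ φ) φ) (-Ω (Q ψ ψ)) ψ := by
  have hid := hasFDerivAt_id (𝕜 := ℝ) ψ
  have h1 : HasFDerivAt (fun x => Q x x) _ ψ := (Q.hasFDerivAt (x := ψ)).clm_apply hid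
  have h2 : HasFDerivAt (fun x => Ω (Q x x) x) _ ψ :=
    (HasFDerivAt.comp (g := Ω) (f := fun x => Q x x) ψ Ω.hasFDerivAt h1).clm_apply hid
  refine (h2.const_mul _).congr_fderiv ?_
  ext v
  simp only [add_apply, ContinuousLinearMap.comp_apply, ContinuousLinearMap.flip_apply,
    ContinuousLinearMap.id_apply, smul_apply, smul_eq_mul, neg_apply, map_add]
  rw [hQ v ψ, hΩ ψ v ψ]
  simp only [Function.comp_apply]
  ring

theorem hasFDerivAt_quartic (Ω : V →L[ℝ] V →L[ℝ] ℝ) {K : V →L[ℝ] V →L[ℝ] V →L[ℝ] V}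
    (hK : IsSymm₃ K) (hΩ : ∀ u v w x, Ω (K u v w) x = Ω (K u v x) w) (ψ : V) :
    HasFDerivAt (fun φ => -(1 / 4 : ℝ) * Ω (K φ φ φ) φ) (-Ω (K ψ ψ ψ)) ψ := by
  have hid := hasFDerivAt_id (𝕜 := ℝ) ψ
  have h1 : HasFDerivAt (fun x => K x x x) _ ψ :=
    ((K.hasFDerivAt (x := ψ)).clm_apply hid).clm_apply hid
  have h2 : HasFDerivAt (fun x => Ω (K x x x) x) _ ψ :=
    (HasFDerivAt.comp (g := Ω) (f := fun x => K x x x) ψ Ω.hasFDerivAt h1).clm_apply hid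
  refine (h2.const_mul _).congr_fderiv ?_
  ext v
  simp only [add_apply, ContinuousLinearMap.comp_apply, ContinuousLinearMap.flip_apply,
    ContinuousLinearMap.id_apply, smul_apply, smul_eq_mul, neg_apply, map_add, id]
  rw [(hK v ψ ψ).1, (hK ψ v ψ).2, hΩ ψ ψ v ψ]
  simp only [Function.comp_apply]
  ring

end Hamiltonians

/-! ### Bilinear operators with nonnegative kernels -/

section Kernels

variable {ι : Type*} [Fintype ι]

/-- The Euclidean norm of a finite real sequence. -/
noncomputable def l2 (x : ι → ℝ) : ℝ := √(∑ k, x k ^ 2)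

theorem l2_nonneg (x : ι → ℝ) : 0 ≤ l2 x := Real.sqrt_nonneg _

theorem l2_sq (x : ι → ℝ) : l2 x ^ 2 = ∑ k, x k ^ 2 :=
  Real.sq_sqrt (Finset.sum_nonneg fun _ _ => sq_nonneg _)

theorem l2_eq_norm (x : ι → ℝ) : l2 x = ‖(WithLp.toLp 2 x : EuclideanSpace ℝ ι)‖ := by
  rw [EuclideanSpace.norm_eq, l2]
  simp

theorem l2_add_le (x y : ι → ℝ) : l2 (fun k => x k + y k) ≤ l2 x + l2 y := by
  rw [l2_eq_norm, l2_eq_norm, l2_eq_norm]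
  exact norm_add_le (WithLp.toLp 2 x : EuclideanSpace ℝ ι) (WithLp.toLp 2 y)

theorem l2_mono {x y : ι → ℝ} (hx : ∀ k, 0 ≤ x k) (h : ∀ k, x k ≤ y k) : l2 x ≤ l2 y := by
  unfold l2
  gcongr with k
  · exact hx k
  · exact h k

theorem l2_const_mul {c : ℝ} (hc : 0 ≤ c) (x : ι → ℝ) : l2 (fun k => c * x k) = c * l2 x := by
  unfold l2
  simp only [mul_pow]
  rw [← Finset.mul_sum, Real.sqrt_mul (sq_nonneg c), Real.sqrt_sq hc]

/-- The bilinear operator with kernel `A` is bounded by `C` on the cone of nonnegative sequences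
of `ℓ²`. -/
def KernelBdd (A : ι → ι → ι → ℝ) (C : ℝ) : Prop :=
  ∀ x y : ι → ℝ, (∀ k, 0 ≤ x k) → (∀ k, 0 ≤ y k) →
    l2 (fun m => ∑ k, ∑ l, A m k l * x k * y l) ≤ C * l2 x * l2 y

theorem KernelBdd.mono {A A' : ι → ι → ι → ℝ} {C : ℝ} (h : KernelBdd A' C)
    (h0 : ∀ m k l, 0 ≤ A m k l) (hA : ∀ m k l, A m k l ≤ A' m k l) : KernelBdd A C := by
  intro x y hx hy
  refine (l2_mono (fun m => ?_) fun m => ?_).trans (h x y hx hy)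
  · exact Finset.sum_nonneg fun k _ => Finset.sum_nonneg fun l _ =>
      mul_nonneg (mul_nonneg (h0 m k l) (hx k)) (hy l)
  · refine Finset.sum_le_sum fun k _ => Finset.sum_le_sum fun l _ => ?_
    exact mul_le_mul_of_nonneg_right (mul_le_mul_of_nonneg_right (hA m k l) (hx k)) (hy l)

theorem KernelBdd.add {A A' : ι → ι → ι → ℝ} {C C' : ℝ} (h : KernelBdd A C)
    (h' : KernelBdd A' C') : KernelBdd (fun m k l => A m k l + A' m k l) (C + C') := by
  intro x y hx hy
  have h1 := l2_add_le (fun m => ∑ k, ∑ l, A m k l * x k * y l)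
    (fun m => ∑ k, ∑ l, A' m k l * x k * y l)
  simp only [← Finset.sum_add_distrib, ← add_mul] at h1
  have := h x y hx hy
  have := h' x y hx hy
  linarith

theorem KernelBdd.const_mul {A : ι → ι → ι → ℝ} {C c : ℝ} (h : KernelBdd A C) (hc : 0 ≤ c) :
    KernelBdd (fun m k l => c * A m k l) (c * C) := by
  intro x y hx hy
  have h1 := l2_const_mul hc (fun m => ∑ k, ∑ l, A m k l * x k * y l)
  simp only [Finset.mul_sum] at h1
  simp only [mul_assoc] at h1 ⊢
  rw [h1]
  have h2 := h x y hx hy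
  simp only [mul_assoc] at h2
  exact mul_le_mul_of_nonneg_left h2 hc

theorem KernelBdd.swap {A : ι → ι → ι → ℝ} {C : ℝ} (h : KernelBdd A C) :
    KernelBdd (fun m k l => A m l k) C := by
  intro x y hx hy
  have h1 := h y x hy hx
  rw [mul_right_comm] at h1
  convert h1 using 2
  funext m
  rw [Finset.sum_comm]
  exact Finset.sum_congr rfl fun k _ => Finset.sum_congr rfl fun l _ => by ring

/-- Kernels of Young type: for each fixed `l` the matrix `E · · l` satisfies the hypothesis of the
Schur test, and `τ` is square summable. -/
theorem kernelBdd_schur {E : ι → ι → ι → ℝ} {τ : ι → ℝ} {S D : ℝ} (hE : ∀ m k l, 0 ≤ E m k l)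
    (hτ : ∀ l, 0 ≤ τ l) (hS : 0 ≤ S) (hrow : ∀ m l, ∑ k, E m k l ≤ S)
    (hcol : ∀ k l, ∑ m, E m k l ≤ S) (hD : l2 τ ≤ D) :
    KernelBdd (fun m k l => E m k l * τ l) (S * D) := by
  intro x y hx hy
  have hD0 : 0 ≤ D := (l2_nonneg τ).trans hD
  set t := ∑ l, τ l * y l with ht
  have ht0 : 0 ≤ t := Finset.sum_nonneg fun l _ => mul_nonneg (hτ l) (hy l)
  have htD : t ≤ D * l2 y := by
    have h1 : t ≤ l2 τ * l2 y := Real.sum_mul_le_sqrt_mul_sqrt _ _ _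
    exact h1.trans (mul_le_mul_of_nonneg_right hD (l2_nonneg y))
  have key : ∀ m, (∑ k, ∑ l, E m k l * τ l * x k * y l) ^ 2
      ≤ S * t * ∑ k, ∑ l, E m k l * τ l * y l * x k ^ 2 := by
    intro m
    have h1 : (∑ q : ι × ι, E m q.1 q.2 * τ q.2 * x q.1 * y q.2) ^ 2
        ≤ (∑ q : ι × ι, E m q.1 q.2 * τ q.2 * y q.2)
          * ∑ q : ι × ι, E m q.1 q.2 * τ q.2 * y q.2 * x q.1 ^ 2 := by
      refine Finset.sum_sq_le_sum_mul_sum_of_sq_le_mul _ (fun q _ => ?_) (fun q _ => ?_)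
        fun q _ => le_of_eq (by ring)
      · exact mul_nonneg (mul_nonneg (hE _ _ _) (hτ _)) (hy _)
      · exact mul_nonneg (mul_nonneg (mul_nonneg (hE _ _ _) (hτ _)) (hy _)) (sq_nonneg _)
    rw [Fintype.sum_prod_type, Fintype.sum_prod_type, Fintype.sum_prod_type] at h1
    refine h1.trans (mul_le_mul_of_nonneg_right ?_ ?_)
    · rw [Finset.sum_comm, ht, Finset.mul_sum]
      refine Finset.sum_le_sum fun l _ => ?_
      calc ∑ k, E m k l * τ l * y l = (∑ k, E m k l) * (τ l * y l) := by
            rw [Finset.sum_mul]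
            exact Finset.sum_congr rfl fun k _ => by ring
        _ ≤ S * (τ l * y l) :=
            mul_le_mul_of_nonneg_right (hrow m l) (mul_nonneg (hτ l) (hy l))
    · exact Finset.sum_nonneg fun k _ => Finset.sum_nonneg fun l _ =>
        mul_nonneg (mul_nonneg (mul_nonneg (hE _ _ _) (hτ _)) (hy _)) (sq_nonneg _)
  have hsum : ∑ m, ∑ k, ∑ l, E m k l * τ l * y l * x k ^ 2 ≤ S * t * l2 x ^ 2 := by
    rw [Finset.sum_comm, l2_sq, Finset.mul_sum]
    refine Finset.sum_le_sum fun k _ => ?_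
    rw [Finset.sum_comm, ht, Finset.mul_sum, Finset.sum_mul]
    refine Finset.sum_le_sum fun l _ => ?_
    calc ∑ m, E m k l * τ l * y l * x k ^ 2 = (∑ m, E m k l) * (τ l * y l * x k ^ 2) := by
          rw [Finset.sum_mul]
          exact Finset.sum_congr rfl fun k _ => by ring
      _ ≤ S * (τ l * y l * x k ^ 2) := mul_le_mul_of_nonneg_right (hcol k l)
          (mul_nonneg (mul_nonneg (hτ l) (hy l)) (sq_nonneg _))
      _ = _ := by ring
  have hsq : l2 (fun m => ∑ k, ∑ l, E m k l * τ l * x k * y l) ^ 2 ≤ (S * t * l2 x) ^ 2 := by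
    rw [l2_sq]
    calc _ ≤ ∑ m, S * t * ∑ k, ∑ l, E m k l * τ l * y l * x k ^ 2 :=
          Finset.sum_le_sum fun m _ => key m
      _ = S * t * ∑ m, ∑ k, ∑ l, E m k l * τ l * y l * x k ^ 2 := by rw [← Finset.mul_sum]
      _ ≤ S * t * (S * t * l2 x ^ 2) := by gcongr
      _ = _ := by ring
  have hfin := le_of_sq_le_sq hsq (by have := l2_nonneg x; positivity)
  calc _ ≤ S * t * l2 x := hfin
    _ ≤ S * (D * l2 y) * l2 x := by have := l2_nonneg x; gcongr
    _ = _ := by ring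

/-- Kernels of Hilbert–Schmidt type. -/
theorem kernelBdd_hilbertSchmidt {u v w : ι → ℝ} {D : ℝ} (hu : l2 u ≤ D) (hv : l2 v ≤ D)
    (hw : l2 w ≤ D) : KernelBdd (fun m k l => u m * v k * w l) (D ^ 3) := by
  intro x y hx hy
  have hD0 : 0 ≤ D := (l2_nonneg u).trans hu
  have h0 := l2_nonneg x
  have h0' := l2_nonneg y
  have hu0 := l2_nonneg u
  have h1 : (fun m => ∑ k, ∑ l, u m * v k * w l * x k * y l)
      = fun m => ((∑ k, v k * x k) * (∑ l, w l * y l)) * u m := by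
    funext m
    rw [Finset.sum_mul_sum, Finset.sum_mul]
    refine Finset.sum_congr rfl fun k _ => ?_
    rw [Finset.sum_mul]
    exact Finset.sum_congr rfl fun l _ => by ring
  have h2 : |∑ k, v k * x k| ≤ D * l2 x := by
    have e := Finset.sum_mul_sq_le_sq_mul_sq Finset.univ v x
    rw [← l2_sq, ← l2_sq, ← mul_pow] at e
    have e' := abs_le_of_sq_le_sq e (mul_nonneg (l2_nonneg v) h0)
    exact e'.trans (mul_le_mul_of_nonneg_right hv h0)
  have h3 : |∑ l, w l * y l| ≤ D * l2 y := by
    have e := Finset.sum_mul_sq_le_sq_mul_sq Finset.univ w y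
    rw [← l2_sq, ← l2_sq, ← mul_pow] at e
    have e' := abs_le_of_sq_le_sq e (mul_nonneg (l2_nonneg w) h0')
    exact e'.trans (mul_le_mul_of_nonneg_right hw h0')
  rw [h1]
  have h4 : l2 (fun m => ((∑ k, v k * x k) * (∑ l, w l * y l)) * u m)
      = |(∑ k, v k * x k) * (∑ l, w l * y l)| * l2 u := by
    rw [← l2_const_mul (abs_nonneg _)]
    unfold l2
    simp only [mul_pow, sq_abs]
  rw [h4, abs_mul]
  calc _ ≤ (D * l2 x) * (D * l2 y) * D := by gcongr
    _ = _ := by ring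

end Kernels

/-! ### Reduction modulo the period -/

theorem exists_eq_wrap_add (N : ℕ) (x : ℤ) : ∃ q : ℤ, x = wrap N x + (2 * (N : ℤ) + 2) * q := by
  refine ⟨(x + ((N : ℤ) + 1)) / (2 * (N : ℤ) + 2), ?_⟩
  have := Int.emod_add_mul_ediv (x + ((N : ℤ) + 1)) (2 * (N : ℤ) + 2)
  simp only [wrap]
  linarith

theorem wrap_bounds (N : ℕ) (x : ℤ) : -((N : ℤ) + 1) ≤ wrap N x ∧ wrap N x ≤ N := by
  simpa [idx] using wrap_mem N x

theorem wrap_add_mul (N : ℕ) (x q : ℤ) : wrap N (x + (2 * (N : ℤ) + 2) * q) = wrap N x := by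
  unfold wrap
  rw [add_right_comm, Int.add_mul_emod_self_left]

theorem wrap_of_mem {N : ℕ} {x : ℤ} (h1 : -((N : ℤ) + 1) ≤ x) (h2 : x ≤ N) : wrap N x = x := by
  unfold wrap
  rw [Int.emod_eq_of_lt (by omega) (by omega)]
  ring

theorem abs_wrap_le (N : ℕ) (x : ℤ) : |wrap N x| ≤ |x| := by
  obtain ⟨q, hq⟩ := exists_eq_wrap_add N x
  obtain ⟨h1, h2⟩ := wrap_bounds N x
  rcases lt_trichotomy q 0 with h | h | h
  · have : (2 * (N : ℤ) + 2) * q ≤ -(2 * (N : ℤ) + 2) := by nlinarith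
    rw [abs_le]
    constructor <;> [have := neg_abs_le x; have := neg_abs_le x] <;> omega
  · rw [h, mul_zero, add_zero] at hq
    rw [← hq]
  · have : 2 * (N : ℤ) + 2 ≤ (2 * (N : ℤ) + 2) * q := by nlinarith
    rw [abs_le]
    constructor <;> [have := le_abs_self x; have := le_abs_self x] <;> omega

/-- The distance from `x` to the multiples of the period `2N+2`. -/
def pdist (N : ℕ) (x : ℤ) : ℝ := |(wrap N x : ℝ)|

theorem pdist_nonneg (N : ℕ) (x : ℤ) : 0 ≤ pdist N x := abs_nonneg _

theorem pdist_add_mul (N : ℕ) (x q : ℤ) : pdist N (x + (2 * (N : ℤ) + 2) * q) = pdist N x := by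
  rw [pdist, wrap_add_mul, pdist]

theorem pdist_le_abs (N : ℕ) (x : ℤ) : pdist N x ≤ |(x : ℝ)| := by
  have := abs_wrap_le N x
  rw [pdist]
  exact_mod_cast this

theorem pdist_add_le (N : ℕ) (x y : ℤ) : pdist N (x + y) ≤ pdist N x + pdist N y := by
  obtain ⟨q, hq⟩ := exists_eq_wrap_add N x
  obtain ⟨r, hr⟩ := exists_eq_wrap_add N y
  have h1 : x + y = (wrap N x + wrap N y) + (2 * (N : ℤ) + 2) * (q + r) := by linarith
  rw [h1, pdist_add_mul]
  refine (pdist_le_abs N _).trans ?_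
  push_cast
  exact abs_add_le _ _

theorem pdist_neg (N : ℕ) (x : ℤ) : pdist N (-x) = pdist N x := by
  have key : ∀ y : ℤ, pdist N (-y) ≤ pdist N y := by
    intro y
    obtain ⟨q, hq⟩ := exists_eq_wrap_add N y
    have h1 : -y = -wrap N y + (2 * (N : ℤ) + 2) * (-q) := by linarith
    rw [h1, pdist_add_mul]
    refine (pdist_le_abs N _).trans ?_
    push_cast
    rw [abs_neg]
    rfl
  exact le_antisymm (key x) (by simpa using key (-x))

theorem pdist_sub_le (N : ℕ) (x y : ℤ) : pdist N (x - y) ≤ pdist N x + pdist N y := by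
  rw [sub_eq_add_neg, ← pdist_neg N y]
  exact pdist_add_le N x (-y)

theorem one_le_pdist_of_odd {N : ℕ} {x : ℤ} (hx : Odd x) : 1 ≤ pdist N x := by
  have h : wrap N x ≠ 0 := by
    intro h
    obtain ⟨q, hq⟩ := exists_eq_wrap_add N x
    rw [h, zero_add] at hq
    obtain ⟨r, hr⟩ := hx
    have : (2 * (N : ℤ) + 2) * q = 2 * (((N : ℤ) + 1) * q) := by ring
    omega
  rw [pdist]
  exact_mod_cast Int.one_le_abs h

/-- Half of the angle between neighbouring modes at the site `1`. -/
noncomputable def ang (N : ℕ) : ℝ := Real.pi / (2 * (N : ℝ) + 2)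

theorem ang_pos (N : ℕ) : 0 < ang N := by
  unfold ang
  have := Real.pi_pos
  positivity

theorem ang_mul (N : ℕ) : (2 * (N : ℝ) + 2) * ang N = Real.pi := by
  unfold ang
  field_simp

theorem abs_sin_ang (N : ℕ) (x : ℤ) : |Real.sin (x * ang N)| = |Real.sin (wrap N x * ang N)| := by
  obtain ⟨q, hq⟩ := exists_eq_wrap_add N x
  have h1 : (x : ℝ) * ang N = wrap N x * ang N + q * Real.pi := by
    rw [← ang_mul N]
    nth_rewrite 1 [hq]
    push_cast
    ring
  rw [h1, Real.sin_add_int_mul_pi, abs_mul, abs_zpow]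
  simp

/-- Jordan's inequality, in terms of the distance to the multiples of the period. -/
theorem le_abs_sin_ang (N : ℕ) (x : ℤ) : pdist N x / (N + 1) ≤ |Real.sin (x * ang N)| := by
  rw [abs_sin_ang]
  obtain ⟨h1, h2⟩ := wrap_bounds N x
  have h3 : |(wrap N x : ℝ)| ≤ N + 1 := by
    rw [abs_le]
    constructor
    · have : ((-((N : ℤ) + 1) : ℤ) : ℝ) ≤ (wrap N x : ℝ) := by exact_mod_cast h1
      push_cast at this
      exact this
    · have : (wrap N x : ℝ) ≤ ((N : ℤ) : ℝ) := by exact_mod_cast h2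
      push_cast at this
      linarith
  have hpi := Real.pi_pos
  have h4 : |(wrap N x : ℝ) * ang N| ≤ Real.pi / 2 := by
    rw [abs_mul, abs_of_pos (ang_pos N)]
    calc _ ≤ ((N : ℝ) + 1) * ang N := mul_le_mul_of_nonneg_right h3 (ang_pos N).le
      _ = Real.pi / 2 := by linarith [ang_mul N]
  refine le_trans (le_of_eq ?_) (Real.mul_abs_le_abs_sin h4)
  rw [abs_mul, abs_of_pos (ang_pos N), pdist, ang]
  field_simp

theorem abs_sin_ang_le (N : ℕ) (x : ℤ) : |Real.sin (x * ang N)| ≤ 2 * pdist N x / (N + 1) := by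
  rw [abs_sin_ang]
  refine Real.abs_sin_le_abs.trans ?_
  rw [abs_mul, abs_of_pos (ang_pos N), pdist, ang]
  have h4 := Real.pi_le_four
  rw [show (2 : ℝ) * N + 2 = 2 * (N + 1) by ring, mul_div_assoc', mul_comm 2 ((N : ℝ) + 1),
    ← div_div, div_right_comm, div_le_div_iff_of_pos_right (by positivity)]
  nlinarith [abs_nonneg (wrap N x : ℝ)]

theorem sin_ang_eq_zero_iff (N : ℕ) (x : ℤ) :
    Real.sin (x * ang N) = 0 ↔ (2 * (N : ℤ) + 2) ∣ x := by
  constructor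
  · intro h
    have h1 := le_abs_sin_ang N x
    rw [h, abs_zero, div_le_iff₀ (by positivity), zero_mul] at h1
    have h2 : wrap N x = 0 := by
      have := le_antisymm h1 (pdist_nonneg N x)
      rw [pdist, abs_eq_zero] at this
      exact_mod_cast this
    obtain ⟨q, hq⟩ := exists_eq_wrap_add N x
    rw [h2, zero_add] at hq
    exact ⟨q, hq⟩
  · rintro ⟨q, rfl⟩
    have : (((2 * (N : ℤ) + 2) * q : ℤ) : ℝ) * ang N = q * Real.pi := by
      rw [← ang_mul N]; push_cast; ring
    rw [this, Real.sin_int_mul_pi]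

/-! ### Trigonometric sums over the lattice -/

theorem sum_Icc_int_sub (f : ℤ → ℝ) {a b : ℤ} (h : a - 1 ≤ b) :
    ∑ j ∈ Finset.Icc a b, (f j - f (j - 1)) = f b - f (a - 1) := by
  induction b, h using Int.leInduction with
  | base => simp
  | succ b hb ih =>
    have : Finset.Icc a (b + 1) = insert (b + 1) (Finset.Icc a b) := by
      ext j; simp only [Finset.mem_Icc, Finset.mem_insert]; omega
    rw [this, Finset.sum_insert (by simp), ih]
    simp

theorem sum_period_cos (N : ℕ) (n : ℤ) (c : ℝ) :
    ∑ j ∈ idx .periodic N, Real.cos (j * (2 * n * ang N) + c)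
      = if (2 * (N : ℤ) + 2) ∣ n then (2 * (N : ℝ) + 2) * Real.cos c else 0 := by
  split_ifs with h
  · obtain ⟨q, rfl⟩ := h
    have h1 : ∀ j : ℤ, Real.cos (j * (2 * (((2 * (N : ℤ) + 2) * q : ℤ) : ℝ) * ang N) + c)
        = Real.cos c := by
      intro j
      have : (j : ℝ) * (2 * (((2 * (N : ℤ) + 2) * q : ℤ) : ℝ) * ang N) + c
          = c + ((j * q : ℤ) : ℝ) * (2 * Real.pi) := by
        rw [← ang_mul N]; push_cast; ring
      rw [this, Real.cos_add_int_mul_two_pi]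
    simp only [h1, idx, Finset.sum_const, Int.card_Icc, nsmul_eq_mul]
    congr 1
    have : ((N : ℤ) + 1 - -((N : ℤ) + 1)).toNat = 2 * N + 2 := by omega
    rw [this]
    push_cast
    ring
  · have h0 : Real.sin (n * ang N) ≠ 0 := fun h' => h ((sin_ang_eq_zero_iff N n).1 h')
    have h1 : ∀ j : ℤ, 2 * Real.sin (n * ang N) * Real.cos (j * (2 * n * ang N) + c)
        = (fun j : ℤ => Real.sin ((2 * j + 1) * (n * ang N) + c)) j
          - (fun j : ℤ => Real.sin ((2 * j + 1) * (n * ang N) + c)) (j - 1) := by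
      intro j
      have e1 : (2 * (j : ℝ) + 1) * (n * ang N) + c = (j * (2 * n * ang N) + c) + n * ang N := by
        ring
      have e2 : (2 * ((j - 1 : ℤ) : ℝ) + 1) * (n * ang N) + c
          = (j * (2 * n * ang N) + c) - n * ang N := by push_cast; ring
      simp only
      rw [e1, e2, Real.sin_add, Real.sin_sub]
      ring
    have h2 : 2 * Real.sin (n * ang N)
        * ∑ j ∈ idx .periodic N, Real.cos (j * (2 * n * ang N) + c) = 0 := by
      rw [Finset.mul_sum, Finset.sum_congr rfl fun j _ => h1 j]
      simp only [idx]
      rw [sum_Icc_int_sub (fun j : ℤ => Real.sin ((2 * j + 1) * (n * ang N) + c)) (by omega),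
        sub_eq_zero]
      have : (2 * ((N : ℤ) : ℝ) + 1) * (n * ang N) + c
          = ((2 * ((-((N : ℤ) + 1) - 1 : ℤ) : ℝ) + 1) * (n * ang N) + c)
            + n * (2 * Real.pi) := by
        rw [← ang_mul N]; push_cast; ring
      rw [this, Real.sin_add_int_mul_two_pi]
    simpa [h0] using h2

theorem sum_dirichlet_cos (N : ℕ) {n : ℤ} (h : ¬ (2 * (N : ℤ) + 2) ∣ n) :
    ∑ j ∈ idx .dirichlet N, Real.cos (j * (2 * n * ang N)) = -(1 + (-1) ^ n) / 2 := by
  have h0 : Real.sin (n * ang N) ≠ 0 := fun h' => h ((sin_ang_eq_zero_iff N n).1 h')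
  have h1 : ∀ j : ℤ, 2 * Real.sin (n * ang N) * Real.cos (j * (2 * n * ang N))
      = (fun j : ℤ => Real.sin ((2 * j + 1) * (n * ang N))) j
        - (fun j : ℤ => Real.sin ((2 * j + 1) * (n * ang N))) (j - 1) := by
    intro j
    have e1 : (2 * (j : ℝ) + 1) * (n * ang N) = j * (2 * n * ang N) + n * ang N := by ring
    have e2 : (2 * ((j - 1 : ℤ) : ℝ) + 1) * (n * ang N)
        = j * (2 * n * ang N) - n * ang N := by push_cast; ring
    simp only
    rw [e1, e2, Real.sin_add, Real.sin_sub]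
    ring
  have h2 : 2 * Real.sin (n * ang N) * ∑ j ∈ idx .dirichlet N, Real.cos (j * (2 * n * ang N))
      = -(1 + (-1) ^ n) * Real.sin (n * ang N) := by
    rw [Finset.mul_sum, Finset.sum_congr rfl fun j _ => h1 j]
    simp only [idx]
    rw [sum_Icc_int_sub (fun j : ℤ => Real.sin ((2 * j + 1) * (n * ang N))) (by omega)]
    have : (2 * ((N : ℤ) : ℝ) + 1) * (n * ang N) = n * Real.pi - n * ang N := by
      rw [← ang_mul N]; push_cast; ring
    rw [this, Real.sin_sub, Real.sin_int_mul_pi, Real.cos_int_mul_pi]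
    push_cast
    ring_nf
  have h3 : Real.sin (n * ang N) * (2 * ∑ j ∈ idx .dirichlet N, Real.cos (j * (2 * n * ang N))
      + (1 + (-1) ^ n)) = 0 := by linarith
  have := (mul_eq_zero.1 h3).resolve_left h0
  linarith

theorem sum_dirichlet_sin (N : ℕ) (n : ℤ) :
    2 * Real.sin (n * ang N) * ∑ j ∈ idx .dirichlet N, Real.sin (j * (2 * n * ang N))
      = (1 - (-1) ^ n) * Real.cos (n * ang N) := by
  have h1 : ∀ j : ℤ, 2 * Real.sin (n * ang N) * Real.sin (j * (2 * n * ang N))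
      = (fun j : ℤ => -Real.cos ((2 * j + 1) * (n * ang N))) j
        - (fun j : ℤ => -Real.cos ((2 * j + 1) * (n * ang N))) (j - 1) := by
    intro j
    have e1 : (2 * (j : ℝ) + 1) * (n * ang N) = j * (2 * n * ang N) + n * ang N := by ring
    have e2 : (2 * ((j - 1 : ℤ) : ℝ) + 1) * (n * ang N)
        = j * (2 * n * ang N) - n * ang N := by push_cast; ring
    simp only
    rw [e1, e2, Real.cos_add, Real.cos_sub]
    ring
  rw [Finset.mul_sum, Finset.sum_congr rfl fun j _ => h1 j]
  simp only [idx]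
  rw [sum_Icc_int_sub (fun j : ℤ => -Real.cos ((2 * j + 1) * (n * ang N))) (by omega)]
  have : (2 * ((N : ℤ) : ℝ) + 1) * (n * ang N) = n * Real.pi - n * ang N := by
    rw [← ang_mul N]; push_cast; ring
  rw [this, Real.cos_sub, Real.sin_int_mul_pi, Real.cos_int_mul_pi]
  push_cast
  ring_nf

/-! ### The Fourier modes -/

/-- The amplitude of the periodic modes. -/
noncomputable def amp (N : ℕ) (k : ℤ) : ℝ :=
  if k = 0 ∨ k = -((N : ℤ) + 1) then 1 / √(2 * (N : ℝ) + 2) else 1 / √((N : ℝ) + 1)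

/-- The phase of the periodic modes: sines for `k > 0`, cosines otherwise. -/
noncomputable def phase (k : ℤ) : ℝ := if 0 < k then Real.pi / 2 else 0

theorem mode_periodic (N : ℕ) (k j : ℤ) :
    mode .periodic N k j = amp N k * Real.cos (j * (2 * k * ang N) - phase k) := by
  have e : (j : ℝ) * k * Real.pi / ((N : ℝ) + 1) = j * (2 * k * ang N) := by
    unfold ang; field_simp
  unfold mode amp phase
  split_ifs with h1 h2 h2 h3 h3 h4 h5
  · omega
  · rw [e, Real.cos_sub_pi_div_two]
  · simp [h2]
  · omega
  · have h6 : (j : ℝ) * (2 * k * ang N) = ((-j : ℤ) : ℝ) * Real.pi := by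
      rw [← ang_mul N, h3]; push_cast; ring
    rw [sub_zero, h6, Real.cos_int_mul_pi, zpow_neg, ← inv_zpow]
    norm_num
    ring
  · omega
  · omega
  · rw [e, sub_zero]

theorem mode_dirichlet (N : ℕ) {k : ℤ} (hk : 0 < k) (j : ℤ) :
    mode .dirichlet N k j = √2 / √((N : ℝ) + 1) * Real.sin (j * (2 * k * ang N)) := by
  have e : (j : ℝ) * k * Real.pi / ((N : ℝ) + 1) = j * (2 * k * ang N) := by
    unfold ang; field_simp
  unfold mode
  rw [if_pos hk, e]

theorem amp_nonneg (N : ℕ) (k : ℤ) : 0 ≤ amp N k := by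
  unfold amp; split_ifs <;> positivity

theorem amp_le (N : ℕ) (k : ℤ) : amp N k ≤ 1 / √((N : ℝ) + 1) := by
  unfold amp
  split_ifs
  · apply one_div_le_one_div_of_le (by positivity)
    apply Real.sqrt_le_sqrt
    linarith [(Nat.cast_nonneg N : (0 : ℝ) ≤ N)]
  · exact le_rfl

theorem not_dvd_of_abs_lt {m n : ℤ} (h0 : n ≠ 0) (h : |n| < m) : ¬ m ∣ n := fun hd =>
  h0 (Int.eq_zero_of_abs_lt_dvd hd h)

theorem mode_orthonormal (bc : BC) (N : ℕ) {k l : ℤ} (hk : k ∈ idx bc N) (hl : l ∈ idx bc N) :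
    ∑ j ∈ idx bc N, mode bc N k j * mode bc N l j = if k = l then 1 else 0 := by
  cases bc with
  | periodic =>
    simp only [idx, Finset.mem_Icc] at hk hl
    have e : ∀ j : ℤ, mode .periodic N k j * mode .periodic N l j
        = amp N k * amp N l / 2 * Real.cos (j * (2 * ((k - l : ℤ) : ℝ) * ang N)
            + (phase l - phase k))
          + amp N k * amp N l / 2 * Real.cos (j * (2 * ((k + l : ℤ) : ℝ) * ang N)
            + (-phase k - phase l)) := by
      intro j
      rw [mode_periodic, mode_periodic]
      have e1 : (j : ℝ) * (2 * ((k - l : ℤ) : ℝ) * ang N) + (phase l - phase k)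
          = (j * (2 * k * ang N) - phase k) - (j * (2 * l * ang N) - phase l) := by
        push_cast; ring
      have e2 : (j : ℝ) * (2 * ((k + l : ℤ) : ℝ) * ang N) + (-phase k - phase l)
          = (j * (2 * k * ang N) - phase k) + (j * (2 * l * ang N) - phase l) := by
        push_cast; ring
      rw [e1, e2]
      generalize (j : ℝ) * (2 * k * ang N) - phase k = x
      generalize (j : ℝ) * (2 * l * ang N) - phase l = y
      rw [Real.cos_sub, Real.cos_add]
      ring
    rw [Finset.sum_congr rfl fun j _ => e j, Finset.sum_add_distrib, ← Finset.mul_sum,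
      ← Finset.mul_sum, sum_period_cos, sum_period_cos]
    have hN : (0 : ℝ) < 2 * (N : ℝ) + 2 := by positivity
    by_cases hkl : k = l
    · subst hkl
      rw [if_pos rfl, sub_self, if_pos (dvd_zero _), sub_self, Real.cos_zero]
      by_cases h0 : k = 0 ∨ k = -((N : ℤ) + 1)
      · have hd : (2 * (N : ℤ) + 2) ∣ k + k := by
          rcases h0 with h | h
          · rw [h]; simp
          · rw [h]; exact ⟨-1, by ring⟩
        have hp : phase k = 0 := by
          unfold phase; rw [if_neg]; omega
        rw [if_pos hd, hp, amp, if_pos h0]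
        simp only [neg_zero, sub_zero, Real.cos_zero]
        rw [div_mul_div_comm, Real.mul_self_sqrt hN.le]
        field_simp
        ring
      · have hd : ¬ (2 * (N : ℤ) + 2) ∣ k + k := by
          apply not_dvd_of_abs_lt
          · omega
          · rw [abs_lt]; omega
        rw [if_neg hd, amp, if_neg h0, div_mul_div_comm,
          Real.mul_self_sqrt (by positivity : (0 : ℝ) ≤ (N : ℝ) + 1)]
        field_simp
        ring
    · have hd : ¬ (2 * (N : ℤ) + 2) ∣ k - l := by
        apply not_dvd_of_abs_lt
        · omega
        · rw [abs_lt]; omega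
      rw [if_neg hkl, if_neg hd]
      split_ifs with hd2
      · have h0 : k + l = 0 := by
          apply Int.eq_zero_of_abs_lt_dvd hd2
          rw [abs_lt]; omega
        have hp : -phase k - phase l = -(Real.pi / 2) := by
          unfold phase
          rcases lt_or_gt_of_ne (show k ≠ 0 by omega) with h | h
          · rw [if_neg (by omega), if_pos (by omega)]; ring
          · rw [if_pos (by omega), if_neg (by omega)]; ring
        rw [hp, Real.cos_neg, Real.cos_pi_div_two]
        ring
      · ring
  | dirichlet =>
    have hk' := hk
    have hl' := hl
    simp only [idx, Finset.mem_Icc] at hk' hl'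
    have e : ∀ j : ℤ, mode .dirichlet N k j * mode .dirichlet N l j
        = 1 / ((N : ℝ) + 1) * (Real.cos (j * (2 * ((k - l : ℤ) : ℝ) * ang N))
          - Real.cos (j * (2 * ((k + l : ℤ) : ℝ) * ang N))) := by
      intro j
      rw [mode_dirichlet N (by omega), mode_dirichlet N (by omega)]
      have e1 : (j : ℝ) * (2 * ((k - l : ℤ) : ℝ) * ang N)
          = (j * (2 * k * ang N)) - (j * (2 * l * ang N)) := by push_cast; ring
      have e2 : (j : ℝ) * (2 * ((k + l : ℤ) : ℝ) * ang N)
          = (j * (2 * k * ang N)) + (j * (2 * l * ang N)) := by push_cast; ring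
      rw [e1, e2, Real.cos_sub, Real.cos_add, mul_mul_mul_comm, div_mul_div_comm,
        Real.mul_self_sqrt (by norm_num), Real.mul_self_sqrt (by positivity)]
      ring
    rw [Finset.sum_congr rfl fun j _ => e j, ← Finset.mul_sum, Finset.sum_sub_distrib]
    have hd2 : ¬ (2 * (N : ℤ) + 2) ∣ k + l := by
      apply not_dvd_of_abs_lt
      · omega
      · rw [abs_lt]; omega
    rw [sum_dirichlet_cos N hd2]
    by_cases hkl : k = l
    · subst hkl
      rw [if_pos rfl, Even.neg_one_zpow ⟨k, rfl⟩]
      simp [idx]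
      field_simp
    · have hd : ¬ (2 * (N : ℤ) + 2) ∣ k - l := by
        apply not_dvd_of_abs_lt
        · omega
        · rw [abs_lt]; omega
      rw [if_neg hkl, sum_dirichlet_cos N hd]
      have : ((-1 : ℝ)) ^ (k - l) = (-1) ^ (k + l) := by
        rw [show k + l = (k - l) + 2 * l by ring, zpow_add₀ (by norm_num), zpow_mul]
        norm_num
      rw [this]
      ring

/-! ### The coefficients of the pointwise product in the Fourier basis -/

/-- The coefficients `∑_j ê_k(j) ê_l(j) ê_m(j)`. -/
noncomputable def tri (bc : BC) (N : ℕ) (k l m : ℤ) : ℝ :=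
  ∑ j ∈ idx bc N, mode bc N k j * mode bc N l j * mode bc N m j

/-- The weight `[k] = max {1, |k|}`. -/
noncomputable def br (k : ℤ) : ℝ := max 1 |(k : ℝ)|

theorem one_le_br (k : ℤ) : 1 ≤ br k := le_max_left _ _

theorem br_pos (k : ℤ) : 0 < br k := zero_lt_one.trans_le (one_le_br k)

/-- The weight of the norm `‖·‖_{s,σ}` at the mode `k`. -/
noncomputable def wt (s σ : ℝ) (k : ℤ) : ℝ := br k ^ s * Real.exp (σ * |(k : ℝ)|)

theorem wt_pos (s σ : ℝ) (k : ℤ) : 0 < wt s σ k :=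
  mul_pos (Real.rpow_pos_of_pos (br_pos k) s) (Real.exp_pos _)

/-- A summable function of the distance to the multiples of the period. -/
noncomputable def prof (δ : ℝ) (N : ℕ) (x : ℤ) : ℝ := (max 1 (pdist N x)) ^ (-(1 + δ))

theorem prof_nonneg (δ : ℝ) (N : ℕ) (x : ℤ) : 0 ≤ prof δ N x := by
  unfold prof; positivity

theorem prof_neg (δ : ℝ) (N : ℕ) (x : ℤ) : prof δ N (-x) = prof δ N x := by
  unfold prof; rw [pdist_neg]

theorem prof_of_dvd (δ : ℝ) {N : ℕ} {x : ℤ} (h : (2 * (N : ℤ) + 2) ∣ x) : prof δ N x = 1 := by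
  obtain ⟨q, rfl⟩ := h
  have : pdist N ((2 * (N : ℤ) + 2) * q) = 0 := by
    have h1 := pdist_add_mul N 0 q
    rw [zero_add] at h1
    rw [h1, pdist, wrap_of_mem (by omega) (by omega)]
    simp
  rw [prof, this]
  simp

/-- The sum of the profile over the four combinations of `m`, `k`, `l`. -/
noncomputable def kerSum (δ : ℝ) (N : ℕ) (m k l : ℤ) : ℝ :=
  prof δ N (m + k + l) + prof δ N (m - k - l) + prof δ N (m + k - l) + prof δ N (m - k + l)

theorem kerSum_nonneg (δ : ℝ) (N : ℕ) (m k l : ℤ) : 0 ≤ kerSum δ N m k l := by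
  unfold kerSum
  have := prof_nonneg δ N
  have h1 := this (m + k + l)
  have h2 := this (m - k - l)
  have h3 := this (m + k - l)
  have h4 := this (m - k + l)
  linarith

theorem kerSum_swap (δ : ℝ) (N : ℕ) (m k l : ℤ) : kerSum δ N m k l = kerSum δ N m l k := by
  unfold kerSum
  rw [show m + k + l = m + l + k by ring, show m - k - l = m - l - k by ring,
    show m + k - l = m - l + k by ring, show m - k + l = m + l - k by ring]
  ring

/-! #### Periodic boundary conditions -/

theorem abs_add_four_le (a b c d : ℝ) : |a + b + c + d| ≤ |a| + |b| + |c| + |d| :=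
  (abs_add_le _ _).trans (by gcongr; exact (abs_add_le _ _).trans (by gcongr; exact abs_add_le _ _))

/-- With periodic boundary conditions the product of three modes has nonzero sum only if one of
the four combinations `m ± k ± l` is a multiple of the period. -/
theorem abs_tri_periodic_le (N : ℕ) (m k l : ℤ) :
    |tri .periodic N m k l| ≤ 1 / √((N : ℝ) + 1)
      * ((if (2 * (N : ℤ) + 2) ∣ m + k + l then 1 else 0)
        + (if (2 * (N : ℤ) + 2) ∣ m - k - l then 1 else 0)
        + (if (2 * (N : ℤ) + 2) ∣ m + k - l then 1 else 0)
        + (if (2 * (N : ℤ) + 2) ∣ m - k + l then 1 else 0)) := by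
  set A := amp N m * amp N k * amp N l / 4 with hA
  have hM : (0 : ℝ) < (N : ℝ) + 1 := by positivity
  have e : ∀ j : ℤ, mode .periodic N m j * mode .periodic N k j * mode .periodic N l j
      = A * Real.cos (j * (2 * ((m + k + l : ℤ) : ℝ) * ang N) + (-phase m - phase k - phase l))
        + A * Real.cos (j * (2 * ((m - k - l : ℤ) : ℝ) * ang N) + (-phase m + phase k + phase l))
        + A * Real.cos (j * (2 * ((m + k - l : ℤ) : ℝ) * ang N) + (-phase m - phase k + phase l))
        + A * Real.cos (j * (2 * ((m - k + l : ℤ) : ℝ) * ang N)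
          + (-phase m + phase k - phase l)) := by
    intro j
    rw [mode_periodic, mode_periodic, mode_periodic]
    set x := (j : ℝ) * (2 * m * ang N) - phase m with hx
    set y := (j : ℝ) * (2 * k * ang N) - phase k with hy
    set z := (j : ℝ) * (2 * l * ang N) - phase l with hz
    have e1 : (j : ℝ) * (2 * ((m + k + l : ℤ) : ℝ) * ang N) + (-phase m - phase k - phase l)
        = x + y + z := by rw [hx, hy, hz]; push_cast; ring
    have e2 : (j : ℝ) * (2 * ((m - k - l : ℤ) : ℝ) * ang N) + (-phase m + phase k + phase l)
        = x - y - z := by rw [hx, hy, hz]; push_cast; ring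
    have e3 : (j : ℝ) * (2 * ((m + k - l : ℤ) : ℝ) * ang N) + (-phase m - phase k + phase l)
        = x + y - z := by rw [hx, hy, hz]; push_cast; ring
    have e4 : (j : ℝ) * (2 * ((m - k + l : ℤ) : ℝ) * ang N) + (-phase m + phase k - phase l)
        = x - y + z := by rw [hx, hy, hz]; push_cast; ring
    rw [e1, e2, e3, e4, hA]
    clear_value x y z
    simp only [Real.cos_add, Real.cos_sub, Real.sin_add, Real.sin_sub]
    ring
  have hA0 : 0 ≤ A := by
    have h1 := amp_nonneg N m
    have h2 := amp_nonneg N k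
    have h3 := amp_nonneg N l
    positivity
  have hAle : A * (2 * (N : ℝ) + 2) ≤ 1 / √((N : ℝ) + 1) := by
    have h1 : A ≤ 1 / √((N : ℝ) + 1) * (1 / √((N : ℝ) + 1)) * (1 / √((N : ℝ) + 1)) / 4 := by
      rw [hA]
      gcongr
      · exact amp_nonneg N l
      · exact amp_nonneg N k
      · exact amp_le N m
      · exact amp_le N k
      · exact amp_le N l
    have h2 : 1 / √((N : ℝ) + 1) * (1 / √((N : ℝ) + 1)) = 1 / ((N : ℝ) + 1) := by
      rw [div_mul_div_comm, Real.mul_self_sqrt hM.le, one_mul]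
    rw [h2] at h1
    have h3 : (0 : ℝ) ≤ 1 / √((N : ℝ) + 1) := by positivity
    calc A * (2 * (N : ℝ) + 2) ≤ (1 / ((N : ℝ) + 1) * (1 / √((N : ℝ) + 1)) / 4)
          * (2 * (N : ℝ) + 2) := by gcongr
      _ = 1 / √((N : ℝ) + 1) / 2 := by field_simp; ring
      _ ≤ _ := by linarith
  have hone : ∀ (n : ℤ) (c : ℝ), |A * (if (2 * (N : ℤ) + 2) ∣ n
      then (2 * (N : ℝ) + 2) * Real.cos c else 0)|
      ≤ 1 / √((N : ℝ) + 1) * (if (2 * (N : ℤ) + 2) ∣ n then 1 else 0) := by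
    intro n c
    split_ifs
    · rw [← mul_assoc, abs_mul, abs_of_nonneg (by positivity : 0 ≤ A * (2 * (N : ℝ) + 2))]
      exact mul_le_mul hAle (Real.abs_cos_le_one c) (abs_nonneg _) (by positivity)
    · simp
  rw [tri, Finset.sum_congr rfl fun j _ => e j]
  simp only [Finset.sum_add_distrib, ← Finset.mul_sum, sum_period_cos]
  refine (abs_add_four_le _ _ _ _).trans ?_
  rw [mul_add, mul_add, mul_add]
  gcongr <;> exact hone _ _

theorem abs_le_abs_of_dvd_sub {N : ℕ} {m x : ℤ} (h1 : -((N : ℤ) + 1) ≤ m) (h2 : m ≤ N)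
    (hd : (2 * (N : ℤ) + 2) ∣ m - x) : |m| ≤ |x| := by
  obtain ⟨q, hq⟩ := hd
  have : wrap N x = m := by
    rw [show x = m + (2 * (N : ℤ) + 2) * (-q) by linarith, wrap_add_mul, wrap_of_mem h1 h2]
  rw [← this]
  exact abs_wrap_le N x

theorem wt_le_of_abs_le {s σ : ℝ} (hs : 0 ≤ s) (hσ : 0 ≤ σ) {m k l : ℤ} (h : |m| ≤ |k| + |l|) :
    wt s σ m ≤ 2 ^ s * (wt s σ k * wt s σ l) * (br k ^ (-s) + br l ^ (-s)) := by
  have hR : |(m : ℝ)| ≤ |(k : ℝ)| + |(l : ℝ)| := by exact_mod_cast h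
  have hk := br_pos k
  have hl := br_pos l
  have hks := Real.rpow_pos_of_pos hk s
  have hls := Real.rpow_pos_of_pos hl s
  have e1 : Real.exp (σ * |(m : ℝ)|) ≤ Real.exp (σ * |(k : ℝ)|) * Real.exp (σ * |(l : ℝ)|) := by
    rw [← Real.exp_add, Real.exp_le_exp]
    nlinarith
  have e2 : br m ≤ br k + br l := by
    unfold br
    refine max_le ?_ ?_
    · linarith [le_max_left (1 : ℝ) |(k : ℝ)|, le_max_left (1 : ℝ) |(l : ℝ)|]
    · linarith [le_max_right (1 : ℝ) |(k : ℝ)|, le_max_right (1 : ℝ) |(l : ℝ)|]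
  have e3 : br m ^ s ≤ 2 ^ s * (br k ^ s + br l ^ s) := by
    have hmx : br m ≤ 2 * max (br k) (br l) := by
      linarith [le_max_left (br k) (br l), le_max_right (br k) (br l)]
    calc br m ^ s ≤ (2 * max (br k) (br l)) ^ s :=
          Real.rpow_le_rpow (br_pos m).le hmx hs
      _ = 2 ^ s * max (br k) (br l) ^ s := Real.mul_rpow (by norm_num) (by positivity)
      _ ≤ _ := by
          gcongr
          rcases max_choice (br k) (br l) with h' | h' <;> rw [h'] <;> linarith
  have e4 : br k ^ s * br l ^ s * (br k ^ (-s) + br l ^ (-s)) = br k ^ s + br l ^ s := by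
    rw [Real.rpow_neg hk.le, Real.rpow_neg hl.le]
    field_simp
    ring
  unfold wt
  calc _ ≤ (2 ^ s * (br k ^ s + br l ^ s))
        * (Real.exp (σ * |(k : ℝ)|) * Real.exp (σ * |(l : ℝ)|)) := by gcongr
    _ = _ := by rw [← e4]; ring

theorem br_rpow_mono (k : ℤ) {x y : ℝ} (h : x ≤ y) : br k ^ x ≤ br k ^ y :=
  Real.rpow_le_rpow_of_exponent_le (one_le_br k) h

/-- The kernel that dominates the weighted coefficients: a part of Young type and a part of
Hilbert–Schmidt type. -/
noncomputable def domKer (δ t : ℝ) (N : ℕ) (m k l : ℤ) : ℝ :=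
  kerSum δ N m k l * (br k ^ (-t) + br l ^ (-t)) + br m ^ (-t) * br k ^ (-t) * br l ^ (-t)

/-- The weighted periodic coefficients are dominated by the Young part of `domKer`, because
`|m| ≤ |k| + |l|` wherever they do not vanish. -/
theorem tri_weighted_periodic {s σ : ℝ} (hs : 1 / 2 < s) (hσ : 0 ≤ σ) (δ : ℝ) {N : ℕ} {m k l : ℤ}
    (hm : m ∈ idx .periodic N) :
    |tri .periodic N m k l| * wt s σ m
      ≤ 2 ^ s / √((N : ℝ) + 1) * (wt s σ k * wt s σ l) * domKer δ s N m k l := by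
  simp only [idx, Finset.mem_Icc] at hm
  have hk := wt_pos s σ k
  have hl := wt_pos s σ l
  have hbk := br_pos k
  have hbl := br_pos l
  have hbm := br_pos m
  have hone : ∀ x y : ℤ, |y| ≤ |k| + |l| → x = m - y →
      (if (2 * (N : ℤ) + 2) ∣ x then (1 : ℝ) else 0) * wt s σ m
        ≤ prof δ N x * (2 ^ s * (wt s σ k * wt s σ l) * (br k ^ (-s) + br l ^ (-s))) := by
    intro x y hy hx
    split_ifs with h
    · rw [prof_of_dvd δ h, one_mul, one_mul]
      rw [hx] at h
      exact wt_le_of_abs_le (by linarith) hσ ((abs_le_abs_of_dvd_sub hm.1 hm.2 h).trans hy)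
    · rw [zero_mul]
      have := prof_nonneg δ N x
      positivity
  have h1 := hone (m + k + l) (-k - l) (by rw [← abs_neg k, ← abs_neg l]; exact abs_sub (-k) l |>.trans (by rw [abs_neg l])) (by ring)
  have h2 := hone (m - k - l) (k + l) (abs_add_le _ _) (by ring)
  have h3 := hone (m + k - l) (-k + l) ((abs_add_le _ _).trans (by rw [abs_neg])) (by ring)
  have h4 := hone (m - k + l) (k - l) (abs_sub _ _) (by ring)
  have h5 := abs_tri_periodic_le N m k l
  set P := 2 ^ s * (wt s σ k * wt s σ l) * (br k ^ (-s) + br l ^ (-s)) with hP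
  have h6 : |tri .periodic N m k l| * wt s σ m
      ≤ 1 / √((N : ℝ) + 1) * (kerSum δ N m k l * P) := by
    refine (mul_le_mul_of_nonneg_right h5 (wt_pos s σ m).le).trans ?_
    rw [mul_assoc]
    refine mul_le_mul_of_nonneg_left ?_ (by positivity)
    unfold kerSum
    linarith
  refine h6.trans ?_
  have h7 : 1 / √((N : ℝ) + 1) * (kerSum δ N m k l * P)
      = 2 ^ s / √((N : ℝ) + 1) * (wt s σ k * wt s σ l)
        * (kerSum δ N m k l * (br k ^ (-s) + br l ^ (-s))) := by rw [hP]; ring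
  rw [h7]
  unfold domKer
  gcongr
  have : 0 ≤ br m ^ (-s) * br k ^ (-s) * br l ^ (-s) := by positivity
  linarith

/-! #### Dirichlet boundary conditions -/

theorem sum_dirichlet_sin_odd (N : ℕ) {n : ℤ} (hn : Odd n) :
    Real.sin (n * ang N) * ∑ j ∈ idx .dirichlet N, Real.sin (j * (2 * n * ang N))
      = Real.cos (n * ang N) := by
  have := sum_dirichlet_sin N n
  rw [hn.neg_one_zpow] at this
  linarith

theorem sum_dirichlet_sin_even (N : ℕ) {n : ℤ} (hn : Even n) :
    ∑ j ∈ idx .dirichlet N, Real.sin (j * (2 * n * ang N)) = 0 := by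
  by_cases h0 : Real.sin (n * ang N) = 0
  · obtain ⟨q, rfl⟩ := (sin_ang_eq_zero_iff N n).1 h0
    refine Finset.sum_eq_zero fun j _ => ?_
    have : (j : ℝ) * (2 * (((2 * (N : ℤ) + 2) * q : ℤ) : ℝ) * ang N)
        = ((2 * j * q : ℤ) : ℝ) * Real.pi := by rw [← ang_mul N]; push_cast; ring
    rw [this, Real.sin_int_mul_pi]
  · have := sum_dirichlet_sin N n
    rw [hn.neg_one_zpow, sub_self, zero_mul] at this
    simpa [h0] using this

theorem sum_dirichlet_sin_mul (N : ℕ) (m k l : ℤ) :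
    4 * ∑ j ∈ idx .dirichlet N, Real.sin (j * (2 * m * ang N)) * Real.sin (j * (2 * k * ang N))
        * Real.sin (j * (2 * l * ang N))
      = ∑ j ∈ idx .dirichlet N, Real.sin (j * (2 * ((m + k - l : ℤ) : ℝ) * ang N))
        + ∑ j ∈ idx .dirichlet N, Real.sin (j * (2 * ((m - k + l : ℤ) : ℝ) * ang N))
        - ∑ j ∈ idx .dirichlet N, Real.sin (j * (2 * ((m + k + l : ℤ) : ℝ) * ang N))
        - ∑ j ∈ idx .dirichlet N, Real.sin (j * (2 * ((m - k - l : ℤ) : ℝ) * ang N)) := by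
  rw [← Finset.sum_add_distrib, ← Finset.sum_sub_distrib, ← Finset.sum_sub_distrib,
    Finset.mul_sum]
  refine Finset.sum_congr rfl fun j _ => ?_
  set x := (j : ℝ) * (2 * m * ang N) with hx
  set y := (j : ℝ) * (2 * k * ang N) with hy
  set z := (j : ℝ) * (2 * l * ang N) with hz
  have e1 : (j : ℝ) * (2 * ((m + k + l : ℤ) : ℝ) * ang N) = x + y + z := by
    rw [hx, hy, hz]; push_cast; ring
  have e2 : (j : ℝ) * (2 * ((m - k - l : ℤ) : ℝ) * ang N) = x - y - z := by
    rw [hx, hy, hz]; push_cast; ring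
  have e3 : (j : ℝ) * (2 * ((m + k - l : ℤ) : ℝ) * ang N) = x + y - z := by
    rw [hx, hy, hz]; push_cast; ring
  have e4 : (j : ℝ) * (2 * ((m - k + l : ℤ) : ℝ) * ang N) = x - y + z := by
    rw [hx, hy, hz]; push_cast; ring
  rw [e1, e2, e3, e4]
  clear_value x y z
  simp only [Real.cos_add, Real.cos_sub, Real.sin_add, Real.sin_sub]
  ring

/-- The closed form of the sum of the product of three sines: the four cotangents that it consists
of combine to a product. -/
theorem sum_dirichlet_sin_mul_odd (N : ℕ) {m k l : ℤ} (h : Odd (m + k + l)) :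
    4 * (∑ j ∈ idx .dirichlet N, Real.sin (j * (2 * m * ang N)) * Real.sin (j * (2 * k * ang N))
        * Real.sin (j * (2 * l * ang N)))
      * (Real.sin ((m + k + l : ℤ) * ang N) * Real.sin ((m - k - l : ℤ) * ang N)
        * Real.sin ((m + k - l : ℤ) * ang N) * Real.sin ((m - k + l : ℤ) * ang N))
      = -(Real.sin ((2 * m : ℤ) * ang N) * Real.sin ((2 * k : ℤ) * ang N)
        * Real.sin ((2 * l : ℤ) * ang N)) := by
  rw [sum_dirichlet_sin_mul]
  have o2 : Odd (m - k - l) := by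
    have : m - k - l = (m + k + l) - 2 * (k + l) := by ring
    rw [this]; exact h.sub_even (even_two_mul _)
  have o3 : Odd (m + k - l) := by
    have : m + k - l = (m + k + l) - 2 * l := by ring
    rw [this]; exact h.sub_even (even_two_mul _)
  have o4 : Odd (m - k + l) := by
    have : m - k + l = (m + k + l) - 2 * k := by ring
    rw [this]; exact h.sub_even (even_two_mul _)
  have h1 := sum_dirichlet_sin_odd N h
  have h2 := sum_dirichlet_sin_odd N o2
  have h3 := sum_dirichlet_sin_odd N o3
  have h4 := sum_dirichlet_sin_odd N o4
  set S1 := ∑ j ∈ idx .dirichlet N, Real.sin (j * (2 * ((m + k + l : ℤ) : ℝ) * ang N))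
  set S2 := ∑ j ∈ idx .dirichlet N, Real.sin (j * (2 * ((m - k - l : ℤ) : ℝ) * ang N))
  set S3 := ∑ j ∈ idx .dirichlet N, Real.sin (j * (2 * ((m + k - l : ℤ) : ℝ) * ang N))
  set S4 := ∑ j ∈ idx .dirichlet N, Real.sin (j * (2 * ((m - k + l : ℤ) : ℝ) * ang N))
  set a1 := ((m + k + l : ℤ) : ℝ) * ang N with ha1
  set a2 := ((m - k - l : ℤ) : ℝ) * ang N with ha2
  set a3 := ((m + k - l : ℤ) : ℝ) * ang N with ha3
  set a4 := ((m - k + l : ℤ) : ℝ) * ang N with ha4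
  have hm : ((2 * m : ℤ) : ℝ) * ang N = a1 + a2 := by rw [ha1, ha2]; push_cast; ring
  have hm' : a1 + a2 = a3 + a4 := by rw [ha1, ha2, ha3, ha4]; push_cast; ring
  have hk : ((2 * k : ℤ) : ℝ) * ang N = a3 - a2 := by rw [ha2, ha3]; push_cast; ring
  have hl : ((2 * l : ℤ) : ℝ) * ang N = a1 - a3 := by rw [ha1, ha3]; push_cast; ring
  have ha4' : a4 = a1 + a2 - a3 := by linarith
  have key : Real.sin a1 * Real.sin a2 - Real.sin a3 * Real.sin a4
      = -(Real.sin (a3 - a2) * Real.sin (a1 - a3)) := by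
    have f : ∀ x y : ℝ, Real.sin x * Real.sin y = (Real.cos (x - y) - Real.cos (x + y)) / 2 := by
      intro x y; rw [Real.cos_sub, Real.cos_add]; ring
    rw [f, f, f, ha4', show a3 - (a1 + a2 - a3) = (a3 - a2) - (a1 - a3) by ring,
      show a3 + (a1 + a2 - a3) = a1 + a2 by ring, show a3 - a2 + (a1 - a3) = a1 - a2 by ring]
    ring
  have e34 : Real.cos a3 * Real.sin a4 + Real.cos a4 * Real.sin a3 = Real.sin (a1 + a2) := by
    rw [hm', Real.sin_add]; ring
  have e12 : Real.cos a1 * Real.sin a2 + Real.cos a2 * Real.sin a1 = Real.sin (a1 + a2) := by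
    rw [Real.sin_add]; ring
  rw [hm, hk, hl]
  calc _ = Real.sin a1 * Real.sin a2 * ((Real.sin a3 * S3) * Real.sin a4
          + (Real.sin a4 * S4) * Real.sin a3)
        - Real.sin a3 * Real.sin a4 * ((Real.sin a1 * S1) * Real.sin a2
          + (Real.sin a2 * S2) * Real.sin a1) := by ring
    _ = Real.sin (a1 + a2) * (Real.sin a1 * Real.sin a2 - Real.sin a3 * Real.sin a4) := by
        rw [h1, h2, h3, h4, e34, e12]; ring
    _ = _ := by rw [key]; ring

/-- The product of the distances in the denominator of the Dirichlet coefficients. -/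
noncomputable def denom (N : ℕ) (m k l : ℤ) : ℝ :=
  pdist N (m + k + l) * pdist N (m - k - l) * pdist N (m + k - l) * pdist N (m - k + l)

theorem denom_nonneg (N : ℕ) (m k l : ℤ) : 0 ≤ denom N m k l := by
  unfold denom
  have := pdist_nonneg N
  exact mul_nonneg (mul_nonneg (mul_nonneg (this _) (this _)) (this _)) (this _)

/-- The closed form of the Dirichlet coefficients with sines replaced by distances, for odd
`m + k + l`. -/
theorem abs_tri_dirichlet_le {N : ℕ} {m k l : ℤ} (hm : 0 < m) (hk : 0 < k) (hl : 0 < l)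
    (h : Odd (m + k + l)) :
    |tri .dirichlet N m k l| * denom N m k l
      ≤ 6 / √((N : ℝ) + 1) * (pdist N (2 * m) * pdist N (2 * k) * pdist N (2 * l)) := by
  set S := ∑ j ∈ idx .dirichlet N, Real.sin (j * (2 * m * ang N))
    * Real.sin (j * (2 * k * ang N)) * Real.sin (j * (2 * l * ang N)) with hS
  have hM : (0 : ℝ) < (N : ℝ) + 1 := by positivity
  have hsM : 0 < √((N : ℝ) + 1) := Real.sqrt_pos.2 hM
  have e : tri .dirichlet N m k l = (√2 / √((N : ℝ) + 1)) ^ 3 * S := by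
    rw [tri, hS, Finset.mul_sum]
    refine Finset.sum_congr rfl fun j _ => ?_
    rw [mode_dirichlet N hm, mode_dirichlet N hk, mode_dirichlet N hl]
    ring
  have h1 := congrArg abs (sum_dirichlet_sin_mul_odd N h)
  rw [← hS, abs_neg] at h1
  simp only [abs_mul] at h1
  rw [abs_of_pos (by norm_num : (0 : ℝ) < 4)] at h1
  have hlow : denom N m k l / ((N : ℝ) + 1) ^ 4
      ≤ |Real.sin ((m + k + l : ℤ) * ang N)| * |Real.sin ((m - k - l : ℤ) * ang N)|
        * |Real.sin ((m + k - l : ℤ) * ang N)| * |Real.sin ((m - k + l : ℤ) * ang N)| := by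
    have hd := pdist_nonneg N
    calc _ = pdist N (m + k + l) / (N + 1) * (pdist N (m - k - l) / (N + 1))
          * (pdist N (m + k - l) / (N + 1)) * (pdist N (m - k + l) / (N + 1)) := by
          unfold denom; field_simp
      _ ≤ _ := by
          have := hd (m + k + l)
          have := hd (m - k - l)
          have := hd (m + k - l)
          have := hd (m - k + l)
          gcongr <;> exact le_abs_sin_ang N _
  have hup : |Real.sin ((2 * m : ℤ) * ang N)| * |Real.sin ((2 * k : ℤ) * ang N)|
        * |Real.sin ((2 * l : ℤ) * ang N)|
      ≤ 8 * (pdist N (2 * m) * pdist N (2 * k) * pdist N (2 * l)) / ((N : ℝ) + 1) ^ 3 := by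
    have := pdist_nonneg N (2 * m)
    have := pdist_nonneg N (2 * k)
    calc _ ≤ 2 * pdist N (2 * m) / (N + 1) * (2 * pdist N (2 * k) / (N + 1))
          * (2 * pdist N (2 * l) / (N + 1)) := by
          gcongr <;> exact abs_sin_ang_le N _
      _ = _ := by field_simp; ring
  have h2 : 4 * |S| * (denom N m k l / ((N : ℝ) + 1) ^ 4)
      ≤ 8 * (pdist N (2 * m) * pdist N (2 * k) * pdist N (2 * l)) / ((N : ℝ) + 1) ^ 3 := by
    refine le_trans ?_ hup
    rw [← h1]
    gcongr
  have h3 : |S| * denom N m k l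
      ≤ 2 * ((N : ℝ) + 1) * (pdist N (2 * m) * pdist N (2 * k) * pdist N (2 * l)) := by
    rw [mul_div_assoc', div_le_div_iff₀ (by positivity) (by positivity)] at h2
    have h4 : 0 < 4 * ((N : ℝ) + 1) ^ 3 := by positivity
    refine le_of_mul_le_mul_left ?_ h4
    calc _ = 4 * |S| * denom N m k l * ((N : ℝ) + 1) ^ 3 := by ring
      _ ≤ _ := h2
      _ = _ := by ring
  have h5 : (√2 / √((N : ℝ) + 1)) ^ 3 ≤ 3 / (((N : ℝ) + 1) * √((N : ℝ) + 1)) := by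
    have h6 : √2 ^ 2 = 2 := Real.sq_sqrt (by norm_num)
    have h7 : √((N : ℝ) + 1) ^ 2 = (N : ℝ) + 1 := Real.sq_sqrt hM.le
    rw [div_pow, pow_succ, pow_succ (√((N : ℝ) + 1)), h6, h7]
    gcongr
    have : √2 ≤ 3 / 2 := by
      rw [Real.sqrt_le_left (by norm_num)]; norm_num
    linarith
  rw [e, abs_mul, abs_of_nonneg (by positivity : 0 ≤ (√2 / √((N : ℝ) + 1)) ^ 3), mul_assoc]
  have h8 : 0 ≤ |S| * denom N m k l := mul_nonneg (abs_nonneg _) (denom_nonneg N m k l)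
  calc _ ≤ 3 / (((N : ℝ) + 1) * √((N : ℝ) + 1)) * (2 * ((N : ℝ) + 1)
        * (pdist N (2 * m) * pdist N (2 * k) * pdist N (2 * l))) := by gcongr
    _ = _ := by field_simp; ring

theorem tri_dirichlet_even {N : ℕ} {m k l : ℤ} (hm : 0 < m) (hk : 0 < k) (hl : 0 < l)
    (h : Even (m + k + l)) : tri .dirichlet N m k l = 0 := by
  have o2 : Even (m - k - l) := by
    have : m - k - l = (m + k + l) - 2 * (k + l) := by ring
    rw [this]; exact h.sub (even_two_mul _)
  have o3 : Even (m + k - l) := by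
    have : m + k - l = (m + k + l) - 2 * l := by ring
    rw [this]; exact h.sub (even_two_mul _)
  have o4 : Even (m - k + l) := by
    have : m - k + l = (m + k + l) - 2 * k := by ring
    rw [this]; exact h.sub (even_two_mul _)
  have h1 := sum_dirichlet_sin_mul N m k l
  rw [sum_dirichlet_sin_even N h, sum_dirichlet_sin_even N o2, sum_dirichlet_sin_even N o3,
    sum_dirichlet_sin_even N o4] at h1
  have e : tri .dirichlet N m k l = (√2 / √((N : ℝ) + 1)) ^ 3
      * ∑ j ∈ idx .dirichlet N, Real.sin (j * (2 * m * ang N))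
        * Real.sin (j * (2 * k * ang N)) * Real.sin (j * (2 * l * ang N)) := by
    rw [tri, Finset.mul_sum]
    refine Finset.sum_congr rfl fun j _ => ?_
    rw [mode_dirichlet N hm, mode_dirichlet N hk, mode_dirichlet N hl]
    ring
  rw [e]
  have : (∑ j ∈ idx .dirichlet N, Real.sin (j * (2 * m * ang N))
        * Real.sin (j * (2 * k * ang N)) * Real.sin (j * (2 * l * ang N))) = 0 := by linarith
  rw [this, mul_zero]

/-- If the smallest of the four factors is `u₁`, the three numerators can be estimated by the
other three factors, one of them with a gain. -/
theorem prod_le_of_min {δ p q r l u₁ u₂ u₃ u₄ : ℝ} (hδ : 0 < δ) (hδ1 : δ ≤ 1) (h1 : 1 ≤ u₁)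
    (h12 : u₁ ≤ u₂) (h13 : u₁ ≤ u₃) (h14 : u₁ ≤ u₄) (hq0 : 0 ≤ q) (hr0 : 0 ≤ r)
    (hp : p ≤ u₁ + u₂) (hq : q ≤ u₁ + u₄) (hr : r ≤ u₁ + u₃) (hrl : r ≤ 2 * l) :
    p * q * r ≤ 8 * l ^ δ * u₁ ^ (-(1 + δ)) * (u₁ * u₂ * u₃ * u₄) := by
  have hl0 : 0 ≤ l := by linarith
  have hu1 : 0 < u₁ := by linarith
  have hu2 : 0 < u₂ := by linarith
  have hu3 : 0 < u₃ := by linarith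
  have hu4 : 0 < u₄ := by linarith
  have hr2 : r ≤ 2 * (l / u₁) ^ δ * u₃ := by
    by_cases h : u₁ ≤ l
    · have : 1 ≤ (l / u₁) ^ δ := Real.one_le_rpow ((one_le_div hu1).2 h) hδ.le
      nlinarith
    · push Not at h
      have h2 : l / u₁ ≤ (l / u₁) ^ δ := by
        rcases hl0.eq_or_lt with h0 | h0
        · rw [← h0, zero_div, Real.zero_rpow hδ.ne']
        · have := Real.rpow_le_rpow_of_exponent_ge (div_pos h0 hu1)
            ((div_le_one hu1).2 h.le) hδ1
          rwa [Real.rpow_one] at this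
      have h3 : l ≤ l / u₁ * u₃ := by
        rw [div_mul_eq_mul_div, le_div_iff₀ hu1]
        exact mul_le_mul_of_nonneg_left h13 hl0
      nlinarith
  have e : (l / u₁) ^ δ = l ^ δ * u₁ ^ (-(1 + δ)) * u₁ := by
    rw [Real.div_rpow hl0 hu1.le, div_eq_mul_inv, ← Real.rpow_neg hu1.le, mul_assoc]
    congr 1
    nth_rewrite 3 [← Real.rpow_one u₁]
    rw [← Real.rpow_add hu1]
    congr 1
    ring
  have hp2 : p ≤ 2 * u₂ := by linarith
  have hq2 : q ≤ 2 * u₄ := by linarith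
  calc p * q * r ≤ (2 * u₂) * (2 * u₄) * (2 * (l / u₁) ^ δ * u₃) := by gcongr
    _ = _ := by rw [e]; ring

theorem pdist_two_mul_le {N : ℕ} {l : ℤ} (hl : 0 ≤ l) : pdist N (2 * l) ≤ 2 * l := by
  have := pdist_le_abs N (2 * l)
  rw [abs_of_nonneg (by positivity)] at this
  push_cast at this
  exact this

/-- Each of the three numerators is bounded by the sum of two of the four factors of `denom`, in
two ways, so `prod_le_of_min` applies whichever of the four factors is smallest. -/
theorem pdist_mul_le_kerSum {δ : ℝ} (hδ : 0 < δ) (hδ1 : δ ≤ 1) {N : ℕ} {m k l : ℤ} (hl : 0 ≤ l)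
    (h : Odd (m + k + l)) :
    pdist N (2 * m) * pdist N (2 * k) * pdist N (2 * l)
      ≤ 8 * (l : ℝ) ^ δ * kerSum δ N m k l * denom N m k l := by
  have o2 : Odd (m - k - l) := by
    have : m - k - l = (m + k + l) - 2 * (k + l) := by ring
    rw [this]; exact h.sub_even (even_two_mul _)
  have o3 : Odd (m + k - l) := by
    have : m + k - l = (m + k + l) - 2 * l := by ring
    rw [this]; exact h.sub_even (even_two_mul _)
  have o4 : Odd (m - k + l) := by
    have : m - k + l = (m + k + l) - 2 * k := by ring
    rw [this]; exact h.sub_even (even_two_mul _)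
  have u1 := one_le_pdist_of_odd (N := N) h
  have u2 := one_le_pdist_of_odd (N := N) o2
  have u3 := one_le_pdist_of_odd (N := N) o3
  have u4 := one_le_pdist_of_odd (N := N) o4
  have m12 := pdist_add_le N (m + k + l) (m - k - l)
  have m34 := pdist_add_le N (m + k - l) (m - k + l)
  have k14 := pdist_sub_le N (m + k + l) (m - k + l)
  have k23 := pdist_sub_le N (m + k - l) (m - k - l)
  have l13 := pdist_sub_le N (m + k + l) (m + k - l)
  have l24 := pdist_sub_le N (m - k + l) (m - k - l)
  rw [show m + k + l + (m - k - l) = 2 * m by ring] at m12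
  rw [show m + k - l + (m - k + l) = 2 * m by ring] at m34
  rw [show m + k + l - (m - k + l) = 2 * k by ring] at k14
  rw [show m + k - l - (m - k - l) = 2 * k by ring] at k23
  rw [show m + k + l - (m + k - l) = 2 * l by ring] at l13
  rw [show m - k + l - (m - k - l) = 2 * l by ring] at l24
  have hL := pdist_two_mul_le (N := N) hl
  have q0 := pdist_nonneg N (2 * k)
  have r0 := pdist_nonneg N (2 * l)
  unfold kerSum denom prof
  rw [max_eq_right u1, max_eq_right u2, max_eq_right u3, max_eq_right u4]
  generalize pdist N (m + k + l) = a at *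
  generalize pdist N (m - k - l) = b at *
  generalize pdist N (m + k - l) = c at *
  generalize pdist N (m - k + l) = d at *
  generalize pdist N (2 * m) = p at *
  generalize pdist N (2 * k) = q at *
  generalize pdist N (2 * l) = r at *
  have hlr : (0 : ℝ) ≤ l := by exact_mod_cast hl
  generalize (l : ℝ) = l' at *
  have hld : 0 ≤ l' ^ δ := Real.rpow_nonneg hlr δ
  have ha : 0 < a := by linarith
  have hb : 0 < b := by linarith
  have hc : 0 < c := by linarith
  have hd : 0 < d := by linarith
  have ea : 0 ≤ 8 * l' ^ δ * a ^ (-(1 + δ)) * (a * b * c * d) := by positivity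
  have eb : 0 ≤ 8 * l' ^ δ * b ^ (-(1 + δ)) * (a * b * c * d) := by positivity
  have ec : 0 ≤ 8 * l' ^ δ * c ^ (-(1 + δ)) * (a * b * c * d) := by positivity
  have ed : 0 ≤ 8 * l' ^ δ * d ^ (-(1 + δ)) * (a * b * c * d) := by positivity
  have goal : p * q * r ≤ 8 * l' ^ δ * a ^ (-(1 + δ)) * (a * b * c * d)
      + 8 * l' ^ δ * b ^ (-(1 + δ)) * (a * b * c * d)
      + 8 * l' ^ δ * c ^ (-(1 + δ)) * (a * b * c * d)
      + 8 * l' ^ δ * d ^ (-(1 + δ)) * (a * b * c * d) := by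
    have hmin : (a ≤ b ∧ a ≤ c ∧ a ≤ d) ∨ (b ≤ a ∧ b ≤ c ∧ b ≤ d) ∨ (c ≤ a ∧ c ≤ b ∧ c ≤ d)
        ∨ (d ≤ a ∧ d ≤ b ∧ d ≤ c) := by
      rcases le_total a b with x | x <;> rcases le_total c d with y | y
      · rcases le_total a c with z | z
        · exact Or.inl ⟨x, z, z.trans y⟩
        · exact Or.inr (Or.inr (Or.inl ⟨z, z.trans x, y⟩))
      · rcases le_total a d with z | z
        · exact Or.inl ⟨x, z.trans y, z⟩
        · exact Or.inr (Or.inr (Or.inr ⟨z, z.trans x, y⟩))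
      · rcases le_total b c with z | z
        · exact Or.inr (Or.inl ⟨x, z, z.trans y⟩)
        · exact Or.inr (Or.inr (Or.inl ⟨z.trans x, z, y⟩))
      · rcases le_total b d with z | z
        · exact Or.inr (Or.inl ⟨x, z.trans y, z⟩)
        · exact Or.inr (Or.inr (Or.inr ⟨z.trans x, z, y⟩))
    rcases hmin with ⟨x, y, z⟩ | ⟨x, y, z⟩ | ⟨x, y, z⟩ | ⟨x, y, z⟩
    · have := prod_le_of_min hδ hδ1 u1 x y z q0 r0 m12 k14 l13 hL
      linarith
    · have := prod_le_of_min (p := p) (u₁ := b) (u₂ := a) (u₃ := d) (u₄ := c) hδ hδ1 u2 x z y q0 r0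
        (by linarith) (by linarith) (by linarith) hL
      rw [show b * a * d * c = a * b * c * d by ring] at this
      linarith
    · have := prod_le_of_min (p := p) (u₁ := c) (u₂ := d) (u₃ := a) (u₄ := b) hδ hδ1 u3 z x y q0 r0
        (by linarith) (by linarith) (by linarith) hL
      rw [show c * d * a * b = a * b * c * d by ring] at this
      linarith
    · have := prod_le_of_min (p := p) (u₁ := d) (u₂ := c) (u₃ := b) (u₄ := a) hδ hδ1 u4 z y x q0 r0
        (by linarith) (by linarith) (by linarith) hL
      rw [show d * c * b * a = a * b * c * d by ring] at this
      linarith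
  linarith

theorem denom_pos {N : ℕ} {m k l : ℤ} (h : Odd (m + k + l)) : 0 < denom N m k l := by
  have o2 : Odd (m - k - l) := by
    have : m - k - l = (m + k + l) - 2 * (k + l) := by ring
    rw [this]; exact h.sub_even (even_two_mul _)
  have o3 : Odd (m + k - l) := by
    have : m + k - l = (m + k + l) - 2 * l := by ring
    rw [this]; exact h.sub_even (even_two_mul _)
  have o4 : Odd (m - k + l) := by
    have : m - k + l = (m + k + l) - 2 * k := by ring
    rw [this]; exact h.sub_even (even_two_mul _)
  have u1 := one_le_pdist_of_odd (N := N) h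
  have u2 := one_le_pdist_of_odd (N := N) o2
  have u3 := one_le_pdist_of_odd (N := N) o3
  have u4 := one_le_pdist_of_odd (N := N) o4
  unfold denom
  positivity

/-- The Dirichlet coefficients decay like a summable function of the combinations `m ± k ± l`, up
to the loss `l ^ δ`. The exponent `δ > 0` makes `prof δ` summable. -/
theorem abs_tri_dirichlet_le_kerSum {δ : ℝ} (hδ : 0 < δ) (hδ1 : δ ≤ 1) {N : ℕ} {m k l : ℤ}
    (hm : 0 < m) (hk : 0 < k) (hl : 0 < l) (h : Odd (m + k + l)) :
    |tri .dirichlet N m k l| ≤ 48 / √((N : ℝ) + 1) * (l : ℝ) ^ δ * kerSum δ N m k l := by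
  refine le_of_mul_le_mul_right ?_ (denom_pos (N := N) h)
  refine (abs_tri_dirichlet_le hm hk hl h).trans ?_
  have := pdist_mul_le_kerSum hδ hδ1 (N := N) hl.le h
  calc _ ≤ 6 / √((N : ℝ) + 1) * (8 * (l : ℝ) ^ δ * kerSum δ N m k l * denom N m k l) := by
        gcongr
    _ = _ := by ring

theorem half_le_pdist {N : ℕ} {m x : ℤ} (hm : m ≤ N) (h0 : 0 ≤ m) (h1 : m ≤ 2 * x)
    (h2 : 2 * x ≤ 3 * m) : (m : ℝ) / 2 ≤ pdist N x := by
  obtain ⟨q, hq⟩ := exists_eq_wrap_add N x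
  obtain ⟨b1, b2⟩ := wrap_bounds N x
  have key : m ≤ 2 * |wrap N x| := by
    rcases lt_trichotomy q 0 with h | h | h
    · have : (2 * (N : ℤ) + 2) * q ≤ -(2 * (N : ℤ) + 2) := by nlinarith
      omega
    · rw [h, mul_zero, add_zero] at hq
      rw [← hq]
      have := le_abs_self x
      omega
    · have h5 : 2 * (N : ℤ) + 2 ≤ (2 * (N : ℤ) + 2) * q := by nlinarith
      have := neg_abs_le (wrap N x)
      omega
  rw [pdist]
  have : (m : ℝ) ≤ 2 * |(wrap N x : ℝ)| := by exact_mod_cast key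
  linarith

/-- If `m` is much larger than `k` and `l`, all four combinations `m ± k ± l` are of size `m`, so
that the coefficient is of size `k * l / m ^ 3`. -/
theorem abs_tri_dirichlet_le_far {N : ℕ} {m k l : ℤ} (hm : 0 < m) (hk : 0 < k) (hl : 0 < l)
    (hmN : m ≤ N) (hk4 : 4 * k < m) (hl4 : 4 * l < m) (h : Odd (m + k + l)) :
    |tri .dirichlet N m k l| * (m : ℝ) ^ 3 ≤ 768 / √((N : ℝ) + 1) * (k * l) := by
  have h1 := half_le_pdist (N := N) (x := m + k + l) hmN hm.le (by omega) (by omega)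
  have h2 := half_le_pdist (N := N) (x := m - k - l) hmN hm.le (by omega) (by omega)
  have h3 := half_le_pdist (N := N) (x := m + k - l) hmN hm.le (by omega) (by omega)
  have h4 := half_le_pdist (N := N) (x := m - k + l) hmN hm.le (by omega) (by omega)
  have hmR : (0 : ℝ) < m := by exact_mod_cast hm
  have hden : (m : ℝ) ^ 4 / 16 ≤ denom N m k l := by
    calc _ = (m : ℝ) / 2 * (m / 2) * (m / 2) * (m / 2) := by ring
      _ ≤ _ := by
        unfold denom
        have := pdist_nonneg N (m + k + l)
        gcongr
        · exact mul_nonneg (mul_nonneg (pdist_nonneg _ _) (pdist_nonneg _ _)) (pdist_nonneg _ _)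
        · exact mul_nonneg (pdist_nonneg _ _) (pdist_nonneg _ _)
  have h5 := abs_tri_dirichlet_le hm hk hl h (N := N)
  have h6 : pdist N (2 * m) * pdist N (2 * k) * pdist N (2 * l)
      ≤ (2 * m) * (2 * k) * (2 * l) := by
    have := pdist_nonneg N (2 * m)
    have := pdist_nonneg N (2 * k)
    have := pdist_nonneg N (2 * l)
    have hkR : (0 : ℝ) < k := by exact_mod_cast hk
    gcongr
    · exact pdist_two_mul_le hm.le
    · exact pdist_two_mul_le hk.le
    · exact pdist_two_mul_le hl.le
  have h7 : |tri .dirichlet N m k l| * ((m : ℝ) ^ 4 / 16)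
      ≤ 6 / √((N : ℝ) + 1) * ((2 * m) * (2 * k) * (2 * l)) := by
    refine le_trans ?_ (h5.trans ?_) <;> gcongr
  refine le_of_mul_le_mul_right ?_ (by positivity : 0 < (m : ℝ) / 16)
  calc _ = |tri .dirichlet N m k l| * ((m : ℝ) ^ 4 / 16) := by ring
    _ ≤ _ := h7
    _ = _ := by ring

theorem br_of_pos {k : ℤ} (hk : 0 < k) : br k = k := by
  have : (1 : ℝ) ≤ k := by exact_mod_cast hk
  rw [br, abs_of_nonneg (by linarith), max_eq_right this]

/-- The Young part of the weighted Dirichlet coefficients: if `m` is comparable to `k`, the weight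
of `m` is absorbed by that of `k`. -/
theorem tri_near_le {s δ t : ℝ} (hs : 0 ≤ s) (hδ : 0 < δ) (hδ1 : δ ≤ 1) (ht : t ≤ s - δ) {N : ℕ}
    {m k l : ℤ} (hm : 0 < m) (hk : 0 < k) (hl : 0 < l) (h : Odd (m + k + l)) (hmk : m ≤ 4 * k) :
    |tri .dirichlet N m k l| * br m ^ s
      ≤ 48 * 4 ^ s / √((N : ℝ) + 1) * (br k ^ s * br l ^ s) * (kerSum δ N m k l * br l ^ (-t)) := by
  have hK := kerSum_nonneg δ N m k l
  have bk := br_pos k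
  have bl := br_pos l
  have bm := br_pos m
  have h1 := abs_tri_dirichlet_le_kerSum hδ hδ1 hm hk hl h (N := N)
  rw [← br_of_pos hl] at h1
  have h2 : br m ^ s ≤ 4 ^ s * br k ^ s := by
    rw [← Real.mul_rpow (by norm_num) bk.le]
    refine Real.rpow_le_rpow (br_pos m).le ?_ hs
    rw [br_of_pos hm, br_of_pos hk]
    exact_mod_cast hmk
  have h3 : br l ^ δ ≤ br l ^ s * br l ^ (-t) := by
    rw [← Real.rpow_add bl]
    exact br_rpow_mono l (by linarith)
  calc _ ≤ (48 / √((N : ℝ) + 1) * br l ^ δ * kerSum δ N m k l) * (4 ^ s * br k ^ s) := by gcongr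
    _ ≤ (48 / √((N : ℝ) + 1) * (br l ^ s * br l ^ (-t)) * kerSum δ N m k l)
        * (4 ^ s * br k ^ s) := by gcongr
    _ = _ := by ring

/-- The Hilbert–Schmidt part of the weighted Dirichlet coefficients. A square summable kernel needs
`t > 1 / 2`, which is compatible with `t ≤ 3 - s` only for `s < 5 / 2`. -/
theorem tri_far_le {s t : ℝ} (ht1 : t ≤ 3 - s) (ht2 : 3 * t ≤ 1 + s) {N : ℕ}
    {m k l : ℤ} (hm : 0 < m) (hk : 0 < k) (hl : 0 < l) (hmN : m ≤ N) (h : Odd (m + k + l))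
    (hk4 : 4 * k < m) (hl4 : 4 * l < m) :
    |tri .dirichlet N m k l| * br m ^ s
      ≤ 768 / √((N : ℝ) + 1) * (br k ^ s * br l ^ s)
        * (br m ^ (-t) * br k ^ (-t) * br l ^ (-t)) := by
  have bk := br_pos k
  have bl := br_pos l
  have bm := br_pos m
  have h1 := abs_tri_dirichlet_le_far hm hk hl hmN hk4 hl4 h
  rw [← br_of_pos hl, ← br_of_pos hk, ← br_of_pos hm] at h1
  have hkm : br k ≤ br m := by
    rw [br_of_pos hm, br_of_pos hk]; exact_mod_cast (by omega : k ≤ m)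
  have hlm : br l ≤ br m := by
    rw [br_of_pos hm, br_of_pos hl]; exact_mod_cast (by omega : l ≤ m)
  have hpow : br k ^ (1 - s + t) * br l ^ (1 - s + t) ≤ br m ^ (3 - s - t) := by
    by_cases h0 : 0 ≤ 1 - s + t
    · calc _ ≤ br m ^ (1 - s + t) * br m ^ (1 - s + t) := by gcongr
        _ = br m ^ ((1 - s + t) + (1 - s + t)) := (Real.rpow_add bm _ _).symm
        _ ≤ _ := br_rpow_mono m (by linarith)
    · push Not at h0
      have e1 : br k ^ (1 - s + t) ≤ 1 := Real.rpow_le_one_of_one_le_of_nonpos (one_le_br k) h0.le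
      have e2 : br l ^ (1 - s + t) ≤ 1 := Real.rpow_le_one_of_one_le_of_nonpos (one_le_br l) h0.le
      have e3 : 1 ≤ br m ^ (3 - s - t) := Real.one_le_rpow (one_le_br m) (by linarith)
      have e4 : 0 ≤ br l ^ (1 - s + t) := by positivity
      nlinarith
  have hsplit : ∀ x : ℝ, 0 < x → x = x ^ (1 - s + t) * (x ^ s * x ^ (-t)) := by
    intro x hx
    rw [← Real.rpow_add hx, ← Real.rpow_add hx]
    nth_rewrite 1 [← Real.rpow_one x]
    congr 1
    ring
  have hm3 : br m ^ (3 - s - t) * br m ^ s = br m ^ 3 * br m ^ (-t) := by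
    rw [← Real.rpow_natCast, ← Real.rpow_add bm, ← Real.rpow_add bm]
    congr 1
    push_cast
    ring
  refine le_of_mul_le_mul_left ?_ (by positivity : 0 < br m ^ 3)
  calc _ = (|tri .dirichlet N m k l| * br m ^ 3) * br m ^ s := by ring
    _ ≤ (768 / √((N : ℝ) + 1) * (br k * br l)) * br m ^ s := by gcongr
    _ = 768 / √((N : ℝ) + 1) * ((br k ^ (1 - s + t) * br l ^ (1 - s + t))
        * ((br k ^ s * br k ^ (-t)) * (br l ^ s * br l ^ (-t)))) * br m ^ s := by
      nth_rewrite 1 [hsplit _ bk, hsplit _ bl]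
      ring
    _ ≤ 768 / √((N : ℝ) + 1) * (br m ^ (3 - s - t)
        * ((br k ^ s * br k ^ (-t)) * (br l ^ s * br l ^ (-t)))) * br m ^ s := by gcongr
    _ = 768 / √((N : ℝ) + 1) * ((br m ^ (3 - s - t) * br m ^ s)
        * ((br k ^ s * br k ^ (-t)) * (br l ^ s * br l ^ (-t)))) := by ring
    _ = _ := by rw [hm3]; ring

theorem tri_swap (bc : BC) (N : ℕ) (m k l : ℤ) : tri bc N m k l = tri bc N m l k :=
  Finset.sum_congr rfl fun _ _ => mul_right_comm _ _ _

theorem wt_zero_right (s : ℝ) (k : ℤ) : wt s 0 k = br k ^ s := by simp [wt]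

/-- The weighted Dirichlet coefficients are dominated by `domKer`. -/
theorem tri_weighted_dirichlet {s δ t : ℝ} (hs : 0 ≤ s) (hδ : 0 < δ) (hδ1 : δ ≤ 1)
    (ht : t ≤ s - δ) (ht1 : t ≤ 3 - s) (ht2 : 3 * t ≤ 1 + s) {N : ℕ} {m k l : ℤ}
    (hm : m ∈ idx .dirichlet N) (hk : k ∈ idx .dirichlet N) (hl : l ∈ idx .dirichlet N) :
    |tri .dirichlet N m k l| * wt s 0 m
      ≤ (48 * 4 ^ s + 768) / √((N : ℝ) + 1) * (wt s 0 k * wt s 0 l) * domKer δ t N m k l := by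
  simp only [idx, Finset.mem_Icc] at hm hk hl
  simp only [wt_zero_right]
  have bk := br_pos k
  have bl := br_pos l
  have bm := br_pos m
  have hK := kerSum_nonneg δ N m k l
  rcases Int.even_or_odd (m + k + l) with h | h
  · rw [tri_dirichlet_even (by omega) (by omega) (by omega) h, abs_zero, zero_mul]
    unfold domKer
    positivity
  · have e0 : 0 ≤ kerSum δ N m k l * br k ^ (-t) := by positivity
    have e1 : 0 ≤ kerSum δ N m k l * br l ^ (-t) := by positivity
    have e2 : 0 ≤ br m ^ (-t) * br k ^ (-t) * br l ^ (-t) := by positivity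
    have e3 : (48 : ℝ) * 4 ^ s ≤ 48 * 4 ^ s + 768 := by linarith
    have e4 : (768 : ℝ) ≤ 48 * 4 ^ s + 768 := by
      have : (0 : ℝ) < 4 ^ s := by positivity
      linarith
    unfold domKer
    rw [mul_add (kerSum δ N m k l)]
    by_cases h1 : m ≤ 4 * k
    · refine (tri_near_le hs hδ hδ1 ht (by omega) (by omega) (by omega) h h1).trans ?_
      gcongr
      linarith
    by_cases h2 : m ≤ 4 * l
    · rw [tri_swap]
      refine (tri_near_le hs hδ hδ1 ht (by omega) (by omega) (by omega)
        (by rwa [add_right_comm] at h) h2).trans ?_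
      rw [← kerSum_swap, mul_comm (br l ^ s)]
      gcongr
      linarith
    · refine (tri_far_le ht1 ht2 (by omega) (by omega) (by omega) (by omega) h (by omega)
        (by omega)).trans ?_
      gcongr
      linarith

/-! #### Boundedness of the product -/

theorem summable_br_rpow {x : ℝ} (hx : 1 < x) : Summable fun n : ℤ => br n ^ (-x) := by
  have h1 := Real.summable_abs_int_rpow hx
  have h2 : Summable fun n : ℤ => if n = 0 then (1 : ℝ) else 0 :=
    summable_of_ne_finset_zero (s := {0}) (by intro b hb; simp at hb; simp [hb])
  refine (h1.add h2).of_nonneg_of_le (fun n => (Real.rpow_pos_of_pos (br_pos n) _).le) fun n => ?_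
  by_cases hn : n = 0
  · subst hn
    simp [br]
    positivity
  · have : (1 : ℝ) ≤ |(n : ℝ)| := by exact_mod_cast Int.one_le_abs hn
    rw [if_neg hn, add_zero, br, max_eq_right this]

/-- The number `∑_n [n]^{-x}`. -/
noncomputable def brSum (x : ℝ) : ℝ := ∑' n : ℤ, br n ^ (-x)

theorem sum_br_le {x : ℝ} (hx : 1 < x) (s : Finset ℤ) : ∑ n ∈ s, br n ^ (-x) ≤ brSum x :=
  (summable_br_rpow hx).sum_le_tsum s fun n _ => (Real.rpow_pos_of_pos (br_pos n) _).le

theorem brSum_nonneg (x : ℝ) : 0 ≤ brSum x :=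
  tsum_nonneg fun n => (Real.rpow_pos_of_pos (br_pos n) _).le

theorem idx_subset (bc : BC) (N : ℕ) : idx bc N ⊆ idx .periodic N := by
  cases bc
  · exact subset_rfl
  · intro x hx
    simp only [idx, Finset.mem_Icc] at hx ⊢
    omega

theorem sum_prof_le {δ : ℝ} (hδ : 0 < δ) (bc : BC) (N : ℕ) (y : ℤ) :
    ∑ k : ↥(idx bc N), prof δ N (k + y) ≤ brSum (1 + δ) := by
  have h1 : ∀ x : ℤ, prof δ N x = br (wrap N x) ^ (-(1 + δ)) := fun x => rfl
  rw [Finset.sum_coe_sort (idx bc N) fun k => prof δ N (k + y)]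
  simp only [h1]
  have hinj : Set.InjOn (fun k : ℤ => wrap N (k + y)) (idx bc N) := by
    intro k hk k' hk' h
    have hk := idx_subset bc N hk
    have hk' := idx_subset bc N hk'
    simp only [idx, Finset.mem_Icc] at hk hk' h
    obtain ⟨q, hq⟩ := exists_eq_wrap_add N (k + y)
    obtain ⟨q', hq'⟩ := exists_eq_wrap_add N (k' + y)
    have h2 : k - k' = (2 * (N : ℤ) + 2) * (q - q') := by rw [h] at hq; linarith
    have h3 : k - k' = 0 := by
      apply Int.eq_zero_of_abs_lt_dvd ⟨_, h2⟩
      rw [abs_lt]; omega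
    omega
  rw [← Finset.sum_image (f := fun x => br x ^ (-(1 + δ))) hinj]
  exact sum_br_le (by linarith) _

theorem sum_kerSum_le {δ : ℝ} (hδ : 0 < δ) (bc : BC) (N : ℕ) (m l : ℤ) :
    ∑ k : ↥(idx bc N), kerSum δ N m k l ≤ 4 * brSum (1 + δ) := by
  have h1 := sum_prof_le hδ bc N (m + l)
  have h2 := sum_prof_le hδ bc N (l - m)
  have h3 := sum_prof_le hδ bc N (m - l)
  have h4 := sum_prof_le hδ bc N (-m - l)
  have e : ∀ k : ℤ, kerSum δ N m k l = prof δ N (k + (m + l)) + prof δ N (k + (l - m))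
      + prof δ N (k + (m - l)) + prof δ N (k + (-m - l)) := by
    intro k
    unfold kerSum
    rw [← prof_neg δ N (m - k - l), ← prof_neg δ N (m - k + l),
      show m + k + l = k + (m + l) by ring, show -(m - k - l) = k + (l - m) by ring,
      show m + k - l = k + (m - l) by ring, show -(m - k + l) = k + (-m - l) by ring]
  simp only [e, Finset.sum_add_distrib]
  linarith

theorem sum_kerSum_le' {δ : ℝ} (hδ : 0 < δ) (bc : BC) (N : ℕ) (k l : ℤ) :
    ∑ m : ↥(idx bc N), kerSum δ N m k l ≤ 4 * brSum (1 + δ) := by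
  have h1 := sum_prof_le hδ bc N (k + l)
  have h2 := sum_prof_le hδ bc N (-k - l)
  have h3 := sum_prof_le hδ bc N (k - l)
  have h4 := sum_prof_le hδ bc N (-k + l)
  have e : ∀ m : ℤ, kerSum δ N m k l = prof δ N (m + (k + l)) + prof δ N (m + (-k - l))
      + prof δ N (m + (k - l)) + prof δ N (m + (-k + l)) := by
    intro m
    unfold kerSum
    rw [show m + k + l = m + (k + l) by ring, show m - k - l = m + (-k - l) by ring,
      show m + k - l = m + (k - l) by ring, show m - k + l = m + (-k + l) by ring]
  simp only [e, Finset.sum_add_distrib]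
  linarith

theorem l2_br_le {t : ℝ} (ht : 1 / 2 < t) (bc : BC) (N : ℕ) :
    l2 (fun k : ↥(idx bc N) => br k ^ (-t)) ≤ √(brSum (2 * t)) := by
  unfold l2
  refine Real.sqrt_le_sqrt ?_
  have e : ∀ k : ℤ, (br k ^ (-t)) ^ 2 = br k ^ (-(2 * t)) := by
    intro k
    rw [← Real.rpow_natCast, ← Real.rpow_mul (br_pos k).le]
    congr 1
    push_cast
    ring
  simp only [e]
  rw [Finset.sum_coe_sort (idx bc N) fun k => br k ^ (-(2 * t))]
  exact sum_br_le (by linarith) _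

/-- The bound on `domKer` is uniform in `N`, since it involves only the sums of `[n]^{-(1 + δ)}`
and `[n]^{-2t}` over all integers. -/
theorem kernelBdd_domKer {δ t : ℝ} (hδ : 0 < δ) (ht : 1 / 2 < t) : ∃ C : ℝ, 0 ≤ C ∧
    ∀ (bc : BC) (N : ℕ), KernelBdd (fun m k l : ↥(idx bc N) => domKer δ t N m k l) C := by
  set D := √(brSum (2 * t)) with hD
  have hS := brSum_nonneg (1 + δ)
  refine ⟨4 * brSum (1 + δ) * D + 4 * brSum (1 + δ) * D + D ^ 3, by positivity, fun bc N => ?_⟩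
  have hl2 := l2_br_le ht bc N
  have h1 : KernelBdd (fun m k l : ↥(idx bc N) => kerSum δ N m k l * br l ^ (-t))
      (4 * brSum (1 + δ) * D) :=
    kernelBdd_schur (E := fun m k l : ↥(idx bc N) => kerSum δ N m k l)
      (fun m k l => kerSum_nonneg δ N m k l)
      (fun l => (Real.rpow_pos_of_pos (br_pos l) _).le) (by positivity)
      (fun m l => sum_kerSum_le hδ bc N m l) (fun k l => sum_kerSum_le' hδ bc N k l) hl2
  have h2 := (h1.add h1.swap).add
    (kernelBdd_hilbertSchmidt (u := fun k : ↥(idx bc N) => br k ^ (-t)) hl2 hl2 hl2)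
  refine h2.mono (fun m k l => ?_) fun m k l => ?_
  · have := kerSum_nonneg δ N m k l
    have := br_pos k
    have := br_pos l
    have := br_pos m
    unfold domKer
    positivity
  · unfold domKer
    rw [kerSum_swap δ N m l k]
    exact le_of_eq (by ring)

/-- The product, with the absolute values of its Fourier coefficients. -/
noncomputable def prodMaj (bc : BC) (N : ℕ) (x y : ↥(idx bc N) → ℝ) (m : ↥(idx bc N)) : ℝ :=
  ∑ k : ↥(idx bc N), ∑ l : ↥(idx bc N), |tri bc N m k l| * x k * y l

/-- The weights of `‖·‖_{s,σ}`, including the normalization by `μ`. -/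
noncomputable def weight (bc : BC) (N : ℕ) (s σ : ℝ) (k : ↥(idx bc N)) : ℝ :=
  √(mu N) * wt s σ k

/-- The phase space norms are algebra norms for the pointwise product, with constants that do not
depend on the number of particles. -/
theorem prodMaj_bdd {bc : BC} {s σ : ℝ} (h : Admissible bc s σ) : ∃ C : ℝ, 0 ≤ C ∧
    ∀ N : ℕ, 1 ≤ N → ∀ x y : ↥(idx bc N) → ℝ, (∀ k, 0 ≤ x k) → (∀ k, 0 ≤ y k) →
      l2 (fun m => weight bc N s σ m * prodMaj bc N x y m)
        ≤ C * l2 (fun k => weight bc N s σ k * x k) * l2 (fun k => weight bc N s σ k * y k) := by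
  have key : ∃ δ t C : ℝ, 0 < δ ∧ 1 / 2 < t ∧ 0 ≤ C ∧ ∀ N : ℕ, ∀ m k l : ↥(idx bc N),
      |tri bc N m k l| * wt s σ m
        ≤ C / √((N : ℝ) + 1) * (wt s σ k * wt s σ l) * domKer δ t N m k l := by
    cases bc with
    | periodic =>
      exact ⟨1, s, 2 ^ s, one_pos, h.1, by positivity,
        fun N m k l => tri_weighted_periodic h.1 h.2 1 m.2⟩
    | dirichlet =>
      obtain ⟨h1, h2, rfl⟩ := h
      refine ⟨(s - 1 / 2) / 2, min (1 / 2 + (s - 1 / 2) / 4) (3 - s), 48 * 4 ^ s + 768,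
        by linarith, lt_min (by linarith) (by linarith), by positivity, fun N m k l => ?_⟩
      have h3 := min_le_left (1 / 2 + (s - 1 / 2) / 4) (3 - s)
      have h4 := min_le_right (1 / 2 + (s - 1 / 2) / 4) (3 - s)
      exact tri_weighted_dirichlet (by linarith) (by linarith) (by linarith) (by linarith) h4
        (by linarith) m.2 k.2 l.2
  obtain ⟨δ, t, C, hδ, ht, hC, hker⟩ := key
  obtain ⟨D, hD, hdom⟩ := kernelBdd_domKer hδ ht
  refine ⟨C * D, by positivity, fun N hN x y hx hy => ?_⟩
  have hN0 : (0 : ℝ) < N := by exact_mod_cast hN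
  have hmu : 0 < mu N := by unfold mu; positivity
  have hw : ∀ k : ↥(idx bc N), 0 < weight bc N s σ k := fun k =>
    mul_pos (Real.sqrt_pos.2 hmu) (wt_pos s σ k)
  have hmuN : 1 / √((N : ℝ) + 1) ≤ √(mu N) := by
    rw [mu, Real.sqrt_div zero_le_one, Real.sqrt_one]
    apply one_div_le_one_div_of_le (Real.sqrt_pos.2 hN0)
    exact Real.sqrt_le_sqrt (by linarith)
  have hcoef : ∀ m k l : ↥(idx bc N), weight bc N s σ m * |tri bc N m k l|
      ≤ (C * domKer δ t N m k l) * weight bc N s σ k * weight bc N s σ l := by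
    intro m k l
    have h1 := hker N m k l
    have hd : 0 ≤ domKer δ t N m k l := by
      have := kerSum_nonneg δ N m k l
      have := br_pos k
      have := br_pos l
      have := br_pos m
      unfold domKer
      positivity
    have hk := wt_pos s σ k
    have hl := wt_pos s σ l
    unfold weight
    calc √(mu N) * wt s σ m * |tri bc N m k l| = √(mu N) * (|tri bc N m k l| * wt s σ m) := by ring
      _ ≤ √(mu N) * (C / √((N : ℝ) + 1) * (wt s σ k * wt s σ l) * domKer δ t N m k l) := by gcongr
      _ = √(mu N) * (1 / √((N : ℝ) + 1)) * (C * (wt s σ k * wt s σ l) * domKer δ t N m k l) := by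
        ring
      _ ≤ √(mu N) * √(mu N) * (C * (wt s σ k * wt s σ l) * domKer δ t N m k l) := by gcongr
      _ = _ := by ring
  have h1 := ((hdom bc N).const_mul hC) (fun k => weight bc N s σ k * x k)
    (fun k => weight bc N s σ k * y k) (fun k => mul_nonneg (hw k).le (hx k))
    (fun k => mul_nonneg (hw k).le (hy k))
  refine (l2_mono (fun m => ?_) fun m => ?_).trans h1
  · exact mul_nonneg (hw m).le (Finset.sum_nonneg fun k _ => Finset.sum_nonneg fun l _ =>
      mul_nonneg (mul_nonneg (abs_nonneg _) (hx k)) (hy l))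
  · unfold prodMaj
    rw [Finset.mul_sum]
    refine Finset.sum_le_sum fun k _ => ?_
    rw [Finset.mul_sum]
    refine Finset.sum_le_sum fun l _ => ?_
    calc _ = (weight bc N s σ m * |tri bc N m k l|) * (x k * y l) := by ring
      _ ≤ _ := mul_le_mul_of_nonneg_right (hcoef m k l) (mul_nonneg (hx k) (hy l))
      _ = _ := by ring

/-! ### Polynomial Hamiltonian fields in complex coordinates -/

section Tensors

variable {ι : Type*}

/-- The sign `±1` that distinguishes the coordinates `ψ_k` and `ψ̄_k`. -/
def sgn (b : Bool) : ℤ := if b then 1 else -1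

/-- The index of the complex conjugate coordinate. -/
def bar (a : ι × Bool) : ι × Bool := (a.1, !a.2)

@[simp] theorem bar_fst (a : ι × Bool) : (bar a).1 = a.1 := rfl

@[simp] theorem bar_bar (a : ι × Bool) : bar (bar a) = a := by simp [bar]

theorem sgn_bar (a : ι × Bool) : sgn (bar a).2 = -sgn a.2 := by
  rcases a with ⟨k, _ | _⟩ <;> simp [bar, sgn]

theorem sum_bar [Fintype ι] {M : Type*} [AddCommMonoid M] (f : ι × Bool → M) :
    ∑ a, f (bar a) = ∑ a, f a :=
  Equiv.sum_comp (Function.Involutive.toPerm bar bar_bar) f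

/-- The complex coordinates: `ψ_k` at the index `(k, true)` and `ψ̄_k` at `(k, false)`. -/
noncomputable def coord [Fintype ι] (a : ι × Bool) : (ι → ℂ) →L[ℝ] ℂ :=
  if a.2 then ContinuousLinearMap.proj a.1
  else (Complex.conjCLE : ℂ →L[ℝ] ℂ) ∘L ContinuousLinearMap.proj a.1

/-- The Hamiltonian field `i ω_k ψ_k` of `∑_k ω_k |ψ_k|²`. -/
noncomputable def linField (ω : ι → ℝ) : (ι → ℂ) →L[ℝ] (ι → ℂ) :=
  ContinuousLinearMap.pi fun k =>
    (Complex.I * (ω k : ℂ)) • (ContinuousLinearMap.proj k : (ι → ℂ) →L[ℝ] ℂ)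

theorem linField_apply (ω : ι → ℝ) (ψ : ι → ℂ) (k : ι) :
    linField ω ψ k = Complex.I * ω k * ψ k := by simp [linField]

/-- The signed frequency of a complex coordinate. -/
def sfreq (ω : ι → ℝ) (a : ι × Bool) : ℝ := sgn a.2 * ω a.1

theorem sfreq_bar (ω : ι → ℝ) (a : ι × Bool) : sfreq ω (bar a) = -sfreq ω a := by
  simp [sfreq, sgn_bar]

variable [Fintype ι]

@[simp] theorem coord_true (k : ι) (ψ : ι → ℂ) : coord (k, true) ψ = ψ k := by simp [coord]

@[simp] theorem coord_false (k : ι) (ψ : ι → ℂ) : coord (k, false) ψ = conj (ψ k) := by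
  simp [coord]

theorem coord_bar (a : ι × Bool) (ψ : ι → ℂ) : coord (bar a) ψ = conj (coord a ψ) := by
  rcases a with ⟨k, _ | _⟩ <;> simp [bar]

theorem norm_coord (a : ι × Bool) (ψ : ι → ℂ) : ‖coord a ψ‖ = ‖ψ a.1‖ := by
  rcases a with ⟨k, _ | _⟩ <;> simp

/-- A symmetric tensor of order three, real in the sense that the cubic polynomial which it defines
takes real values. -/
structure IsTensor₃ (h : ι × Bool → ι × Bool → ι × Bool → ℂ) : Prop where
  real : ∀ a b c, h (bar a) (bar b) (bar c) = conj (h a b c)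
  swap : ∀ a b c, h a b c = h b a c
  swap' : ∀ a b c, h a b c = h a c b

/-- A symmetric real tensor of order four. -/
structure IsTensor₄ (t : ι × Bool → ι × Bool → ι × Bool → ι × Bool → ℂ) : Prop where
  real : ∀ a b c d, t (bar a) (bar b) (bar c) (bar d) = conj (t a b c d)
  swap : ∀ a b c d, t a b c d = t b a c d
  swap' : ∀ a b c d, t a b c d = t a c b d
  swap'' : ∀ a b c d, t a b c d = t a b d c

/-- The trilinear form with coefficients `h`. -/
noncomputable def form₃ (h : ι × Bool → ι × Bool → ι × Bool → ℂ) (u v w : ι → ℂ) : ℂ :=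
  ∑ a, ∑ b, ∑ c, h a b c * (coord a u * (coord b v * coord c w))

/-- The quadrilinear form with coefficients `t`. -/
noncomputable def form₄ (t : ι × Bool → ι × Bool → ι × Bool → ι × Bool → ℂ)
    (x u v w : ι → ℂ) : ℂ :=
  ∑ a, ∑ b, ∑ c, ∑ d, t a b c d * (coord a x * (coord b u * (coord c v * coord d w)))

/-- The polarized Hamiltonian field `i ∂f/∂ψ̄` of the cubic polynomial `f` with
`∂f/∂z_a = ∑ h_{abc} z_b z_c`. -/
noncomputable def field₂ (h : ι × Bool → ι × Bool → ι × Bool → ℂ) :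
    (ι → ℂ) →L[ℝ] (ι → ℂ) →L[ℝ] (ι → ℂ) :=
  LinearMap.toContinuousBilinearMap <| LinearMap.mk₂ ℝ
    (fun u v k => Complex.I * ∑ b, ∑ c, h (k, false) b c * (coord b u * coord c v))
    (fun u u' v => by
      funext k
      simp only [map_add, add_mul, mul_add, Finset.sum_add_distrib, Pi.add_apply])
    (fun r u v => by
      funext k
      simp only [map_smul, Pi.smul_apply, Complex.real_smul, Finset.mul_sum]
      exact Finset.sum_congr rfl fun b _ => Finset.sum_congr rfl fun c _ => by ring)
    (fun u v v' => by
      funext k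
      simp only [map_add, mul_add, Finset.sum_add_distrib, Pi.add_apply])
    (fun r u v => by
      funext k
      simp only [map_smul, Pi.smul_apply, Complex.real_smul, Finset.mul_sum]
      exact Finset.sum_congr rfl fun b _ => Finset.sum_congr rfl fun c _ => by ring)

theorem field₂_apply (h : ι × Bool → ι × Bool → ι × Bool → ℂ) (u v : ι → ℂ) (k : ι) :
    field₂ h u v k
      = Complex.I * ∑ b, ∑ c, h (k, false) b c * (coord b u * coord c v) := rfl

/-- The polarized Hamiltonian field of a quartic polynomial. -/
noncomputable def field₃ (t : ι × Bool → ι × Bool → ι × Bool → ι × Bool → ℂ) :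
    (ι → ℂ) →L[ℝ] (ι → ℂ) →L[ℝ] (ι → ℂ) →L[ℝ] (ι → ℂ) :=
  LinearMap.toContinuousLinearMap
    { toFun := fun u => field₂ fun a c d => ∑ b, t a b c d * coord b u
      map_add' := fun u u' => by
        ext v w k
        simp only [field₂_apply, map_add, mul_add, add_mul, Finset.sum_add_distrib,
          add_apply, Pi.add_apply]
      map_smul' := fun r u => by
        ext v w k
        simp only [field₂_apply, map_smul, smul_apply, Pi.smul_apply, Complex.real_smul,
          Finset.mul_sum, Finset.sum_mul, RingHom.id_apply]
        refine Finset.sum_congr rfl fun b _ => Finset.sum_congr rfl fun c _ =>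
          Finset.sum_congr rfl fun d _ => ?_
        ring }

theorem field₃_apply (t : ι × Bool → ι × Bool → ι × Bool → ι × Bool → ℂ) (u v w : ι → ℂ) (k : ι) :
    field₃ t u v w k = Complex.I * ∑ b, ∑ c, ∑ d, t (k, false) b c d
      * (coord b u * (coord c v * coord d w)) := by
  change field₂ (fun a c d => ∑ b, t a b c d * coord b u) v w k = _
  rw [field₂_apply]
  congr 1
  simp only [Finset.sum_mul]
  rw [Finset.sum_congr rfl fun c _ => Finset.sum_comm, Finset.sum_comm]
  refine Finset.sum_congr rfl fun b _ => Finset.sum_congr rfl fun c _ =>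
    Finset.sum_congr rfl fun d _ => ?_
  ring

theorem form₃_swap {h : ι × Bool → ι × Bool → ι × Bool → ℂ} (hh : IsTensor₃ h) (u v w : ι → ℂ) :
    form₃ h u v w = form₃ h v u w := by
  unfold form₃
  rw [Finset.sum_comm]
  refine Finset.sum_congr rfl fun a _ => Finset.sum_congr rfl fun b _ =>
    Finset.sum_congr rfl fun c _ => ?_
  rw [hh.swap]
  ring

theorem form₃_swap' {h : ι × Bool → ι × Bool → ι × Bool → ℂ} (hh : IsTensor₃ h) (u v w : ι → ℂ) :
    form₃ h u v w = form₃ h u w v := by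
  unfold form₃
  refine Finset.sum_congr rfl fun a _ => ?_
  rw [Finset.sum_comm]
  refine Finset.sum_congr rfl fun b _ => Finset.sum_congr rfl fun c _ => ?_
  rw [hh.swap']
  ring

theorem form₄_swap {t : ι × Bool → ι × Bool → ι × Bool → ι × Bool → ℂ} (ht : IsTensor₄ t)
    (x u v w : ι → ℂ) : form₄ t x u v w = form₄ t u x v w := by
  unfold form₄
  rw [Finset.sum_comm]
  refine Finset.sum_congr rfl fun a _ => Finset.sum_congr rfl fun b _ =>
    Finset.sum_congr rfl fun c _ => Finset.sum_congr rfl fun d _ => ?_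
  rw [ht.swap]
  ring

theorem form₄_swap' {t : ι × Bool → ι × Bool → ι × Bool → ι × Bool → ℂ} (ht : IsTensor₄ t)
    (x u v w : ι → ℂ) : form₄ t x u v w = form₄ t x v u w := by
  unfold form₄
  refine Finset.sum_congr rfl fun a _ => ?_
  rw [Finset.sum_comm]
  refine Finset.sum_congr rfl fun b _ => Finset.sum_congr rfl fun c _ =>
    Finset.sum_congr rfl fun d _ => ?_
  rw [ht.swap']
  ring

theorem form₄_swap'' {t : ι × Bool → ι × Bool → ι × Bool → ι × Bool → ℂ} (ht : IsTensor₄ t)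
    (x u v w : ι → ℂ) : form₄ t x u v w = form₄ t x u w v := by
  unfold form₄
  refine Finset.sum_congr rfl fun a _ => Finset.sum_congr rfl fun b _ => ?_
  rw [Finset.sum_comm]
  refine Finset.sum_congr rfl fun c _ => Finset.sum_congr rfl fun d _ => ?_
  rw [ht.swap'']
  ring

theorem isSymm_field₂ {h : ι × Bool → ι × Bool → ι × Bool → ℂ} (hh : IsTensor₃ h) :
    IsSymm₂ (field₂ h) := by
  intro u v
  funext k
  rw [field₂_apply, field₂_apply, Finset.sum_comm]
  congr 1
  refine Finset.sum_congr rfl fun b _ => Finset.sum_congr rfl fun c _ => ?_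
  rw [hh.swap']
  ring

theorem isSymm_field₃ {t : ι × Bool → ι × Bool → ι × Bool → ι × Bool → ℂ} (ht : IsTensor₄ t) :
    IsSymm₃ (field₃ t) := by
  refine fun u v w => ⟨?_, ?_⟩
  · funext k
    rw [field₃_apply, field₃_apply, Finset.sum_comm]
    congr 1
    refine Finset.sum_congr rfl fun b _ => Finset.sum_congr rfl fun c _ =>
      Finset.sum_congr rfl fun d _ => ?_
    rw [ht.swap']
    ring
  · funext k
    rw [field₃_apply, field₃_apply]
    congr 1
    refine Finset.sum_congr rfl fun b _ => ?_
    rw [Finset.sum_comm]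
    refine Finset.sum_congr rfl fun c _ => Finset.sum_congr rfl fun d _ => ?_
    rw [ht.swap'']
    ring

/-- The complex coordinates of the Hamiltonian field `i G_{ψ̄}` of a real gradient `G`. -/
theorem coord_I_mul {G : ι × Bool → ℂ} (hG : ∀ a, G (bar a) = conj (G a)) (a : ι × Bool) :
    coord a (fun k => Complex.I * G (k, false)) = Complex.I * sgn a.2 * G (bar a) := by
  rcases a with ⟨k, _ | _⟩
  · have := hG (k, false)
    simp [sgn, this]
  · simp [sgn, bar]

theorem conj_gradient₂ {h : ι × Bool → ι × Bool → ι × Bool → ℂ} (hh : IsTensor₃ h) (u v : ι → ℂ)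
    (a : ι × Bool) : ∑ b, ∑ c, h (bar a) b c * (coord b u * coord c v)
      = conj (∑ b, ∑ c, h a b c * (coord b u * coord c v)) := by
  rw [← sum_bar]
  simp only [map_sum, map_mul]
  refine Finset.sum_congr rfl fun b _ => ?_
  rw [← sum_bar]
  refine Finset.sum_congr rfl fun c _ => ?_
  rw [hh.real, coord_bar, coord_bar]

theorem conj_gradient₃ {t : ι × Bool → ι × Bool → ι × Bool → ι × Bool → ℂ} (ht : IsTensor₄ t)
    (u v w : ι → ℂ) (a : ι × Bool) :
    ∑ b, ∑ c, ∑ d, t (bar a) b c d * (coord b u * (coord c v * coord d w))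
      = conj (∑ b, ∑ c, ∑ d, t a b c d * (coord b u * (coord c v * coord d w))) := by
  rw [← sum_bar]
  simp only [map_sum, map_mul]
  refine Finset.sum_congr rfl fun b _ => ?_
  rw [← sum_bar]
  refine Finset.sum_congr rfl fun c _ => ?_
  rw [← sum_bar]
  refine Finset.sum_congr rfl fun d _ => ?_
  rw [ht.real, coord_bar, coord_bar, coord_bar]

theorem coord_field₂ {h : ι × Bool → ι × Bool → ι × Bool → ℂ} (hh : IsTensor₃ h) (u v : ι → ℂ)
    (a : ι × Bool) : coord a (field₂ h u v)
      = Complex.I * sgn a.2 * ∑ b, ∑ c, h (bar a) b c * (coord b u * coord c v) :=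
  coord_I_mul (G := fun a => ∑ b, ∑ c, h a b c * (coord b u * coord c v))
    (conj_gradient₂ hh u v) a

/-! ### The linear field and the homological operator -/

theorem coord_linField (ω : ι → ℝ) (a : ι × Bool) (ψ : ι → ℂ) :
    coord a (linField ω ψ) = Complex.I * sfreq ω a * coord a ψ := by
  rcases a with ⟨k, _ | _⟩ <;> simp [linField_apply, sfreq, sgn]

/-- On cubic polynomials, the Poisson bracket with `∑_k ω_k |ψ_k|²` acts diagonally. -/
theorem bracket_linField₂ (ω : ι → ℝ) {g h : ι × Bool → ι × Bool → ι × Bool → ℂ}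
    (hg : IsTensor₃ g)
    (hgh : ∀ a b c, Complex.I * ((sfreq ω a + sfreq ω b + sfreq ω c : ℝ) : ℂ) * g a b c = h a b c)
    (m : ι → ℂ) :
    linField ω (field₂ g m m) - (2 : ℝ) • field₂ g m (linField ω m) + field₂ h m m = 0 := by
  have e : (2 : ℝ) • field₂ g m (linField ω m)
      = field₂ g (linField ω m) m + field₂ g m (linField ω m) := by
    rw [isSymm_field₂ hg (linField ω m) m, two_smul]
  rw [e]
  funext k
  have hk : sfreq ω ((k, false) : ι × Bool) = -ω k := by simp [sfreq, sgn]
  simp only [Pi.add_apply, Pi.sub_apply, Pi.zero_apply, linField_apply, field₂_apply,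
    coord_linField, Finset.mul_sum, ← Finset.sum_add_distrib, ← Finset.sum_sub_distrib]
  refine Finset.sum_eq_zero fun b _ => Finset.sum_eq_zero fun c _ => ?_
  rw [← hgh, hk]
  push_cast
  ring

/-- On quartic polynomials, the Poisson bracket with `∑_k ω_k |ψ_k|²` acts diagonally. -/
theorem bracket_linField₃ (ω : ι → ℝ)
    {g h : ι × Bool → ι × Bool → ι × Bool → ι × Bool → ℂ} (hg : IsTensor₄ g)
    (hgh : ∀ a b c d, Complex.I * ((sfreq ω a + sfreq ω b + sfreq ω c + sfreq ω d : ℝ) : ℂ)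
      * g a b c d = h a b c d) (m : ι → ℂ) :
    linField ω (field₃ g m m m) - (3 : ℝ) • field₃ g m m (linField ω m) + field₃ h m m m = 0 := by
  have e : (3 : ℝ) • field₃ g m m (linField ω m) = field₃ g (linField ω m) m m
      + field₃ g m (linField ω m) m + field₃ g m m (linField ω m) := by
    rw [(isSymm_field₃ hg (linField ω m) m m).1, (isSymm_field₃ hg m (linField ω m) m).2]
    module
  rw [e]
  funext k
  have hk : sfreq ω ((k, false) : ι × Bool) = -ω k := by simp [sfreq, sgn]
  simp only [Pi.add_apply, Pi.sub_apply, Pi.zero_apply, linField_apply, field₃_apply,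
    coord_linField, Finset.mul_sum, ← Finset.sum_add_distrib, ← Finset.sum_sub_distrib]
  refine Finset.sum_eq_zero fun b _ => Finset.sum_eq_zero fun c _ =>
    Finset.sum_eq_zero fun d _ => ?_
  rw [← hgh, hk]
  push_cast
  ring

/-! ### Composition of fields -/

/-- The tensor of the composition `(u, v, w) ↦ field₂ h (field₂ g v w) u`. -/
noncomputable def compT (h g : ι × Bool → ι × Bool → ι × Bool → ℂ) (a b c d : ι × Bool) : ℂ :=
  ∑ n, Complex.I * sgn n.2 * (h a b n * g (bar n) c d)

theorem field₂_field₂ {h g : ι × Bool → ι × Bool → ι × Bool → ℂ} (hh : IsTensor₃ h)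
    (hg : IsTensor₃ g) (u v w : ι → ℂ) :
    field₂ h (field₂ g v w) u = field₃ (compT h g) u v w := by
  rw [isSymm_field₂ hh]
  funext k
  rw [field₂_apply, field₃_apply]
  congr 1
  refine Finset.sum_congr rfl fun b _ => ?_
  simp only [coord_field₂ hg, compT, Finset.mul_sum, Finset.sum_mul]
  rw [Finset.sum_comm]
  refine Finset.sum_congr rfl fun c _ => ?_
  rw [Finset.sum_comm]
  refine Finset.sum_congr rfl fun d _ => Finset.sum_congr rfl fun n _ => ?_
  ring

/-- The tensor of the Poisson bracket of two cubic polynomials, before symmetrization. -/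
noncomputable def brT (h g : ι × Bool → ι × Bool → ι × Bool → ℂ) (a b c d : ι × Bool) : ℂ :=
  compT h g a b c d - compT g h a b c d

/-- The symmetrization of `brT h g`, which is already invariant under the exchange of the first and
the last pair of indices and under the exchanges within each pair. -/
noncomputable def symBrT (h g : ι × Bool → ι × Bool → ι × Bool → ℂ) (a b c d : ι × Bool) : ℂ :=
  (1 / 3 : ℂ) * (brT h g a b c d + brT h g a c b d + brT h g a d b c)

theorem compT_real {h g : ι × Bool → ι × Bool → ι × Bool → ℂ} (hh : IsTensor₃ h)
    (hg : IsTensor₃ g) (a b c d : ι × Bool) :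
    compT h g (bar a) (bar b) (bar c) (bar d) = conj (compT h g a b c d) := by
  unfold compT
  rw [← sum_bar]
  simp only [map_sum, map_mul]
  refine Finset.sum_congr rfl fun n _ => ?_
  rw [hh.real, hg.real, sgn_bar]
  simp

/-- The exchange of the two pairs of indices. The sign comes from the sign of the summation index,
which is conjugated. -/
theorem compT_pair {h g : ι × Bool → ι × Bool → ι × Bool → ℂ} (hh : IsTensor₃ h)
    (hg : IsTensor₃ g) (a b c d : ι × Bool) : compT h g a b c d = -compT g h c d a b := by
  unfold compT
  rw [← sum_bar, ← Finset.sum_neg_distrib]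
  refine Finset.sum_congr rfl fun n _ => ?_
  rw [sgn_bar, bar_bar, hh.swap' a b, hh.swap a, hg.swap n c, hg.swap' c n]
  push_cast
  ring

theorem brT_swap {h g : ι × Bool → ι × Bool → ι × Bool → ℂ} (hh : IsTensor₃ h)
    (hg : IsTensor₃ g) (a b c d : ι × Bool) : brT h g a b c d = brT h g b a c d := by
  unfold brT compT
  congr 1 <;> refine Finset.sum_congr rfl fun n _ => ?_
  · rw [hh.swap a b]
  · rw [hg.swap a b]

theorem brT_swap'' {h g : ι × Bool → ι × Bool → ι × Bool → ℂ} (hh : IsTensor₃ h)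
    (hg : IsTensor₃ g) (a b c d : ι × Bool) : brT h g a b c d = brT h g a b d c := by
  unfold brT compT
  congr 1 <;> refine Finset.sum_congr rfl fun n _ => ?_
  · rw [hg.swap' _ c d]
  · rw [hh.swap' _ c d]

theorem brT_pair {h g : ι × Bool → ι × Bool → ι × Bool → ℂ} (hh : IsTensor₃ h)
    (hg : IsTensor₃ g) (a b c d : ι × Bool) : brT h g a b c d = brT h g c d a b := by
  unfold brT
  rw [compT_pair hh hg, compT_pair hg hh a b c d]
  ring

theorem isTensor₄_symBrT {h g : ι × Bool → ι × Bool → ι × Bool → ℂ} (hh : IsTensor₃ h)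
    (hg : IsTensor₃ g) : IsTensor₄ (symBrT h g) := by
  have s1 := brT_swap hh hg
  have s2 := brT_swap'' hh hg
  have s3 := brT_pair hh hg
  refine ⟨fun a b c d => ?_, fun a b c d => ?_, fun a b c d => ?_, fun a b c d => ?_⟩
  · simp only [symBrT, brT, compT_real hh hg, compT_real hg hh, map_mul, map_add, map_sub,
      map_div₀, map_one, map_ofNat]
  · unfold symBrT
    rw [s1 a b, s3 b c a d, s3 b d a c]
    ring
  · unfold symBrT
    rw [s2 a d b c]
    ring
  · unfold symBrT
    rw [s2 a b c d]
    ring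

/-- On the diagonal, the field of the bracket tensor is the commutator of the fields. -/
theorem field₃_symBrT {h g : ι × Bool → ι × Bool → ι × Bool → ℂ} (hh : IsTensor₃ h)
    (hg : IsTensor₃ g) (m : ι → ℂ) : field₃ (symBrT h g) m m m
      = field₂ h (field₂ g m m) m - field₂ g (field₂ h m m) m := by
  rw [field₂_field₂ hh hg, field₂_field₂ hg hh]
  funext k
  have e1 : ∑ b, ∑ c, ∑ d, brT h g (k, false) c b d * (coord b m * (coord c m * coord d m))
      = ∑ b, ∑ c, ∑ d, brT h g (k, false) b c d * (coord b m * (coord c m * coord d m)) := by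
    rw [Finset.sum_comm]
    refine Finset.sum_congr rfl fun b _ => Finset.sum_congr rfl fun c _ =>
      Finset.sum_congr rfl fun d _ => ?_
    ring
  have e2 : ∑ b, ∑ c, ∑ d, brT h g (k, false) d b c * (coord b m * (coord c m * coord d m))
      = ∑ b, ∑ c, ∑ d, brT h g (k, false) b c d * (coord b m * (coord c m * coord d m)) := by
    rw [Finset.sum_congr rfl fun b _ => Finset.sum_comm, Finset.sum_comm]
    refine Finset.sum_congr rfl fun b _ => Finset.sum_congr rfl fun c _ =>
      Finset.sum_congr rfl fun d _ => ?_
    ring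
  have e3 : ∑ b, ∑ c, ∑ d, brT h g (k, false) b c d * (coord b m * (coord c m * coord d m))
      = ∑ b, ∑ c, ∑ d, compT h g (k, false) b c d * (coord b m * (coord c m * coord d m))
        - ∑ b, ∑ c, ∑ d, compT g h (k, false) b c d * (coord b m * (coord c m * coord d m)) := by
    simp only [← Finset.sum_sub_distrib, brT, sub_mul]
  rw [Pi.sub_apply, field₃_apply, field₃_apply, field₃_apply, ← mul_sub, ← e3]
  congr 1
  have e4 : ∑ b, ∑ c, ∑ d, symBrT h g (k, false) b c d * (coord b m * (coord c m * coord d m))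
      = (1 / 3 : ℂ) * (∑ b, ∑ c, ∑ d, brT h g (k, false) b c d
            * (coord b m * (coord c m * coord d m))
        + ∑ b, ∑ c, ∑ d, brT h g (k, false) c b d * (coord b m * (coord c m * coord d m))
        + ∑ b, ∑ c, ∑ d, brT h g (k, false) d b c * (coord b m * (coord c m * coord d m))) := by
    simp only [← Finset.sum_add_distrib, Finset.mul_sum, symBrT]
    refine Finset.sum_congr rfl fun b _ => Finset.sum_congr rfl fun c _ =>
      Finset.sum_congr rfl fun d _ => ?_
    ring
  rw [e4, e1, e2]
  ring

end Tensors

/-! ### The symplectic form and Hamiltonian fields -/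

section SymplecticForm

variable {ι : Type*} [Fintype ι]

/-- The symplectic form `∑_k dp̂_k ∧ dq̂_k`, with `ψ̂_k = (p̂_k + i q̂_k) / √2`. -/
noncomputable def sympForm : (ι → ℂ) →L[ℝ] (ι → ℂ) →L[ℝ] ℝ :=
  LinearMap.toContinuousBilinearMap <| LinearMap.mk₂ ℝ
    (fun u v => ∑ k, 2 * ((u k).re * (v k).im - (u k).im * (v k).re))
    (fun u u' v => by
      rw [← Finset.sum_add_distrib]
      refine Finset.sum_congr rfl fun k _ => ?_
      simp only [Pi.add_apply, Complex.add_re, Complex.add_im]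
      ring)
    (fun r u v => by
      rw [smul_eq_mul, Finset.mul_sum]
      refine Finset.sum_congr rfl fun k _ => ?_
      simp only [Pi.smul_apply, Complex.smul_re, Complex.smul_im, smul_eq_mul]
      ring)
    (fun u v v' => by
      rw [← Finset.sum_add_distrib]
      refine Finset.sum_congr rfl fun k _ => ?_
      simp only [Pi.add_apply, Complex.add_re, Complex.add_im]
      ring)
    (fun r u v => by
      rw [smul_eq_mul, Finset.mul_sum]
      refine Finset.sum_congr rfl fun k _ => ?_
      simp only [Pi.smul_apply, Complex.smul_re, Complex.smul_im, smul_eq_mul]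
      ring)

theorem sympForm_apply (u v : ι → ℂ) :
    sympForm u v = ∑ k, 2 * ((u k).re * (v k).im - (u k).im * (v k).re) := rfl

theorem sympForm_neg (u v : ι → ℂ) : sympForm u v = -sympForm v u := by
  rw [sympForm_apply, sympForm_apply, ← Finset.sum_neg_distrib]
  exact Finset.sum_congr rfl fun k _ => by ring

theorem eq_zero_of_sympForm [DecidableEq ι] {u : ι → ℂ} (h : ∀ v, sympForm u v = 0) : u = 0 := by
  funext k
  have h1 := h (Pi.single k 1)
  have h2 := h (Pi.single k Complex.I)
  rw [sympForm_apply, Finset.sum_eq_single k (fun l _ hl => by simp [hl]) (by simp)] at h1 h2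
  apply Complex.ext
  · simpa using h2
  · simpa using h1

/-- Contracting the symplectic form with the Hamiltonian field of a real gradient `G` gives back
`G`, up to the sign. -/
theorem sympForm_gradient {G : ι × Bool → ℂ} (hG : ∀ a, G (bar a) = conj (G a)) (w : ι → ℂ) :
    sympForm (fun k => Complex.I * G (k, false)) w = -(∑ a, G a * coord a w).re := by
  rw [sympForm_apply, Fintype.sum_prod_type, Complex.re_sum, ← Finset.sum_neg_distrib]
  refine Finset.sum_congr rfl fun k _ => ?_
  have := hG (k, false)
  simp only [bar, Bool.not_false] at this
  rw [Fintype.sum_bool, this]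
  simp
  ring

theorem sympForm_field₂ {h : ι × Bool → ι × Bool → ι × Bool → ℂ} (hh : IsTensor₃ h)
    (u v w : ι → ℂ) : sympForm (field₂ h u v) w = -(form₃ h w u v).re := by
  have := sympForm_gradient
    (G := fun a => ∑ b, ∑ c, h a b c * (coord b u * coord c v)) (conj_gradient₂ hh u v) w
  refine this.trans ?_
  unfold form₃
  congr 2
  refine Finset.sum_congr rfl fun a _ => ?_
  simp only [Finset.sum_mul]
  exact Finset.sum_congr rfl fun b _ => Finset.sum_congr rfl fun c _ => by ring

theorem sympForm_field₃ {t : ι × Bool → ι × Bool → ι × Bool → ι × Bool → ℂ} (ht : IsTensor₄ t)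
    (u v w x : ι → ℂ) : sympForm (field₃ t u v w) x = -(form₄ t x u v w).re := by
  have := sympForm_gradient
    (G := fun a => ∑ b, ∑ c, ∑ d, t a b c d * (coord b u * (coord c v * coord d w)))
    (conj_gradient₃ ht u v w) x
  refine Eq.trans ?_ (this.trans ?_)
  · congr 2
    funext k
    exact field₃_apply t u v w k
  unfold form₄
  congr 2
  refine Finset.sum_congr rfl fun a _ => ?_
  simp only [Finset.sum_mul]
  exact Finset.sum_congr rfl fun b _ => Finset.sum_congr rfl fun c _ =>
    Finset.sum_congr rfl fun d _ => by ring

theorem sympForm_field₂_swap {h : ι × Bool → ι × Bool → ι × Bool → ℂ} (hh : IsTensor₃ h)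
    (u v w : ι → ℂ) : sympForm (field₂ h u v) w = sympForm (field₂ h u w) v := by
  rw [sympForm_field₂ hh, sympForm_field₂ hh, form₃_swap' hh w u v, form₃_swap hh w v u,
    form₃_swap' hh v w u]

theorem sympForm_field₃_swap {t : ι × Bool → ι × Bool → ι × Bool → ι × Bool → ℂ}
    (ht : IsTensor₄ t) (u v w x : ι → ℂ) :
    sympForm (field₃ t u v w) x = sympForm (field₃ t u v x) w := by
  rw [sympForm_field₃ ht, sympForm_field₃ ht, form₄_swap'' ht x u v w, form₄_swap' ht x u w v,
    form₄_swap ht x w u v, form₄_swap' ht w x u v, form₄_swap'' ht w u x v]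

theorem sympForm_linField (ω : ι → ℝ) (u v : ι → ℂ) :
    sympForm (linField ω u) v = -∑ k, 2 * ω k * ((u k).re * (v k).re + (u k).im * (v k).im) := by
  rw [sympForm_apply, ← Finset.sum_neg_distrib]
  refine Finset.sum_congr rfl fun k _ => ?_
  simp [linField_apply]
  ring

/-- The linearization of a Hamiltonian field is infinitesimally symplectic. -/
theorem sympForm_polyFieldDeriv {h : ι × Bool → ι × Bool → ι × Bool → ℂ}
    {t : ι × Bool → ι × Bool → ι × Bool → ι × Bool → ℂ} (hh : IsTensor₃ h) (ht : IsTensor₄ t)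
    (m u v : ι → ℂ) : sympForm (polyFieldDeriv (field₂ h) (field₃ t) m u) v
      = -sympForm u (polyFieldDeriv (field₂ h) (field₃ t) m v) := by
  rw [sympForm_neg u, neg_neg]
  simp only [polyFieldDeriv, add_apply, smul_apply, map_add, map_smul]
  rw [sympForm_field₂_swap hh m u v, sympForm_field₃_swap ht m m u v]

end SymplecticForm

section HamiltonianFields

variable {bc : BC} {N : ℕ}

theorem symp_eq (u v : Phase bc N) : symp u v = sympForm u v := by
  unfold symp pHat qHat
  rw [sympForm_apply]
  refine Finset.sum_congr rfl fun k _ => ?_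
  have h : √2 * √2 = (2 : ℝ) := Real.mul_self_sqrt (by norm_num)
  linear_combination ((u k).re * (v k).im - (u k).im * (v k).re) * h

theorem one_div_sqrt_two : 1 / (√2 : ℂ) = ((1 / √2 : ℝ) : ℂ) := by push_cast; rfl

theorem sqrt_two_mul_self : √2 * √2 = (2 : ℝ) := Real.mul_self_sqrt (by norm_num)

/-- The Hamiltonian vector field is determined by the differential, through the symplectic form. -/
theorem hamVF_eq_of_fderiv {f : Phase bc N → ℝ} {ψ X : Phase bc N}
    (h : ∀ w, fderiv ℝ f ψ w = -sympForm X w) : hamVF f ψ = X := by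
  have h2 := sqrt_two_mul_self
  have hs : √2 ≠ 0 := by positivity
  have hsC : ((√2 : ℝ) : ℂ) ≠ 0 := by exact_mod_cast hs
  funext k
  have e1 : dP f ψ k = √2 * (X k).im := by
    unfold dP
    rw [h, sympForm_apply, Finset.sum_eq_single k (fun l _ hl => by simp [hl]) (by simp)]
    rw [Pi.single_eq_same, one_div_sqrt_two, Complex.ofReal_re, Complex.ofReal_im]
    field_simp
    linear_combination -(X k).im * h2
  have e2 : dQ f ψ k = -(√2 * (X k).re) := by
    unfold dQ
    rw [h, sympForm_apply, Finset.sum_eq_single k (fun l _ hl => by simp [hl]) (by simp)]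
    have : Complex.I / ((√2 : ℝ) : ℂ) = Complex.I * ((1 / √2 : ℝ) : ℂ) := by
      push_cast; rw [mul_one_div]
    rw [Pi.single_eq_same, this, Complex.re_mul_ofReal, Complex.im_mul_ofReal, Complex.I_re,
      Complex.I_im]
    field_simp
    linear_combination (X k).re * h2
  unfold hamVF
  rw [e1, e2, div_eq_iff hsC]
  apply Complex.ext
  · simp; ring
  · simp; ring

theorem fderiv_eq_sympForm_hamVF (f : Phase bc N → ℝ) (ψ w : Phase bc N) :
    fderiv ℝ f ψ w = -sympForm (hamVF f ψ) w := by
  have h2 := sqrt_two_mul_self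
  have hs : √2 ≠ 0 := by positivity
  -- expand `w` in the basis of the real coordinates
  have hw : w = ∑ k, ((√2 * (w k).re) • (Pi.single k (1 / (√2 : ℂ)) : Phase bc N)
      + (√2 * (w k).im) • (Pi.single k (Complex.I / (√2 : ℂ)) : Phase bc N)) := by
    funext l
    rw [Finset.sum_apply, Finset.sum_eq_single l (fun k _ hk => by simp [Ne.symm hk]) (by simp)]
    have hsC : ((√2 : ℝ) : ℂ) ≠ 0 := by exact_mod_cast hs
    simp only [Pi.add_apply, Pi.smul_apply, Pi.single_eq_same, Complex.real_smul]
    push_cast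
    field_simp
    exact (Complex.re_add_im (w l)).symm
  nth_rewrite 1 [hw]
  rw [map_sum, sympForm_apply, ← Finset.sum_neg_distrib]
  refine Finset.sum_congr rfl fun k _ => ?_
  have e : hamVF f ψ k = ((-(dQ f ψ k) / √2 : ℝ) : ℂ) + ((dP f ψ k / √2 : ℝ) : ℂ) * Complex.I := by
    unfold hamVF
    push_cast
    ring
  have er : (hamVF f ψ k).re = -(dQ f ψ k) / √2 := by rw [e]; simp
  have ei : (hamVF f ψ k).im = dP f ψ k / √2 := by rw [e]; simp
  rw [map_add, map_smul, map_smul, er, ei]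
  change _ * dP f ψ k + _ * dQ f ψ k = _
  field_simp
  linear_combination ((w k).re * dP f ψ k + (w k).im * dQ f ψ k) * h2

theorem fderiv_H00 (ψ w : Phase bc N) :
    fderiv ℝ (H00 : Phase bc N → ℝ) ψ w
      = ∑ k, 2 * ((ψ k).re * (w k).re + (ψ k).im * (w k).im) := by
  have h2 := sqrt_two_mul_self
  have e : (H00 : Phase bc N → ℝ)
      = fun φ => -(1 / 2 : ℝ) * sympForm (linField (fun _ => 1) φ) φ := by
    funext φ
    rw [sympForm_linField, H00, ← Finset.sum_neg_distrib, Finset.mul_sum]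
    refine Finset.sum_congr rfl fun k _ => ?_
    unfold pHat qHat
    linear_combination ((φ k).re ^ 2 / 2 + (φ k).im ^ 2 / 2) * h2
  have hs : ∀ u v : Phase bc N, sympForm (linField (fun _ => 1) u) v
      = sympForm (linField (fun _ => 1) v) u := by
    intro u v
    rw [sympForm_linField, sympForm_linField]
    congr 1
    exact Finset.sum_congr rfl fun k _ => by ring
  rw [e, (hasFDerivAt_quadratic sympForm _ hs ψ).fderiv, neg_apply, sympForm_linField, neg_neg]
  exact Finset.sum_congr rfl fun k _ => by ring

/-- The Poisson bracket with `H00` is the derivative along the rotation `ψ ↦ i ψ`. -/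
theorem poisson_H00 (f : Phase bc N → ℝ) (ψ : Phase bc N) :
    poisson H00 f ψ = -fderiv ℝ f ψ (linField (fun _ => 1) ψ) := by
  have h2 := sqrt_two_mul_self
  have hs : √2 ≠ 0 := by positivity
  have hp : ∀ k, dP (H00 : Phase bc N → ℝ) ψ k = √2 * (ψ k).re := by
    intro k
    unfold dP
    rw [fderiv_H00, Finset.sum_eq_single k (fun l _ hl => by simp [hl]) (by simp),
      Pi.single_eq_same, one_div_sqrt_two, Complex.ofReal_re, Complex.ofReal_im]
    field_simp
    linear_combination -(ψ k).re * h2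
  have hq : ∀ k, dQ (H00 : Phase bc N → ℝ) ψ k = √2 * (ψ k).im := by
    intro k
    have : Complex.I / ((√2 : ℝ) : ℂ) = Complex.I * ((1 / √2 : ℝ) : ℂ) := by
      push_cast; rw [mul_one_div]
    unfold dQ
    rw [fderiv_H00, Finset.sum_eq_single k (fun l _ hl => by simp [hl]) (by simp),
      Pi.single_eq_same, this, Complex.re_mul_ofReal, Complex.im_mul_ofReal, Complex.I_re,
      Complex.I_im]
    field_simp
    linear_combination -(ψ k).im * h2
  rw [fderiv_eq_sympForm_hamVF, neg_neg, sympForm_neg, sympForm_linField, neg_neg, poisson]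
  refine Finset.sum_congr rfl fun k _ => ?_
  have e : hamVF f ψ k = ((-(dQ f ψ k) / √2 : ℝ) : ℂ) + ((dP f ψ k / √2 : ℝ) : ℂ) * Complex.I := by
    unfold hamVF
    push_cast
    ring
  have er : (hamVF f ψ k).re = -(dQ f ψ k) / √2 := by rw [e]; simp
  have ei : (hamVF f ψ k).im = dP f ψ k / √2 := by rw [e]; simp
  rw [hp, hq, er, ei]
  field_simp
  linear_combination (-(ψ k).re * dQ f ψ k + (ψ k).im * dP f ψ k) * h2

end HamiltonianFields

/-! ### The tensors of the normal form -/

section Coefficients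

variable {ι : Type*}

/-- The factor with which a complex coordinate enters the displacements:
`q_j = ∑_a η_a ê_a(j) z_a`. -/
noncomputable def eta (ω : ι → ℝ) (a : ι × Bool) : ℂ :=
  -Complex.I * sgn a.2 / (√2 * √(ω a.1) : ℝ)

/-- The tensor of the cubic part `H₁`. -/
noncomputable def cubT (α : ℝ) (c : ι → ι → ι → ℝ) (ω : ι → ℝ) (a b d : ι × Bool) : ℂ :=
  α * (eta ω a * eta ω b * eta ω d) * c a.1 b.1 d.1

/-- The tensor of the quartic part `H₂`. -/
noncomputable def quaT (β : ℝ) (c₄ : ι → ι → ι → ι → ℝ) (ω : ι → ℝ) (a b d e : ι × Bool) : ℂ :=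
  β * (eta ω a * eta ω b * eta ω d * eta ω e) * c₄ a.1 b.1 d.1 e.1

/-- The tensor of the cubic generator, which solves the first homological equation. -/
noncomputable def genT (α : ℝ) (c : ι → ι → ι → ℝ) (ω : ι → ℝ) (a b d : ι × Bool) : ℂ :=
  cubT α c ω a b d / (Complex.I * ((sfreq ω a + sfreq ω b + sfreq ω d : ℝ) : ℂ))

/-- The coefficients `c` are symmetric. -/
structure IsSymmCoef₃ (c : ι → ι → ι → ℝ) : Prop where
  swap : ∀ k l m, c k l m = c l k m
  swap' : ∀ k l m, c k l m = c k m l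

/-- The frequencies lie in an interval `[1, 2 - γ]`. -/
structure IsNonresonant (ω : ι → ℝ) (γ : ℝ) : Prop where
  pos : 0 < γ
  one_le : ∀ k, 1 ≤ ω k
  le : ∀ k, ω k ≤ 2 - γ

theorem eta_bar (ω : ι → ℝ) (a : ι × Bool) : eta ω (bar a) = conj (eta ω a) := by
  unfold eta
  rw [sgn_bar, map_div₀, Complex.conj_ofReal]
  simp

theorem isTensor₃_cubT (α : ℝ) {c : ι → ι → ι → ℝ} (hc : IsSymmCoef₃ c) (ω : ι → ℝ) :
    IsTensor₃ (cubT α c ω) := by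
  refine ⟨fun a b d => ?_, fun a b d => ?_, fun a b d => ?_⟩
  · simp [cubT, eta_bar]
  · unfold cubT
    rw [hc.swap]
    ring
  · unfold cubT
    rw [hc.swap']
    ring

theorem isTensor₃_genT (α : ℝ) {c : ι → ι → ι → ℝ} (hc : IsSymmCoef₃ c) (ω : ι → ℝ) :
    IsTensor₃ (genT α c ω) := by
  have h := isTensor₃_cubT α hc ω
  refine ⟨fun a b d => ?_, fun a b d => ?_, fun a b d => ?_⟩
  · unfold genT
    rw [h.real, map_div₀, map_mul, Complex.conj_I, Complex.conj_ofReal, sfreq_bar, sfreq_bar,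
      sfreq_bar]
    congr 1
    push_cast
    ring
  · unfold genT
    rw [h.swap, add_comm (sfreq ω a)]
  · unfold genT
    rw [h.swap', add_right_comm]

/-- There are no resonances of order three between frequencies in `[1, 2)`. -/
theorem IsNonresonant.le_abs_add₃ {ω : ι → ℝ} {γ : ℝ} (h : IsNonresonant ω γ)
    (a b d : ι × Bool) : γ ≤ |sfreq ω a + sfreq ω b + sfreq ω d| := by
  obtain ⟨k, x⟩ := a
  obtain ⟨l, y⟩ := b
  obtain ⟨m, z⟩ := d
  have := h.one_le k
  have := h.one_le l
  have := h.one_le m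
  have := h.le k
  have := h.le l
  have := h.le m
  rw [le_abs]
  cases x <;> cases y <;> cases z <;>
    simp only [sfreq, sgn, if_true, if_false, Bool.false_eq_true, Int.cast_one, Int.cast_neg,
      one_mul, neg_mul] <;>
    first
      | (left; linarith)
      | (right; linarith)

/-- The only resonances of order four between frequencies in `[1, 2)` involve equally many `ψ` and
`ψ̄`. -/
theorem IsNonresonant.le_abs_add₄ {ω : ι → ℝ} {γ : ℝ} (h : IsNonresonant ω γ)
    {a b d e : ι × Bool} (hs : sgn a.2 + sgn b.2 + sgn d.2 + sgn e.2 ≠ 0) :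
    γ ≤ |sfreq ω a + sfreq ω b + sfreq ω d + sfreq ω e| := by
  obtain ⟨k, x⟩ := a
  obtain ⟨l, y⟩ := b
  obtain ⟨m, z⟩ := d
  obtain ⟨n, w⟩ := e
  have := h.one_le k
  have := h.one_le l
  have := h.one_le m
  have := h.one_le n
  have := h.le k
  have := h.le l
  have := h.le m
  have := h.le n
  rw [le_abs]
  cases x <;> cases y <;> cases z <;> cases w <;>
    first
      | exact absurd rfl hs
      | (simp only [sfreq, sgn, if_true, if_false, Bool.false_eq_true, Int.cast_one, Int.cast_neg,
          one_mul, neg_mul]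
         first
          | (left; linarith)
          | (right; linarith))

theorem IsNonresonant.divisor_ne_zero₃ {ω : ι → ℝ} {γ : ℝ} (h : IsNonresonant ω γ)
    (a b d : ι × Bool) : ((sfreq ω a + sfreq ω b + sfreq ω d : ℝ) : ℂ) ≠ 0 := by
  have h1 := h.le_abs_add₃ a b d
  exact_mod_cast abs_pos.1 (h.pos.trans_le h1)

theorem IsNonresonant.divisor_ne_zero₄ {ω : ι → ℝ} {γ : ℝ} (h : IsNonresonant ω γ)
    {a b d e : ι × Bool} (hs : sgn a.2 + sgn b.2 + sgn d.2 + sgn e.2 ≠ 0) :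
    ((sfreq ω a + sfreq ω b + sfreq ω d + sfreq ω e : ℝ) : ℂ) ≠ 0 := by
  have h1 := h.le_abs_add₄ hs
  exact_mod_cast abs_pos.1 (h.pos.trans_le h1)

end Coefficients

section NormalForm

variable {ι : Type*} [Fintype ι]

/-- The tensor of the quartic terms that the cubic generator leaves. -/
noncomputable def totT (α β : ℝ) (c : ι → ι → ι → ℝ) (c₄ : ι → ι → ι → ι → ℝ) (ω : ι → ℝ)
    (a b d e : ι × Bool) : ℂ :=
  quaT β c₄ ω a b d e + symBrT (cubT α c ω) (genT α c ω) a b d e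

/-- The tensor of the normal form: the monomials with equally many `ψ` and `ψ̄`. -/
noncomputable def resT (α β : ℝ) (c : ι → ι → ι → ℝ) (c₄ : ι → ι → ι → ι → ℝ) (ω : ι → ℝ)
    (a b d e : ι × Bool) : ℂ :=
  if sgn a.2 + sgn b.2 + sgn d.2 + sgn e.2 = 0 then totT α β c c₄ ω a b d e else 0

/-- The tensor of the quartic generator, which solves the second homological equation. -/
noncomputable def gen₄T (α β : ℝ) (c : ι → ι → ι → ℝ) (c₄ : ι → ι → ι → ι → ℝ) (ω : ι → ℝ)
    (a b d e : ι × Bool) : ℂ :=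
  if sgn a.2 + sgn b.2 + sgn d.2 + sgn e.2 = 0 then 0
  else totT α β c c₄ ω a b d e
    / (Complex.I * ((sfreq ω a + sfreq ω b + sfreq ω d + sfreq ω e : ℝ) : ℂ))

/-- The coefficients `c₄` are symmetric, and are the contraction of `c` with itself. -/
structure IsContraction (c : ι → ι → ι → ℝ) (c₄ : ι → ι → ι → ι → ℝ) : Prop where
  eq : ∀ k l m p, c₄ k l m p = ∑ n, c k l n * c n m p
  swap : ∀ k l m p, c₄ k l m p = c₄ l k m p
  swap' : ∀ k l m p, c₄ k l m p = c₄ k m l p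
  swap'' : ∀ k l m p, c₄ k l m p = c₄ k l p m

variable {c : ι → ι → ι → ℝ} {c₄ : ι → ι → ι → ι → ℝ}

theorem isTensor₄_quaT (β : ℝ) (hc : IsContraction c c₄) (ω : ι → ℝ) :
    IsTensor₄ (quaT β c₄ ω) := by
  refine ⟨fun a b d e => ?_, fun a b d e => ?_, fun a b d e => ?_, fun a b d e => ?_⟩
  · simp [quaT, eta_bar]
  · unfold quaT
    rw [hc.swap]
    ring
  · unfold quaT
    rw [hc.swap']
    ring
  · unfold quaT
    rw [hc.swap'']
    ring

theorem isTensor₄_totT (α β : ℝ) (hs : IsSymmCoef₃ c) (hc : IsContraction c c₄) (ω : ι → ℝ) :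
    IsTensor₄ (totT α β c c₄ ω) := by
  have h1 := isTensor₄_quaT β hc ω
  have h2 := isTensor₄_symBrT (isTensor₃_cubT α hs ω) (isTensor₃_genT α hs ω)
  refine ⟨fun a b d e => ?_, fun a b d e => ?_, fun a b d e => ?_, fun a b d e => ?_⟩
  · unfold totT
    rw [h1.real, h2.real, map_add]
  · unfold totT
    rw [h1.swap, h2.swap]
  · unfold totT
    rw [h1.swap', h2.swap']
  · unfold totT
    rw [h1.swap'', h2.swap'']

theorem isTensor₄_resT (α β : ℝ) (hs : IsSymmCoef₃ c) (hc : IsContraction c c₄) (ω : ι → ℝ) :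
    IsTensor₄ (resT α β c c₄ ω) := by
  have h := isTensor₄_totT α β hs hc ω
  refine ⟨fun a b d e => ?_, fun a b d e => ?_, fun a b d e => ?_, fun a b d e => ?_⟩
  · unfold resT
    rw [h.real, apply_ite conj, map_zero]
    simp only [sgn_bar]
    refine if_congr ?_ rfl rfl
    omega
  · unfold resT
    rw [h.swap, add_comm (sgn a.2)]
  · unfold resT
    rw [h.swap', add_right_comm (sgn a.2)]
  · unfold resT
    rw [h.swap'', add_right_comm]

theorem isTensor₄_gen₄T (α β : ℝ) (hs : IsSymmCoef₃ c) (hc : IsContraction c c₄) (ω : ι → ℝ) :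
    IsTensor₄ (gen₄T α β c c₄ ω) := by
  have h := isTensor₄_totT α β hs hc ω
  refine ⟨fun a b d e => ?_, fun a b d e => ?_, fun a b d e => ?_, fun a b d e => ?_⟩
  · unfold gen₄T
    rw [apply_ite conj, map_zero, h.real, map_div₀, map_mul, Complex.conj_I, Complex.conj_ofReal]
    simp only [sgn_bar, sfreq_bar]
    refine if_congr ?_ rfl ?_
    · omega
    · congr 1
      push_cast
      ring
  · unfold gen₄T
    rw [h.swap, add_comm (sgn a.2), add_comm (sfreq ω a)]
  · unfold gen₄T
    rw [h.swap', add_right_comm (sgn a.2), add_right_comm (sfreq ω a)]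
  · unfold gen₄T
    rw [h.swap'', add_right_comm, add_right_comm (sfreq ω a + sfreq ω b)]

theorem field₂_sub (h h' : ι × Bool → ι × Bool → ι × Bool → ℂ) (u v : ι → ℂ) :
    field₂ (fun a b c => h a b c - h' a b c) u v = field₂ h u v - field₂ h' u v := by
  funext k
  simp only [Pi.sub_apply, field₂_apply, sub_mul, Finset.sum_sub_distrib, mul_sub]

theorem field₃_add (t t' : ι × Bool → ι × Bool → ι × Bool → ι × Bool → ℂ) (u v w : ι → ℂ) :
    field₃ (fun a b c d => t a b c d + t' a b c d) u v w = field₃ t u v w + field₃ t' u v w := by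
  funext k
  simp only [Pi.add_apply, field₃_apply, add_mul, Finset.sum_add_distrib, mul_add]

theorem field₃_sub (t t' : ι × Bool → ι × Bool → ι × Bool → ι × Bool → ℂ) (u v w : ι → ℂ) :
    field₃ (fun a b c d => t a b c d - t' a b c d) u v w = field₃ t u v w - field₃ t' u v w := by
  funext k
  simp only [Pi.sub_apply, field₃_apply, sub_mul, Finset.sum_sub_distrib, mul_sub]

/-- The first homological equation. -/
theorem homological_cubic (α : ℝ) (hs : IsSymmCoef₃ c) {ω : ι → ℝ} {γ : ℝ}
    (hω : IsNonresonant ω γ) (m : ι → ℂ) :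
    linField ω (field₂ (genT α c ω) m m) - (2 : ℝ) • field₂ (genT α c ω) m (linField ω m)
      + field₂ (cubT α c ω) m m = 0 :=
  bracket_linField₂ ω (isTensor₃_genT α hs ω) (fun a b d =>
    mul_div_cancel₀ _ (mul_ne_zero Complex.I_ne_zero (hω.divisor_ne_zero₃ a b d))) m

/-- The second homological equation. -/
theorem homological_quartic (α β : ℝ) (hs : IsSymmCoef₃ c) (hc : IsContraction c c₄) {ω : ι → ℝ}
    {γ : ℝ} (hω : IsNonresonant ω γ) (m : ι → ℂ) :
    linField ω (field₃ (gen₄T α β c c₄ ω) m m m)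
      - (3 : ℝ) • field₃ (gen₄T α β c c₄ ω) m m (linField ω m) + field₃ (quaT β c₄ ω) m m m
      + field₂ (cubT α c ω) (field₂ (genT α c ω) m m) m
      - field₂ (genT α c ω) (field₂ (cubT α c ω) m m) m = field₃ (resT α β c c₄ ω) m m m := by
  have h1 := bracket_linField₃ ω (isTensor₄_gen₄T α β hs hc ω)
    (h := fun a b d e => totT α β c c₄ ω a b d e - resT α β c c₄ ω a b d e)
    (fun a b d e => by
      unfold gen₄T resT
      split_ifs with h0
      · simp
      · rw [sub_zero]
        exact mul_div_cancel₀ _ (mul_ne_zero Complex.I_ne_zero (hω.divisor_ne_zero₄ h0))) m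
  rw [field₃_sub] at h1
  have h2 : field₃ (totT α β c c₄ ω) m m m = field₃ (quaT β c₄ ω) m m m
      + field₃ (symBrT (cubT α c ω) (genT α c ω)) m m m := field₃_add _ _ m m m
  rw [h2, field₃_symBrT (isTensor₃_cubT α hs ω) (isTensor₃_genT α hs ω)] at h1
  rw [← sub_eq_zero, ← h1]
  abel

/-- The normal form commutes with `∑_k |ψ_k|²`. -/
theorem sympForm_resT_linField (α β : ℝ) (hs : IsSymmCoef₃ c) (hc : IsContraction c c₄)
    (ω : ι → ℝ) (m : ι → ℂ) :
    sympForm (field₃ (resT α β c c₄ ω) m m m) (linField (fun _ => 1) m) = 0 := by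
  have ht := isTensor₄_resT α β hs hc ω
  have h1 := bracket_linField₃ (fun _ => 1) ht (h := fun _ _ _ _ => 0)
    (fun a b d e => by
      unfold resT sfreq
      split_ifs with h0
      · have : ((sgn a.2 : ℝ) * 1 + sgn b.2 * 1 + sgn d.2 * 1 + sgn e.2 * 1) = 0 := by
          simp only [mul_one]
          exact_mod_cast h0
        rw [this]
        simp
      · simp) m
  have h0 : field₃ (fun _ _ _ _ => (0 : ℂ)) m m m = 0 := by
    funext k
    rw [field₃_apply]
    simp
  rw [h0, add_zero, sub_eq_zero] at h1
  have h2 : ∀ u v : ι → ℂ, sympForm (linField (fun _ => 1) u) v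
      = -sympForm u (linField (fun _ => 1) v) := by
    intro u v
    rw [sympForm_neg u, neg_neg, sympForm_linField, sympForm_linField]
    congr 1
    exact Finset.sum_congr rfl fun k _ => by ring
  have h3 := congrArg (fun x => sympForm x m) h1
  simp only [map_smul, smul_apply, smul_eq_mul] at h3
  rw [h2, sympForm_field₃_swap ht m m (linField (fun _ => 1) m) m] at h3
  linarith

/-- The Hamiltonian with field `field₂ h`. -/
noncomputable def pot₃ (h : ι × Bool → ι × Bool → ι × Bool → ℂ) (ψ : ι → ℂ) : ℝ :=
  -(1 / 3 : ℝ) * sympForm (field₂ h ψ ψ) ψ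

/-- The Hamiltonian with field `field₃ t`. -/
noncomputable def pot₄ (t : ι × Bool → ι × Bool → ι × Bool → ι × Bool → ℂ) (ψ : ι → ℂ) : ℝ :=
  -(1 / 4 : ℝ) * sympForm (field₃ t ψ ψ ψ) ψ

theorem pot₃_eq {h : ι × Bool → ι × Bool → ι × Bool → ℂ} (hh : IsTensor₃ h) (ψ : ι → ℂ) :
    pot₃ h ψ = 1 / 3 * (form₃ h ψ ψ ψ).re := by
  rw [pot₃, sympForm_field₂ hh]
  ring

theorem pot₄_eq {t : ι × Bool → ι × Bool → ι × Bool → ι × Bool → ℂ} (ht : IsTensor₄ t)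
    (ψ : ι → ℂ) : pot₄ t ψ = 1 / 4 * (form₄ t ψ ψ ψ ψ).re := by
  rw [pot₄, sympForm_field₃ ht]
  ring

theorem hasFDerivAt_pot₃ {h : ι × Bool → ι × Bool → ι × Bool → ℂ} (hh : IsTensor₃ h)
    (ψ : ι → ℂ) : HasFDerivAt (pot₃ h) (-sympForm (field₂ h ψ ψ)) ψ :=
  hasFDerivAt_cubic sympForm (isSymm_field₂ hh) (sympForm_field₂_swap hh) ψ

theorem hasFDerivAt_pot₄ {t : ι × Bool → ι × Bool → ι × Bool → ι × Bool → ℂ}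
    (ht : IsTensor₄ t) (ψ : ι → ℂ) : HasFDerivAt (pot₄ t) (-sympForm (field₃ t ψ ψ ψ)) ψ :=
  hasFDerivAt_quartic sympForm (isSymm_field₃ ht) (sympForm_field₃_swap ht) ψ

end NormalForm

section PhaseSpace

variable {bc : BC} {N : ℕ}

theorem hamVF_pot₃ {h : ↥(idx bc N) × Bool → ↥(idx bc N) × Bool → ↥(idx bc N) × Bool → ℂ}
    (hh : IsTensor₃ h) (ψ : Phase bc N) : hamVF (pot₃ h) ψ = field₂ h ψ ψ :=
  hamVF_eq_of_fderiv fun w => by rw [(hasFDerivAt_pot₃ hh ψ).fderiv]; rfl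

theorem hamVF_pot₄ {t : ↥(idx bc N) × Bool → ↥(idx bc N) × Bool → ↥(idx bc N) × Bool →
      ↥(idx bc N) × Bool → ℂ} (ht : IsTensor₄ t) (ψ : Phase bc N) :
    hamVF (pot₄ t) ψ = field₃ t ψ ψ ψ :=
  hamVF_eq_of_fderiv fun w => by rw [(hasFDerivAt_pot₄ ht ψ).fderiv]; rfl

theorem isHomPoly_pot₄ (t : ↥(idx bc N) × Bool → ↥(idx bc N) × Bool → ↥(idx bc N) × Bool →
      ↥(idx bc N) × Bool → ℂ) : IsHomPoly 4 (pot₄ t : Phase bc N → ℝ) := by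
  refine ⟨⟨fun f => -(1 / 4 : ℝ) * sympForm (field₃ t (f 0) (f 1) (f 2)) (f 3), ?_, ?_⟩,
    fun ψ => rfl⟩
  · intro _ f i x y
    fin_cases i <;> simp [Fin.ext_iff] <;> ring
  · intro _ f i r x
    fin_cases i <;> simp [Fin.ext_iff] <;> ring

theorem isNormalForm_resT (α β : ℝ) {c : ↥(idx bc N) → ↥(idx bc N) → ↥(idx bc N) → ℝ}
    {c₄ : ↥(idx bc N) → ↥(idx bc N) → ↥(idx bc N) → ↥(idx bc N) → ℝ} (hs : IsSymmCoef₃ c)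
    (hc : IsContraction c c₄) (ω : ↥(idx bc N) → ℝ) :
    IsNormalForm (pot₄ (resT α β c c₄ ω) : Phase bc N → ℝ) := by
  intro ψ
  rw [poisson_H00, (hasFDerivAt_pot₄ (isTensor₄_resT α β hs hc ω) ψ).fderiv, neg_apply, neg_neg]
  exact sympForm_resT_linField α β hs hc ω ψ

end PhaseSpace

/-! ### The Hamiltonian in Fourier coordinates -/

section Fourier

variable {bc : BC} {N : ℕ}

theorem mode_orthonormal_subtype (k l : ↥(idx bc N)) :
    ∑ j : ↥(idx bc N), mode bc N k j * mode bc N l j = if k = l then 1 else 0 := by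
  rw [Finset.sum_coe_sort (idx bc N) fun j => mode bc N k j * mode bc N l j,
    mode_orthonormal bc N k.2 l.2]
  simp only [Subtype.ext_iff]

/-- Completeness of the Fourier basis: a square matrix with orthonormal rows has orthonormal
columns. -/
theorem mode_complete (i j : ↥(idx bc N)) :
    ∑ k : ↥(idx bc N), mode bc N k i * mode bc N k j = if i = j then 1 else 0 := by
  let M : Matrix ↥(idx bc N) ↥(idx bc N) ℝ := Matrix.of fun k j => mode bc N k j
  have h1 : M * M.transpose = 1 := by
    ext k l
    rw [Matrix.mul_apply, Matrix.one_apply]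
    exact mode_orthonormal_subtype k l
  have h1' : M.transpose * M = 1 := mul_eq_one_comm.1 h1
  have h2 := congrFun (congrFun h1' i) j
  rw [Matrix.mul_apply, Matrix.one_apply] at h2
  exact h2

/-- The Fourier synthesis, as a function on all of `ℤ`. -/
noncomputable def modeSum (x : ↥(idx bc N) → ℝ) (j : ℤ) : ℝ := ∑ k, x k * mode bc N k j

theorem sum_modeSum_mul (x y : ↥(idx bc N) → ℝ) :
    ∑ j : ↥(idx bc N), modeSum x j * modeSum y j = ∑ k, x k * y k := by
  have e : ∀ j : ↥(idx bc N), modeSum x j * modeSum y j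
      = ∑ k, ∑ l, x k * y l * (mode bc N k j * mode bc N l j) := by
    intro j
    rw [modeSum, modeSum, Finset.sum_mul_sum]
    exact Finset.sum_congr rfl fun k _ => Finset.sum_congr rfl fun l _ => by ring
  rw [Finset.sum_congr rfl fun j _ => e j, Finset.sum_comm]
  refine Finset.sum_congr rfl fun k _ => ?_
  rw [Finset.sum_comm]
  simp only [← Finset.mul_sum, mode_orthonormal_subtype]
  simp

/-- The modes are eigenvectors of the discrete Laplacian, with both boundary conditions. -/
theorem mode_eigen {k : ℤ} (hk : k ∈ idx bc N) (j : ℤ) :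
    2 * mode bc N k j - mode bc N k (j + 1) - mode bc N k (j - 1)
      = 4 * Real.sin (k * ang N) ^ 2 * mode bc N k j := by
  have hc : Real.cos (2 * k * ang N) = 1 - 2 * Real.sin (k * ang N) ^ 2 := by
    rw [mul_assoc, Real.cos_two_mul, Real.cos_sq']
    ring
  cases bc with
  | periodic =>
    rw [mode_periodic, mode_periodic, mode_periodic]
    have e1 : ((j + 1 : ℤ) : ℝ) * (2 * k * ang N) - phase k
        = (j * (2 * k * ang N) - phase k) + 2 * k * ang N := by push_cast; ring
    have e2 : ((j - 1 : ℤ) : ℝ) * (2 * k * ang N) - phase k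
        = (j * (2 * k * ang N) - phase k) - 2 * k * ang N := by push_cast; ring
    rw [e1, e2]
    generalize (j : ℝ) * (2 * k * ang N) - phase k = x
    rw [Real.cos_add, Real.cos_sub, hc]
    ring
  | dirichlet =>
    have hk0 : 0 < k := by simp only [idx, Finset.mem_Icc] at hk; omega
    rw [mode_dirichlet N hk0, mode_dirichlet N hk0, mode_dirichlet N hk0]
    have e1 : ((j + 1 : ℤ) : ℝ) * (2 * k * ang N) = j * (2 * k * ang N) + 2 * k * ang N := by
      push_cast; ring
    have e2 : ((j - 1 : ℤ) : ℝ) * (2 * k * ang N) = j * (2 * k * ang N) - 2 * k * ang N := by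
      push_cast; ring
    rw [e1, e2, Real.sin_add, Real.sin_sub, hc]
    ring

theorem mode_periodic_add_mul (k j q : ℤ) :
    mode .periodic N k (j + (2 * (N : ℤ) + 2) * q) = mode .periodic N k j := by
  rw [mode_periodic, mode_periodic]
  have h : ((j + (2 * (N : ℤ) + 2) * q : ℤ) : ℝ) * (2 * k * ang N) - phase k
      = (j * (2 * k * ang N) - phase k) + ((k * q : ℤ) : ℝ) * (2 * Real.pi) := by
    rw [← ang_mul N]
    push_cast
    ring
  rw [h, Real.cos_add_int_mul_two_pi]

theorem mode_dirichlet_zero {k : ℤ} (hk : k ∈ idx .dirichlet N) : mode .dirichlet N k 0 = 0 := by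
  rw [mode_dirichlet N (by simp only [idx, Finset.mem_Icc] at hk; omega)]
  simp

theorem mode_dirichlet_end {k : ℤ} (hk : k ∈ idx .dirichlet N) :
    mode .dirichlet N k ((N : ℤ) + 1) = 0 := by
  rw [mode_dirichlet N (by simp only [idx, Finset.mem_Icc] at hk; omega)]
  have h : (((N : ℤ) + 1 : ℤ) : ℝ) * (2 * k * ang N) = k * Real.pi := by
    rw [← ang_mul N]
    push_cast
    ring
  rw [h, Real.sin_int_mul_pi, mul_zero]

theorem ext_modeSum (x : ↥(idx bc N) → ℝ) {j : ℤ}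
    (hj : j ∈ bonds bc N ∨ j + 1 ∈ bonds bc N) :
    ext bc N (fun i => modeSum x i) j = modeSum x j := by
  cases bc with
  | periodic =>
    change modeSum x (wrap N j) = modeSum x j
    obtain ⟨q, hq⟩ := exists_eq_wrap_add N j
    conv_rhs => rw [hq]
    exact Finset.sum_congr rfl fun k _ => by rw [mode_periodic_add_mul]
  | dirichlet =>
    simp only [ext]
    split_ifs with h
    · rfl
    · simp only [idx, bonds, Finset.mem_Icc] at h hj
      have : j = 0 ∨ j = (N : ℤ) + 1 := by omega
      symm
      refine Finset.sum_eq_zero fun k _ => ?_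
      rcases this with rfl | rfl
      · rw [mode_dirichlet_zero k.2, mul_zero]
      · rw [mode_dirichlet_end k.2, mul_zero]

/-- Summation by parts: the discrete Dirichlet form is diagonal in the Fourier basis. -/
theorem sum_bonds_sq (x : ↥(idx bc N) → ℝ) :
    ∑ j ∈ bonds bc N, (modeSum x j - modeSum x (j - 1)) ^ 2
      = ∑ k : ↥(idx bc N), 4 * Real.sin (k * ang N) ^ 2 * x k ^ 2 := by
  set f := modeSum x with hf
  have hlap : ∀ j : ℤ, 2 * f j - f (j + 1) - f (j - 1)
      = modeSum (fun k : ↥(idx bc N) => 4 * Real.sin (k * ang N) ^ 2 * x k) j := by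
    intro j
    simp only [hf, modeSum, Finset.mul_sum, ← Finset.sum_sub_distrib]
    refine Finset.sum_congr rfl fun k _ => ?_
    linear_combination x k * mode_eigen k.2 j
  have e1 : ∀ j : ℤ, (f j - f (j - 1)) ^ 2 = f j * (2 * f j - f (j + 1) - f (j - 1))
      + ((fun i => f i * (f (i + 1) - f i)) j - (fun i => f i * (f (i + 1) - f i)) (j - 1)) := by
    intro j
    simp only [sub_add_cancel]
    ring
  have e2 : ∑ j ∈ bonds bc N, ((fun i => f i * (f (i + 1) - f i)) j
      - (fun i => f i * (f (i + 1) - f i)) (j - 1)) = 0 := by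
    cases bc with
    | periodic =>
      have hper : ∀ j : ℤ, f (j + (2 * (N : ℤ) + 2) * 1) = f j := fun j =>
        Finset.sum_congr rfl fun k _ => by rw [mode_periodic_add_mul]
      have h1 := hper (-((N : ℤ) + 1) - 1)
      have h2 := hper (-((N : ℤ) + 1) - 1 + 1)
      rw [show -((N : ℤ) + 1) - 1 + (2 * (N : ℤ) + 2) * 1 = N by ring] at h1
      rw [show -((N : ℤ) + 1) - 1 + 1 + (2 * (N : ℤ) + 2) * 1 = N + 1 by ring] at h2
      rw [bonds, sum_Icc_int_sub _ (by omega)]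
      simp only [h1, h2]
      ring
    | dirichlet =>
      have h1 : f 0 = 0 := Finset.sum_eq_zero fun k _ => by rw [mode_dirichlet_zero k.2, mul_zero]
      have h2 : f ((N : ℤ) + 1) = 0 :=
        Finset.sum_eq_zero fun k _ => by rw [mode_dirichlet_end k.2, mul_zero]
      rw [bonds, sum_Icc_int_sub _ (by omega)]
      simp [h1, h2]
  have e3 : ∑ j ∈ bonds bc N, f j * (2 * f j - f (j + 1) - f (j - 1))
      = ∑ j ∈ idx bc N, f j * (2 * f j - f (j + 1) - f (j - 1)) := by
    cases bc with
    | periodic => rfl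
    | dirichlet =>
      have h2 : f ((N : ℤ) + 1) = 0 :=
        Finset.sum_eq_zero fun k _ => by rw [mode_dirichlet_end k.2, mul_zero]
      symm
      refine Finset.sum_subset (fun j hj => ?_) fun j hj hj' => ?_
      · simp only [idx, bonds, Finset.mem_Icc] at hj ⊢
        omega
      · have : j = (N : ℤ) + 1 := by
          simp only [idx, bonds, Finset.mem_Icc] at hj hj'
          omega
        rw [this, h2, zero_mul]
  rw [Finset.sum_congr rfl fun j _ => e1 j, Finset.sum_add_distrib, e2, e3, add_zero,
    Finset.sum_congr rfl fun j _ => by rw [hlap j], ← Finset.sum_coe_sort (idx bc N), sum_modeSum_mul]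
  exact Finset.sum_congr rfl fun k _ => by ring

/-- The frequencies of the modes. -/
noncomputable def modeFreq (bc : BC) (N : ℕ) (a : ℝ) (k : ↥(idx bc N)) : ℝ := freq N a k

theorem freq_eq (a : ℝ) (k : ℤ) : freq N a k = √(1 + 4 * a * Real.sin (k * ang N) ^ 2) := by
  rw [freq, ang, mul_div_assoc]

theorem one_le_freq {a : ℝ} (ha : 0 ≤ a) (k : ℤ) : 1 ≤ freq N a k := by
  rw [freq_eq, Real.one_le_sqrt]
  have : 0 ≤ 4 * a * Real.sin (k * ang N) ^ 2 := by positivity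
  linarith

theorem freq_sq {a : ℝ} (ha : 0 ≤ a) (k : ℤ) :
    freq N a k ^ 2 = 1 + 4 * a * Real.sin (k * ang N) ^ 2 := by
  rw [freq_eq, Real.sq_sqrt (by positivity)]

/-- This is where `a < 1/3` enters: it keeps the frequencies below `2`. -/
theorem isNonresonant_modeFreq {a : ℝ} (ha : 0 ≤ a) (ha3 : a < 1 / 3) :
    IsNonresonant (modeFreq bc N a) (2 - √(1 + 4 * a)) := by
  refine ⟨?_, fun k => one_le_freq ha k, fun k => ?_⟩
  · rw [sub_pos, Real.sqrt_lt' (by norm_num)]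
    linarith
  · rw [sub_sub_cancel, modeFreq, freq_eq]
    refine Real.sqrt_le_sqrt ?_
    have := Real.sin_sq_le_one ((k : ℤ) * ang N)
    nlinarith

/-- In Fourier coordinates `H₀` is `∑_k ω_k |ψ_k|²`. -/
theorem H0_eq {a : ℝ} (ha : 0 ≤ a) (ψ : Phase bc N) :
    H0 a ψ = -(1 / 2 : ℝ) * sympForm (linField (modeFreq bc N a) ψ) ψ := by
  have hp : momentum a ψ = fun j : ↥(idx bc N) =>
      modeSum (fun k : ↥(idx bc N) => √(freq N a k) * pHat ψ k) j := rfl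
  have hq : position a ψ = fun j : ↥(idx bc N) =>
      modeSum (fun k : ↥(idx bc N) => qHat ψ k / √(freq N a k)) j := rfl
  have h1 : ∑ j ∈ bonds bc N,
      a * (ext bc N (position a ψ) j - ext bc N (position a ψ) (j - 1)) ^ 2 / 2
      = a / 2 * ∑ k : ↥(idx bc N), 4 * Real.sin (k * ang N) ^ 2 * (qHat ψ k / √(freq N a k)) ^ 2 := by
    rw [← sum_bonds_sq, Finset.mul_sum]
    refine Finset.sum_congr rfl fun j hj => ?_
    rw [hq, ext_modeSum _ (Or.inl hj), ext_modeSum _ (Or.inr (by rwa [sub_add_cancel]))]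
    ring
  have h2 : ∑ j : ↥(idx bc N), (momentum a ψ j ^ 2 + position a ψ j ^ 2) / 2
      = 1 / 2 * (∑ k : ↥(idx bc N), (√(freq N a k) * pHat ψ k) * (√(freq N a k) * pHat ψ k)
        + ∑ k : ↥(idx bc N), (qHat ψ k / √(freq N a k)) * (qHat ψ k / √(freq N a k))) := by
    rw [← sum_modeSum_mul (fun k : ↥(idx bc N) => √(freq N a k) * pHat ψ k),
      ← sum_modeSum_mul (fun k : ↥(idx bc N) => qHat ψ k / √(freq N a k)),
      ← Finset.sum_add_distrib, Finset.mul_sum]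
    refine Finset.sum_congr rfl fun j _ => ?_
    rw [hp, hq]
    ring
  rw [H0, latticeH0, h1, h2, sympForm_linField, ← Finset.sum_neg_distrib,
    ← Finset.sum_add_distrib, Finset.mul_sum, Finset.mul_sum, Finset.mul_sum,
    ← Finset.sum_add_distrib]
  refine Finset.sum_congr rfl fun k _ => ?_
  have hω := one_le_freq (N := N) ha k
  have hω0 : 0 < freq N a k := by linarith
  have hsq : √(freq N a k) * √(freq N a k) = freq N a k := Real.mul_self_sqrt hω0.le
  have hω2 := freq_sq (N := N) ha k
  have h22 := sqrt_two_mul_self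
  have e1 : √(freq N a k) * pHat ψ k * (√(freq N a k) * pHat ψ k) = freq N a k * pHat ψ k ^ 2 := by
    linear_combination pHat ψ k ^ 2 * hsq
  have e2 : qHat ψ k / √(freq N a k) * (qHat ψ k / √(freq N a k)) = qHat ψ k ^ 2 / freq N a k := by
    rw [div_mul_div_comm, hsq, sq]
  have e3 : (qHat ψ k / √(freq N a k)) ^ 2 = qHat ψ k ^ 2 / freq N a k := by rw [sq, e2]
  have e4 : pHat ψ k ^ 2 = 2 * (ψ k).re ^ 2 := by
    unfold pHat
    linear_combination (ψ k).re ^ 2 * h22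
  have e5 : qHat ψ k ^ 2 = 2 * (ψ k).im ^ 2 := by
    unfold qHat
    linear_combination (ψ k).im ^ 2 * h22
  rw [e1, e2, e3, e4, e5, modeFreq]
  field_simp
  linear_combination -(ψ k).im ^ 2 * hω2

end Fourier

/-! ### Nonlinear terms as sums over the sites -/

section Sites

variable {ι J : Type*} [Fintype ι] [Fintype J]

theorem sum_signed (g : Bool → ℂ) (A : ι × Bool → ℂ) :
    ∑ d, g d.2 * A d = ∑ z, g z * ∑ k, A (k, z) := by
  simp only [Fintype.sum_prod_type_right, Finset.mul_sum]

/-- A cubic form whose coefficients depend on the modes through `∑_j f_j f_j f_j` only. -/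
theorem form₃_eq_sum_sites (w : Bool → Bool → Bool → ℂ) (f : ι → J → ℝ) (ψ : ι → ℂ)
    {h : ι × Bool → ι × Bool → ι × Bool → ℂ}
    (hh : ∀ a b d, h a b d
      = w a.2 b.2 d.2 * ((∑ j, f a.1 j * f b.1 j * f d.1 j : ℝ) : ℂ)) :
    form₃ h ψ ψ ψ = ∑ j, ∑ x, (∑ y, (∑ z, w x y z * ∑ k, f k j * coord (k, z) ψ)
      * ∑ k, f k j * coord (k, y) ψ) * ∑ k, f k j * coord (k, x) ψ := by
  have key : ∀ j, ∑ x, (∑ y, (∑ z, w x y z * ∑ k, f k j * coord (k, z) ψ)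
      * ∑ k, f k j * coord (k, y) ψ) * ∑ k, f k j * coord (k, x) ψ
      = ∑ a : ι × Bool, ∑ b : ι × Bool, ∑ d : ι × Bool, w a.2 b.2 d.2
        * ((f a.1 j * f b.1 j * f d.1 j : ℝ) : ℂ) * (coord a ψ * (coord b ψ * coord d ψ)) := by
    intro j
    have e := sum_signed (ι := ι) (A := fun a => f a.1 j * coord a ψ)
    simp only at e
    simp only [← e]
    simp only [Finset.sum_mul]
    refine Finset.sum_congr rfl fun a _ => Finset.sum_congr rfl fun b _ =>
      Finset.sum_congr rfl fun d _ => ?_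
    push_cast
    ring
  rw [Finset.sum_congr rfl fun j _ => key j]
  simp only [form₃, hh, Complex.ofReal_sum, Finset.mul_sum, Finset.sum_mul]
  exact (Finset.sum_comm.trans <| Finset.sum_congr rfl fun a _ => Finset.sum_comm.trans <|
    Finset.sum_congr rfl fun b _ => Finset.sum_comm).symm

/-- A quartic form whose coefficients depend on the modes through `∑_j f_j f_j f_j f_j` only. -/
theorem form₄_eq_sum_sites (w : Bool → Bool → Bool → Bool → ℂ) (f : ι → J → ℝ) (ψ : ι → ℂ)
    {t : ι × Bool → ι × Bool → ι × Bool → ι × Bool → ℂ}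
    (ht : ∀ a b d e, t a b d e
      = w a.2 b.2 d.2 e.2 * ((∑ j, f a.1 j * f b.1 j * f d.1 j * f e.1 j : ℝ) : ℂ)) :
    form₄ t ψ ψ ψ ψ = ∑ j, ∑ x, (∑ y, (∑ z, (∑ v, w x y z v * ∑ k, f k j * coord (k, v) ψ)
      * ∑ k, f k j * coord (k, z) ψ) * ∑ k, f k j * coord (k, y) ψ)
      * ∑ k, f k j * coord (k, x) ψ := by
  have key : ∀ j, ∑ x, (∑ y, (∑ z, (∑ v, w x y z v * ∑ k, f k j * coord (k, v) ψ)
      * ∑ k, f k j * coord (k, z) ψ) * ∑ k, f k j * coord (k, y) ψ)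
      * ∑ k, f k j * coord (k, x) ψ
      = ∑ a : ι × Bool, ∑ b : ι × Bool, ∑ d : ι × Bool, ∑ e : ι × Bool, w a.2 b.2 d.2 e.2
        * ((f a.1 j * f b.1 j * f d.1 j * f e.1 j : ℝ) : ℂ)
        * (coord a ψ * (coord b ψ * (coord d ψ * coord e ψ))) := by
    intro j
    have e := sum_signed (ι := ι) (A := fun a => f a.1 j * coord a ψ)
    simp only at e
    simp only [← e]
    simp only [Finset.sum_mul]
    refine Finset.sum_congr rfl fun a _ => Finset.sum_congr rfl fun b _ =>
      Finset.sum_congr rfl fun d _ => Finset.sum_congr rfl fun e _ => ?_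
    push_cast
    ring
  rw [Finset.sum_congr rfl fun j _ => key j]
  simp only [form₄, ht, Complex.ofReal_sum, Finset.mul_sum, Finset.sum_mul]
  exact (Finset.sum_comm.trans <| Finset.sum_congr rfl fun a _ => Finset.sum_comm.trans <|
    Finset.sum_congr rfl fun b _ => Finset.sum_comm.trans <|
    Finset.sum_congr rfl fun d _ => Finset.sum_comm).symm

end Sites

section Chain

variable (bc : BC) (N : ℕ)

/-- The coefficients `c_{klm}` of the chain. -/
noncomputable def triC (k l m : ↥(idx bc N)) : ℝ :=
  ∑ j : ↥(idx bc N), mode bc N k j * mode bc N l j * mode bc N m j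

/-- The coefficients `∑_j ê_k(j) ê_l(j) ê_m(j) ê_p(j)`. -/
noncomputable def quadC (k l m p : ↥(idx bc N)) : ℝ :=
  ∑ j : ↥(idx bc N), mode bc N k j * mode bc N l j * mode bc N m j * mode bc N p j

theorem triC_eq (k l m : ↥(idx bc N)) : triC bc N k l m = tri bc N k l m :=
  Finset.sum_coe_sort (idx bc N) fun j => mode bc N k j * mode bc N l j * mode bc N m j

theorem isSymmCoef₃_triC : IsSymmCoef₃ (triC bc N) :=
  ⟨fun k l m => Finset.sum_congr rfl fun j _ => by ring,
    fun k l m => Finset.sum_congr rfl fun j _ => by ring⟩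

/-- The coefficients of the quartic part factor through those of the cubic part, by completeness
of the Fourier basis. -/
theorem isContraction_quadC : IsContraction (triC bc N) (quadC bc N) := by
  refine ⟨fun k l m p => ?_, fun k l m p => Finset.sum_congr rfl fun j _ => by ring,
    fun k l m p => Finset.sum_congr rfl fun j _ => by ring,
    fun k l m p => Finset.sum_congr rfl fun j _ => by ring⟩
  have e : ∀ n : ↥(idx bc N), triC bc N k l n * triC bc N n m p
      = ∑ i : ↥(idx bc N), ∑ j : ↥(idx bc N), mode bc N k i * mode bc N l i
        * (mode bc N m j * mode bc N p j) * (mode bc N n i * mode bc N n j) := by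
    intro n
    rw [triC, triC, Finset.sum_mul_sum]
    exact Finset.sum_congr rfl fun i _ => Finset.sum_congr rfl fun j _ => by ring
  rw [Finset.sum_congr rfl fun n _ => e n, Finset.sum_comm, quadC]
  refine Finset.sum_congr rfl fun i _ => ?_
  rw [Finset.sum_comm]
  simp only [← Finset.mul_sum, mode_complete]
  simp
  ring

variable {bc N}

/-- The displacements in the complex coordinates, with the factors `eta`. -/
theorem position_eq (a : ℝ) (ψ : Phase bc N) (j : ↥(idx bc N)) :
    ((position a ψ j : ℝ) : ℂ) = ∑ x : Bool, -Complex.I * sgn x / (√2 : ℝ)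
      * ∑ k : ↥(idx bc N), ((mode bc N k j / √(modeFreq bc N a k) : ℝ) : ℂ) * coord (k, x) ψ := by
  have h22 : ((√2 : ℝ) : ℂ) * ((√2 : ℝ) : ℂ) = 2 := by exact_mod_cast sqrt_two_mul_self
  have hs : ((√2 : ℝ) : ℂ) ≠ 0 := by
    have : √2 ≠ (0 : ℝ) := by positivity
    exact_mod_cast this
  rw [Fintype.sum_bool, Finset.mul_sum, Finset.mul_sum, ← Finset.sum_add_distrib, position,
    Complex.ofReal_sum]
  refine Finset.sum_congr rfl fun k _ => ?_
  have hz : (ψ k) - conj (ψ k) = 2 * Complex.I * ((ψ k).im : ℂ) := by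
    rw [Complex.sub_conj]
    push_cast
    ring
  rw [coord_true, coord_false, qHat, modeFreq]
  simp only [sgn, if_true, Bool.false_eq_true, if_false]
  push_cast
  have e : ∀ r : ℂ, -Complex.I * 1 / ((√2 : ℝ) : ℂ) * (r * ψ k)
      + -Complex.I * -1 / ((√2 : ℝ) : ℂ) * (r * conj (ψ k))
      = ((√2 : ℝ) : ℂ) * ((ψ k).im : ℂ) * r := by
    intro r
    have : -Complex.I * 1 / ((√2 : ℝ) : ℂ) * (r * ψ k)
      + -Complex.I * -1 / ((√2 : ℝ) : ℂ) * (r * conj (ψ k))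
      = -Complex.I * r * ((ψ k) - conj (ψ k)) / ((√2 : ℝ) : ℂ) := by ring
    rw [this, hz, div_eq_iff hs]
    linear_combination (-2 * r * (ψ k).im) * Complex.I_sq - ((ψ k).im * r) * h22
  rw [e]
  ring

theorem latticeH1_eq (α a : ℝ) (ψ : Phase bc N) :
    latticeH1 bc N α (position a ψ) = pot₃ (cubT α (triC bc N) (modeFreq bc N a)) ψ := by
  rw [pot₃_eq (isTensor₃_cubT α (isSymmCoef₃_triC bc N) _),
    form₃_eq_sum_sites (fun x y z => α * ((-Complex.I * sgn x / (√2 : ℝ))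
      * (-Complex.I * sgn y / (√2 : ℝ)) * (-Complex.I * sgn z / (√2 : ℝ))))
      (fun (k j : ↥(idx bc N)) => mode bc N k j / √(modeFreq bc N a k))]
  · have e : ∀ j : ↥(idx bc N), ∑ x, (∑ y, (∑ z, α * ((-Complex.I * sgn x / (√2 : ℝ))
      * (-Complex.I * sgn y / (√2 : ℝ)) * (-Complex.I * sgn z / (√2 : ℝ)))
      * ∑ k : ↥(idx bc N), ((mode bc N k j / √(modeFreq bc N a k) : ℝ) : ℂ) * coord (k, z) ψ)
      * ∑ k : ↥(idx bc N), ((mode bc N k j / √(modeFreq bc N a k) : ℝ) : ℂ) * coord (k, y) ψ)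
      * ∑ k : ↥(idx bc N), ((mode bc N k j / √(modeFreq bc N a k) : ℝ) : ℂ) * coord (k, x) ψ
      = ((α * position a ψ j ^ 3 : ℝ) : ℂ) := by
      intro j
      rw [Complex.ofReal_mul, Complex.ofReal_pow, position_eq]
      simp only [Fintype.sum_bool]
      ring
    rw [Finset.sum_congr rfl fun j _ => e j, ← Complex.ofReal_sum, Complex.ofReal_re, latticeH1,
      Finset.mul_sum, Finset.mul_sum]
    exact Finset.sum_congr rfl fun j _ => by ring
  · intro k l m
    simp only [cubT, eta, triC]
    push_cast
    simp only [Finset.mul_sum]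
    refine Finset.sum_congr rfl fun j _ => ?_
    ring

theorem latticeH2_eq (β a : ℝ) (ψ : Phase bc N) :
    latticeH2 bc N β (position a ψ) = pot₄ (quaT β (quadC bc N) (modeFreq bc N a)) ψ := by
  rw [pot₄_eq (isTensor₄_quaT β (isContraction_quadC bc N) _),
    form₄_eq_sum_sites (fun x y z v => β * ((-Complex.I * sgn x / (√2 : ℝ))
      * (-Complex.I * sgn y / (√2 : ℝ)) * (-Complex.I * sgn z / (√2 : ℝ))
      * (-Complex.I * sgn v / (√2 : ℝ))))
      (fun (k j : ↥(idx bc N)) => mode bc N k j / √(modeFreq bc N a k))]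
  · have e : ∀ j : ↥(idx bc N), ∑ x, (∑ y, (∑ z, (∑ v, β * ((-Complex.I * sgn x / (√2 : ℝ))
      * (-Complex.I * sgn y / (√2 : ℝ)) * (-Complex.I * sgn z / (√2 : ℝ))
      * (-Complex.I * sgn v / (√2 : ℝ)))
      * ∑ k : ↥(idx bc N), ((mode bc N k j / √(modeFreq bc N a k) : ℝ) : ℂ) * coord (k, v) ψ)
      * ∑ k : ↥(idx bc N), ((mode bc N k j / √(modeFreq bc N a k) : ℝ) : ℂ) * coord (k, z) ψ)
      * ∑ k : ↥(idx bc N), ((mode bc N k j / √(modeFreq bc N a k) : ℝ) : ℂ) * coord (k, y) ψ)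
      * ∑ k : ↥(idx bc N), ((mode bc N k j / √(modeFreq bc N a k) : ℝ) : ℂ) * coord (k, x) ψ
      = ((β * position a ψ j ^ 4 : ℝ) : ℂ) := by
      intro j
      rw [Complex.ofReal_mul, Complex.ofReal_pow, position_eq]
      simp only [Fintype.sum_bool]
      ring
    rw [Finset.sum_congr rfl fun j _ => e j, ← Complex.ofReal_sum, Complex.ofReal_re, latticeH2,
      Finset.mul_sum, Finset.mul_sum]
    exact Finset.sum_congr rfl fun j _ => by ring
  · intro k l m p
    simp only [quaT, eta, quadC]
    push_cast
    simp only [Finset.mul_sum]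
    refine Finset.sum_congr rfl fun j _ => ?_
    ring

end Chain

/-! ### The limit of equal frequencies -/

section EqualFrequencies

variable {ι : Type*}

theorem eta_one (a : ι × Bool) : eta (fun _ => 1) a = -Complex.I * sgn a.2 / (√2 : ℝ) := by
  simp [eta]

theorem sqrt_two_mul_self_complex : ((√2 : ℝ) : ℂ) * ((√2 : ℝ) : ℂ) = 2 := by
  exact_mod_cast sqrt_two_mul_self

theorem sqrt_two_ne_zero_complex : ((√2 : ℝ) : ℂ) ≠ 0 := by
  have : √2 ≠ (0 : ℝ) := by positivity
  exact_mod_cast this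

theorem sgn_add_ne_zero (x y z : Bool) : ((sgn x : ℂ) + sgn y + sgn z) ≠ 0 := by
  cases x <;> cases y <;> cases z <;> norm_num [sgn]

theorem sgn_sq (x : Bool) : (sgn x : ℂ) ^ 2 = 1 := by cases x <;> norm_num [sgn]

theorem cubT_one (α : ℝ) (c : ι → ι → ι → ℝ) (a b d : ι × Bool) :
    cubT α c (fun _ => 1) a b d = Complex.I * (α / (2 * (√2 : ℝ))) * (sgn a.2 * sgn b.2 * sgn d.2)
      * c a.1 b.1 d.1 := by
  have hs := sqrt_two_ne_zero_complex
  have h2 := sqrt_two_mul_self_complex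
  rw [cubT, eta_one, eta_one, eta_one]
  have e : -Complex.I * sgn a.2 / (√2 : ℝ) * (-Complex.I * sgn b.2 / (√2 : ℝ))
      * (-Complex.I * sgn d.2 / (√2 : ℝ))
      = Complex.I * (1 / (2 * (√2 : ℝ))) * (sgn a.2 * sgn b.2 * sgn d.2) := by
    rw [← h2]
    field_simp
    linear_combination (-sgn a.2 * sgn b.2 * sgn d.2 : ℂ) * Complex.I_sq
  rw [e]
  ring

theorem genT_one (α : ℝ) (c : ι → ι → ι → ℝ) (a b d : ι × Bool) :
    genT α c (fun _ => 1) a b d = α / (2 * (√2 : ℝ)) * (sgn a.2 * sgn b.2 * sgn d.2)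
      / (sgn a.2 + sgn b.2 + sgn d.2) * c a.1 b.1 d.1 := by
  have h := sgn_add_ne_zero a.2 b.2 d.2
  have e : ((sfreq (fun _ => 1) a + sfreq (fun _ => 1) b + sfreq (fun _ => 1) d : ℝ) : ℂ)
      = sgn a.2 + sgn b.2 + sgn d.2 := by
    simp [sfreq]
  rw [genT, cubT_one, e]
  have hI := Complex.I_ne_zero
  field_simp

theorem quaT_one (β : ℝ) (c₄ : ι → ι → ι → ι → ℝ) (a b d e : ι × Bool) : quaT β c₄ (fun _ => 1) a b d e
    = β / 4 * (sgn a.2 * sgn b.2 * sgn d.2 * sgn e.2) * c₄ a.1 b.1 d.1 e.1 := by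
  have hs := sqrt_two_ne_zero_complex
  have h2 := sqrt_two_mul_self_complex
  rw [quaT, eta_one, eta_one, eta_one, eta_one]
  have h : -Complex.I * sgn a.2 / (√2 : ℝ) * (-Complex.I * sgn b.2 / (√2 : ℝ))
      * (-Complex.I * sgn d.2 / (√2 : ℝ)) * (-Complex.I * sgn e.2 / (√2 : ℝ))
      = 1 / (2 * 2) * (sgn a.2 * sgn b.2 * sgn d.2 * sgn e.2) := by
    rw [← h2]
    field_simp
    linear_combination (sgn a.2 * sgn b.2 * sgn d.2 * sgn e.2 : ℂ)
      * (Complex.I ^ 2 - 1) * Complex.I_sq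
  rw [h]
  ring

variable [Fintype ι] {c : ι → ι → ι → ℝ} {c₄ : ι → ι → ι → ι → ℝ}

/-- At equal frequencies the small divisors depend on the signs only, and the sum over the inner
mode contracts the coefficients. -/
theorem compT_one (α : ℝ) (hc : IsContraction c c₄) (a b d e : ι × Bool) :
    compT (cubT α c (fun _ => 1)) (genT α c (fun _ => 1)) a b d e
      = α ^ 2 / 8 * (sgn a.2 * sgn b.2 * sgn d.2 * sgn e.2)
        * (∑ x : Bool, (sgn x / (sgn d.2 + sgn e.2 - sgn x) : ℂ)) * c₄ a.1 b.1 d.1 e.1 := by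
  have hs := sqrt_two_ne_zero_complex
  have h2 := sqrt_two_mul_self_complex
  rw [compT, Fintype.sum_prod_type_right, Finset.mul_sum, Finset.sum_mul]
  refine Finset.sum_congr rfl fun x _ => ?_
  rw [hc.eq, Complex.ofReal_sum, Finset.mul_sum]
  refine Finset.sum_congr rfl fun n _ => ?_
  rw [cubT_one, genT_one]
  have hx := sgn_sq x
  have h := sgn_add_ne_zero d.2 e.2 (!x)
  have hb : (sgn (!x) : ℂ) = -sgn x := by cases x <;> simp [sgn]
  rw [hb] at h
  have e1 : (sgn d.2 + sgn e.2 - sgn x : ℂ) = sgn d.2 + sgn e.2 + -sgn x := by ring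
  have e2 : (-sgn x + sgn d.2 + sgn e.2 : ℂ) = sgn d.2 + sgn e.2 + -sgn x := by ring
  simp only [bar, hb]
  rw [e1, e2]
  push_cast
  have e3 : (α : ℂ) ^ 2 / 8 = α / (2 * (√2 : ℝ)) * (α / (2 * (√2 : ℝ))) := by
    rw [div_mul_div_comm]
    have : 2 * ((√2 : ℝ) : ℂ) * (2 * ((√2 : ℝ) : ℂ)) = 8 := by linear_combination 4 * h2
    rw [this, sq]
  rw [e3, div_eq_mul_inv _ ((sgn d.2 : ℂ) + sgn e.2 + -sgn x),
    div_eq_mul_inv _ ((sgn d.2 : ℂ) + sgn e.2 + -sgn x)]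
  generalize (α : ℂ) / (2 * (√2 : ℝ)) = r
  generalize ((sgn d.2 : ℂ) + sgn e.2 + -sgn x)⁻¹ = q
  linear_combination (-r ^ 2 * sgn x ^ 3 * (sgn a.2 * sgn b.2 * sgn d.2 * sgn e.2 : ℂ) * q
    * c a.1 b.1 n * c n d.1 e.1) * Complex.I_sq
    + (r ^ 2 * sgn x * (sgn a.2 * sgn b.2 * sgn d.2 * sgn e.2 : ℂ) * q
    * c a.1 b.1 n * c n d.1 e.1) * hx

/-- The resonant coefficients at equal frequencies. The value collects `β / 4` from the quartic
part, and `-α²/2`, `-α²/2`, `α²/6` (with the factor `1/3`) from the three pairings of the indices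
in the symmetrized bracket of the cubic tensors. -/
theorem resT_one (α β : ℝ) (hs : IsSymmCoef₃ c) (hc : IsContraction c c₄) (a b d e : ι × Bool) :
    resT α β c c₄ (fun _ => 1) a b d e
      = (if sgn a.2 + sgn b.2 + sgn d.2 + sgn e.2 = 0 then ((2 / 3 * gammaTilde α β : ℝ) : ℂ)
          else 0) * c₄ a.1 b.1 d.1 e.1 := by
  have hh := isTensor₃_cubT α hs (fun _ => 1)
  have hg := isTensor₃_genT α hs (fun _ => 1)
  have hbr : ∀ a b d e : ι × Bool, brT (cubT α c (fun _ => 1)) (genT α c (fun _ => 1)) a b d e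
      = α ^ 2 / 8 * (sgn a.2 * sgn b.2 * sgn d.2 * sgn e.2)
        * (∑ x : Bool, (sgn x / (sgn d.2 + sgn e.2 - sgn x) : ℂ)
          + ∑ x : Bool, (sgn x / (sgn a.2 + sgn b.2 - sgn x) : ℂ)) * c₄ a.1 b.1 d.1 e.1 := by
    intro a b d e
    rw [brT, compT_pair hg hh, compT_one α hc, compT_one α hc, hc.swap' d.1, hc.swap d.1,
      hc.swap'' a.1 d.1, hc.swap' a.1 d.1]
    ring
  rw [resT, ite_mul, zero_mul]
  split_ifs with h0
  · rw [totT, quaT_one, symBrT, hbr, hbr, hbr, hc.swap' a.1 d.1, hc.swap' a.1 e.1,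
      hc.swap'' a.1 b.1 e.1, gammaTilde]
    push_cast
    obtain ⟨k, x⟩ := a
    obtain ⟨l, y⟩ := b
    obtain ⟨m, z⟩ := d
    obtain ⟨n, v⟩ := e
    cases x <;> cases y <;> cases z <;> cases v <;>
      first
        | (norm_num [sgn] at h0; done)
        | (simp only [Fintype.sum_bool, sgn, if_true, Bool.false_eq_true, if_false]
           norm_num
           ring)
  · rfl

end EqualFrequencies

section Chain

variable {bc : BC} {N : ℕ}

theorem sum_mode_coord_true (ψ : Phase bc N) (j : ↥(idx bc N)) :
    ∑ k : ↥(idx bc N), ((mode bc N k j : ℝ) : ℂ) * coord (k, true) ψ = site ψ j :=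
  Finset.sum_congr rfl fun k _ => by rw [coord_true, mul_comm]

theorem sum_mode_coord_false (ψ : Phase bc N) (j : ↥(idx bc N)) :
    ∑ k : ↥(idx bc N), ((mode bc N k j : ℝ) : ℂ) * coord (k, false) ψ = conj (site ψ j) := by
  rw [site, map_sum]
  exact Finset.sum_congr rfl fun k _ => by rw [coord_false, map_mul, Complex.conj_ofReal, mul_comm]

/-- At equal frequencies the cubic generator is local in the sites, and equals `χ₀₁`: the divisor
is `±3` for `ψ_j³` and its conjugate, and `±1` for the mixed monomials. -/
theorem chi01_eq (α : ℝ) :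
    (chi01 α : Phase bc N → ℝ) = pot₃ (genT α (triC bc N) (fun _ => 1)) := by
  funext ψ
  rw [pot₃_eq (isTensor₃_genT α (isSymmCoef₃_triC bc N) _),
    form₃_eq_sum_sites (fun x y z => α / (2 * (√2 : ℝ)) * (sgn x * sgn y * sgn z)
      / (sgn x + sgn y + sgn z)) (fun (k j : ↥(idx bc N)) => mode bc N k j) ψ (genT_one α _)]
  have hs := sqrt_two_ne_zero_complex
  have e : ∀ j : ↥(idx bc N), ∑ x, (∑ y, (∑ z, α / (2 * (√2 : ℝ)) * (sgn x * sgn y * sgn z)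
      / (sgn x + sgn y + sgn z) * ∑ k : ↥(idx bc N), ((mode bc N k j : ℝ) : ℂ) * coord (k, z) ψ)
      * ∑ k : ↥(idx bc N), ((mode bc N k j : ℝ) : ℂ) * coord (k, y) ψ)
      * ∑ k : ↥(idx bc N), ((mode bc N k j : ℝ) : ℂ) * coord (k, x) ψ
      = ((α / (2 * √2) : ℝ) : ℂ) * (site ψ j ^ 3 / 3 + star (site ψ j) ^ 3 / 3
    - 3 * site ψ j * star (site ψ j) ^ 2 - 3 * site ψ j ^ 2 * star (site ψ j)) := by
    intro j
    simp only [Fintype.sum_bool, sum_mode_coord_true, sum_mode_coord_false, sgn, if_true,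
      Bool.false_eq_true, if_false, ← starRingEnd_apply]
    push_cast
    generalize site ψ j = A
    generalize (α : ℂ) / (2 * (√2 : ℝ)) = r
    norm_num
    ring
  rw [Finset.sum_congr rfl fun j _ => e j, ← Finset.mul_sum, Complex.re_ofReal_mul, Complex.re_sum,
    chi01]
  ring

theorem hamVF_chi01 (α : ℝ) (ψ : Phase bc N) :
    hamVF (chi01 α) ψ = field₂ (genT α (triC bc N) (fun _ => 1)) ψ ψ := by
  rw [chi01_eq, hamVF_pot₃ (isTensor₃_genT α (isSymmCoef₃_triC bc N) _)]

/-- At equal frequencies the normal form is local in the sites, and equals `Z₀`. There are six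
ways of choosing two `ψ` and two `ψ̄`, whence `6 * (2 / 3) = 4`. -/
theorem Z0_eq (α β : ℝ) :
    (Z0 α β : Phase bc N → ℝ) = pot₄ (resT α β (triC bc N) (quadC bc N) (fun _ => 1)) := by
  funext ψ
  rw [pot₄_eq (isTensor₄_resT α β (isSymmCoef₃_triC bc N) (isContraction_quadC bc N) _),
    form₄_eq_sum_sites (fun x y z v => if sgn x + sgn y + sgn z + sgn v = 0
      then ((2 / 3 * gammaTilde α β : ℝ) : ℂ) else 0)
      (fun (k j : ↥(idx bc N)) => mode bc N k j) ψ
      (resT_one α β (isSymmCoef₃_triC bc N) (isContraction_quadC bc N))]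
  have e : ∀ j : ↥(idx bc N), ∑ x, (∑ y, (∑ z, (∑ v, (if sgn x + sgn y + sgn z + sgn v = 0
      then ((2 / 3 * gammaTilde α β : ℝ) : ℂ) else 0)
      * ∑ k : ↥(idx bc N), ((mode bc N k j : ℝ) : ℂ) * coord (k, v) ψ)
      * ∑ k : ↥(idx bc N), ((mode bc N k j : ℝ) : ℂ) * coord (k, z) ψ)
      * ∑ k : ↥(idx bc N), ((mode bc N k j : ℝ) : ℂ) * coord (k, y) ψ)
      * ∑ k : ↥(idx bc N), ((mode bc N k j : ℝ) : ℂ) * coord (k, x) ψ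
      = ((4 * gammaTilde α β * ‖site ψ j‖ ^ 4 : ℝ) : ℂ) := by
    intro j
    have h1 : ((‖site ψ j‖ : ℝ) : ℂ) ^ 4 = (site ψ j * conj (site ψ j)) ^ 2 := by
      rw [Complex.mul_conj, Complex.normSq_eq_norm_sq]
      push_cast
      ring
    simp only [Fintype.sum_bool, sum_mode_coord_true, sum_mode_coord_false, sgn, if_true,
      Bool.false_eq_true, if_false]
    push_cast
    rw [h1]
    norm_num
    ring
  rw [Finset.sum_congr rfl fun j _ => e j, ← Complex.ofReal_sum, Complex.ofReal_re, Z0,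
    ← Finset.mul_sum]
  ring

end Chain

/-! ### Bounds on the tensors -/

section TensorBounds

variable {ι : Type*} {ω : ι → ℝ} {γ : ℝ}

theorem norm_sgn (b : Bool) : ‖(sgn b : ℂ)‖ = 1 := by cases b <;> simp [sgn]

theorem norm_eta_eq (ω : ι → ℝ) (a : ι × Bool) : ‖eta ω a‖ = 1 / (√2 * √(ω a.1)) := by
  rw [eta, norm_div, norm_mul, norm_sgn, norm_neg, Complex.norm_I, Complex.norm_real,
    Real.norm_of_nonneg (by positivity), one_mul]

theorem one_le_sqrt_two : (1 : ℝ) ≤ √2 := Real.one_le_sqrt.2 (by norm_num)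

theorem norm_eta_le {a : ι × Bool} (h : 1 ≤ ω a.1) : ‖eta ω a‖ ≤ 1 := by
  rw [norm_eta_eq]
  have h1 := one_le_sqrt_two
  have h2 := Real.one_le_sqrt.2 h
  rw [div_le_one (by positivity)]
  nlinarith

theorem norm_eta_sub_le {a : ι × Bool} (h : 1 ≤ ω a.1) :
    ‖eta ω a - eta (fun _ => 1) a‖ ≤ ω a.1 - 1 := by
  have h1 := one_le_sqrt_two
  have h2 := Real.one_le_sqrt.2 h
  have h3 : √(ω a.1) * √(ω a.1) = ω a.1 := Real.mul_self_sqrt (by linarith)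
  have e : eta ω a - eta (fun _ => 1) a
      = (sgn a.2 * Complex.I) * ((1 / √2 * (1 - 1 / √(ω a.1)) : ℝ) : ℂ) := by
    unfold eta
    push_cast
    rw [Real.sqrt_one]
    have hs := sqrt_two_ne_zero_complex
    have hw : ((√(ω a.1) : ℝ) : ℂ) ≠ 0 := by
      have : √(ω a.1) ≠ 0 := by positivity
      exact_mod_cast this
    field_simp
    push_cast
    ring
  have h4 : 0 ≤ 1 - 1 / √(ω a.1) := by
    rw [sub_nonneg, div_le_one (by positivity)]
    exact h2
  rw [e, norm_mul, norm_mul, norm_sgn, Complex.norm_I, Complex.norm_real,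
    Real.norm_of_nonneg (by positivity), one_mul, one_mul]
  have h5 : 1 / √2 ≤ 1 := by rw [div_le_one (by positivity)]; exact h1
  calc 1 / √2 * (1 - 1 / √(ω a.1)) ≤ 1 * (1 - 1 / √(ω a.1)) := by gcongr
    _ = (√(ω a.1) - 1) / √(ω a.1) := by field_simp
    _ ≤ √(ω a.1) - 1 := div_le_self (by linarith) h2
    _ ≤ ω a.1 - 1 := by nlinarith

theorem norm_mul_le_one {x y : ℂ} (hx : ‖x‖ ≤ 1) (hy : ‖y‖ ≤ 1) : ‖x * y‖ ≤ 1 := by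
  rw [norm_mul]
  exact mul_le_one₀ hx (norm_nonneg y) hy

theorem norm_mul_sub_mul_le {x y x' y' : ℂ} {ε ε' : ℝ} (hy : ‖y‖ ≤ 1) (hx' : ‖x'‖ ≤ 1)
    (h : ‖x - x'‖ ≤ ε) (h' : ‖y - y'‖ ≤ ε') : ‖x * y - x' * y'‖ ≤ ε + ε' := by
  have e : x * y - x' * y' = (x - x') * y + x' * (y - y') := by ring
  rw [e]
  refine (norm_add_le _ _).trans ?_
  rw [norm_mul, norm_mul]
  have h1 := norm_nonneg (x - x')
  have h2 := norm_nonneg (y - y')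
  exact add_le_add ((mul_le_of_le_one_right h1 hy).trans h)
    ((mul_le_of_le_one_left h2 hx').trans h')

theorem isNonresonant_one : IsNonresonant (fun _ : ι => 1) 1 :=
  ⟨one_pos, fun _ => le_rfl, fun _ => by norm_num⟩

variable (α β : ℝ) (c : ι → ι → ι → ℝ)

theorem norm_cubT_le (hα : 0 ≤ α) (hω : IsNonresonant ω γ) (a b d : ι × Bool) :
    ‖cubT α c ω a b d‖ ≤ α * |c a.1 b.1 d.1| := by
  have h1 := norm_mul_le_one (norm_mul_le_one (norm_eta_le (hω.one_le a.1))
    (norm_eta_le (hω.one_le b.1))) (norm_eta_le (hω.one_le d.1))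
  rw [cubT, norm_mul, norm_mul, Complex.norm_real, Complex.norm_real, Real.norm_of_nonneg hα,
    Real.norm_eq_abs]
  exact mul_le_mul_of_nonneg_right (mul_le_of_le_one_right hα h1) (abs_nonneg _)

theorem norm_cubT_sub_le (hα : 0 ≤ α) (hω : IsNonresonant ω γ) (a b d : ι × Bool) :
    ‖cubT α c ω a b d - cubT α c (fun _ => 1) a b d‖
      ≤ α * (((ω a.1 - 1) + (ω b.1 - 1) + (ω d.1 - 1)) * |c a.1 b.1 d.1|) := by
  have h1 := norm_mul_sub_mul_le (norm_eta_le (hω.one_le d.1))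
    (norm_mul_le_one (norm_eta_le (a := a) (ω := fun _ => 1) le_rfl)
      (norm_eta_le (a := b) (ω := fun _ => 1) le_rfl))
    (norm_mul_sub_mul_le (norm_eta_le (hω.one_le b.1))
      (norm_eta_le (a := a) (ω := fun _ => 1) le_rfl) (norm_eta_sub_le (hω.one_le a.1))
      (norm_eta_sub_le (hω.one_le b.1))) (norm_eta_sub_le (hω.one_le d.1))
  rw [cubT, cubT, ← sub_mul, ← mul_sub, norm_mul, norm_mul, Complex.norm_real, Complex.norm_real,
    Real.norm_of_nonneg hα, Real.norm_eq_abs, mul_assoc]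
  gcongr

theorem norm_genT_le (hα : 0 ≤ α) (hω : IsNonresonant ω γ) (a b d : ι × Bool) :
    ‖genT α c ω a b d‖ ≤ α / γ * |c a.1 b.1 d.1| := by
  have h1 := norm_cubT_le α c hα hω a b d
  have h2 := hω.le_abs_add₃ a b d
  have h3 := hω.pos
  rw [genT, norm_div, norm_mul, Complex.norm_I, one_mul, Complex.norm_real, Real.norm_eq_abs,
    div_mul_eq_mul_div]
  exact div_le_div₀ (by positivity) h1 h3 h2

theorem abs_sfreq_sub (hω : IsNonresonant ω γ) (a : ι × Bool) :
    |sfreq (fun _ => 1) a - sfreq ω a| ≤ ω a.1 - 1 := by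
  obtain ⟨k, x⟩ := a
  have := hω.one_le k
  rw [abs_le]
  cases x <;> simp only [sfreq, sgn, if_true, if_false, Bool.false_eq_true, Int.cast_one,
    Int.cast_neg, one_mul, neg_mul] <;> constructor <;> linarith

/-- The tensor of the cubic generator is Lipschitz in the frequencies. The difference of the
divisors contributes as much as the difference of the numerators. -/
theorem norm_genT_sub_le (hα : 0 ≤ α) (hω : IsNonresonant ω γ) (a b d : ι × Bool) :
    ‖genT α c ω a b d - genT α c (fun _ => 1) a b d‖
      ≤ 2 * α / γ * (((ω a.1 - 1) + (ω b.1 - 1) + (ω d.1 - 1)) * |c a.1 b.1 d.1|) := by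
  have h1 := norm_cubT_sub_le α c hα hω a b d
  have h2 := norm_cubT_le α c hα isNonresonant_one a b d
  have h3 := hω.le_abs_add₃ a b d
  have h4 := isNonresonant_one.le_abs_add₃ a b d
  have hγ := hω.pos
  have n3 := hω.divisor_ne_zero₃ a b d
  have n4 := isNonresonant_one.divisor_ne_zero₃ a b d
  have h5 : |(sfreq (fun _ => 1) a + sfreq (fun _ => 1) b + sfreq (fun _ => 1) d)
      - (sfreq ω a + sfreq ω b + sfreq ω d)| ≤ (ω a.1 - 1) + (ω b.1 - 1) + (ω d.1 - 1) := by
    have e : (sfreq (fun _ => 1) a + sfreq (fun _ => 1) b + sfreq (fun _ => 1) d)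
      - (sfreq ω a + sfreq ω b + sfreq ω d) = (sfreq (fun _ => 1) a - sfreq ω a)
        + (sfreq (fun _ => 1) b - sfreq ω b) + (sfreq (fun _ => 1) d - sfreq ω d) := by ring
    rw [e]
    exact (abs_add_three _ _ _).trans (add_le_add (add_le_add (abs_sfreq_sub hω a)
      (abs_sfreq_sub hω b)) (abs_sfreq_sub hω d))
  set S := sfreq ω a + sfreq ω b + sfreq ω d
  set S₁ := sfreq (fun _ => 1) a + sfreq (fun _ => 1) b + sfreq (fun _ => 1) d
  set Δ := (ω a.1 - 1) + (ω b.1 - 1) + (ω d.1 - 1)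
  have hΔ : 0 ≤ Δ := (abs_nonneg _).trans h5
  have e : genT α c ω a b d - genT α c (fun _ => 1) a b d
      = (cubT α c ω a b d - cubT α c (fun _ => 1) a b d) / (Complex.I * (S : ℂ))
        + cubT α c (fun _ => 1) a b d * ((S₁ - S : ℝ) : ℂ) / (Complex.I * ((S : ℂ) * S₁)) := by
    have hI := Complex.I_ne_zero
    rw [genT, genT, Complex.ofReal_sub]
    change _ / (Complex.I * (S : ℂ)) - _ / (Complex.I * (S₁ : ℂ)) = _
    field_simp
    ring
  have p3 : 0 < |S| := hγ.trans_le h3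
  have hc := abs_nonneg (c a.1 b.1 d.1)
  rw [e]
  refine (norm_add_le _ _).trans ?_
  simp only [norm_div, norm_mul, Complex.norm_I, one_mul, Complex.norm_real, Real.norm_eq_abs]
  have t1 : ‖cubT α c ω a b d - cubT α c (fun _ => 1) a b d‖ / |S|
      ≤ α * (Δ * |c a.1 b.1 d.1|) / γ := div_le_div₀ (by positivity) h1 hγ h3
  have t2 : ‖cubT α c (fun _ => 1) a b d‖ * |S₁ - S| / (|S| * |S₁|)
      ≤ α * |c a.1 b.1 d.1| * Δ / γ := by
    refine div_le_div₀ (by positivity) (mul_le_mul h2 h5 (abs_nonneg _) (by positivity)) hγ ?_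
    nlinarith
  refine (add_le_add t1 t2).trans (le_of_eq ?_)
  ring

theorem norm_quaT_le (hβ : 0 ≤ β) (c₄ : ι → ι → ι → ι → ℝ) (hω : IsNonresonant ω γ)
    (a b d e : ι × Bool) : ‖quaT β c₄ ω a b d e‖ ≤ β * |c₄ a.1 b.1 d.1 e.1| := by
  have h1 := norm_mul_le_one (norm_mul_le_one (norm_mul_le_one (norm_eta_le (hω.one_le a.1))
    (norm_eta_le (hω.one_le b.1))) (norm_eta_le (hω.one_le d.1))) (norm_eta_le (hω.one_le e.1))
  rw [quaT, norm_mul, norm_mul, Complex.norm_real, Complex.norm_real, Real.norm_of_nonneg hβ,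
    Real.norm_eq_abs]
  exact mul_le_mul_of_nonneg_right (mul_le_of_le_one_right hβ h1) (abs_nonneg _)

theorem norm_quaT_sub_le (hβ : 0 ≤ β) (c₄ : ι → ι → ι → ι → ℝ) (hω : IsNonresonant ω γ)
    (a b d e : ι × Bool) : ‖quaT β c₄ ω a b d e - quaT β c₄ (fun _ => 1) a b d e‖
      ≤ β * (((ω a.1 - 1) + (ω b.1 - 1) + (ω d.1 - 1) + (ω e.1 - 1)) * |c₄ a.1 b.1 d.1 e.1|) := by
  have o : ∀ x : ι × Bool, ‖eta (fun _ : ι => 1) x‖ ≤ 1 := fun x =>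
    norm_eta_le (ω := fun _ => 1) le_rfl
  have h1 := norm_mul_sub_mul_le (norm_eta_le (hω.one_le e.1))
    (norm_mul_le_one (norm_mul_le_one (o a) (o b)) (o d))
    (norm_mul_sub_mul_le (norm_eta_le (hω.one_le d.1)) (norm_mul_le_one (o a) (o b))
      (norm_mul_sub_mul_le (norm_eta_le (hω.one_le b.1)) (o a) (norm_eta_sub_le (hω.one_le a.1))
        (norm_eta_sub_le (hω.one_le b.1))) (norm_eta_sub_le (hω.one_le d.1)))
    (norm_eta_sub_le (hω.one_le e.1))
  rw [quaT, quaT, ← sub_mul, ← mul_sub, norm_mul, norm_mul, Complex.norm_real, Complex.norm_real,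
    Real.norm_of_nonneg hβ, Real.norm_eq_abs, mul_assoc]
  gcongr

variable [Fintype ι]

/-- The coefficients of two composed products with a multiplier `δ` on one of the five modes. -/
def pairSum (δ : ι → ℝ) (k l m p : ι) : ℝ :=
  ∑ n, (δ k + δ l + δ m + δ p + δ n) * (|c k l n| * |c n m p|)

/-- The sum over the three pairings. -/
def pairSums (δ : ι → ℝ) (k l m p : ι) : ℝ :=
  pairSum c δ k l m p + pairSum c δ k m l p + pairSum c δ k p l m

theorem pairSum_nonneg {δ : ι → ℝ} (hδ : ∀ k, 0 ≤ δ k) (k l m p : ι) :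
    0 ≤ pairSum c δ k l m p := by
  refine Finset.sum_nonneg fun n _ => ?_
  have := hδ k
  have := hδ l
  have := hδ m
  have := hδ p
  have := hδ n
  positivity

variable {c} {c₄ : ι → ι → ι → ι → ℝ}

theorem abs_quadC_le (hc : IsContraction c c₄) (k l m p : ι) :
    |c₄ k l m p| ≤ ∑ n, |c k l n| * |c n m p| := by
  rw [hc.eq]
  refine (Finset.abs_sum_le_sum_abs _ _).trans (le_of_eq ?_)
  exact Finset.sum_congr rfl fun n _ => abs_mul _ _

theorem sum_le_pairSum_one (k l m p : ι) :
    ∑ n, |c k l n| * |c n m p| ≤ pairSum c (fun _ => 1) k l m p := by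
  refine Finset.sum_le_sum fun n _ => ?_
  have : 0 ≤ |c k l n| * |c n m p| := by positivity
  nlinarith

theorem norm_compT_le {h g : ι × Bool → ι × Bool → ι × Bool → ℂ} {A B : ℝ} (hA : 0 ≤ A)
    (hh : ∀ a b d, ‖h a b d‖ ≤ A * |c a.1 b.1 d.1|)
    (hg : ∀ a b d, ‖g a b d‖ ≤ B * |c a.1 b.1 d.1|) (a b d e : ι × Bool) :
    ‖compT h g a b d e‖ ≤ 2 * A * B * ∑ n, |c a.1 b.1 n| * |c n d.1 e.1| := by
  have e1 : 2 * A * B * ∑ n, |c a.1 b.1 n| * |c n d.1 e.1|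
      = ∑ n : ι × Bool, A * |c a.1 b.1 n.1| * (B * |c n.1 d.1 e.1|) := by
    rw [Fintype.sum_prod_type, Finset.mul_sum]
    refine Finset.sum_congr rfl fun n _ => ?_
    rw [Fintype.sum_bool]
    ring
  rw [e1, compT]
  refine (norm_sum_le _ _).trans (Finset.sum_le_sum fun n _ => ?_)
  rw [norm_mul, norm_mul, norm_mul, norm_sgn, Complex.norm_I, one_mul, one_mul]
  exact mul_le_mul (hh a b n) (hg (bar n) d e) (norm_nonneg _) (by positivity)

theorem norm_compT_sub_le {h h' g g' : ι × Bool → ι × Bool → ι × Bool → ℂ} {δ : ι → ℝ}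
    {A B A' B' : ℝ} (hδ : ∀ k, 0 ≤ δ k) (hA' : 0 ≤ A') (hA : 0 ≤ A)
    (hB : 0 ≤ B) (hB' : 0 ≤ B')
    (hh : ∀ a b d, ‖h' a b d‖ ≤ A * |c a.1 b.1 d.1|)
    (hg : ∀ a b d, ‖g a b d‖ ≤ B * |c a.1 b.1 d.1|)
    (hh' : ∀ a b d, ‖h a b d - h' a b d‖
      ≤ A' * ((δ a.1 + δ b.1 + δ d.1) * |c a.1 b.1 d.1|))
    (hg' : ∀ a b d, ‖g a b d - g' a b d‖
      ≤ B' * ((δ a.1 + δ b.1 + δ d.1) * |c a.1 b.1 d.1|)) (a b d e : ι × Bool) :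
    ‖compT h g a b d e - compT h' g' a b d e‖
      ≤ 2 * (A' * B + A * B') * pairSum c δ a.1 b.1 d.1 e.1 := by
  have e1 : 2 * (A' * B + A * B') * pairSum c δ a.1 b.1 d.1 e.1
      = ∑ n : ι × Bool, (A' * B + A * B') * ((δ a.1 + δ b.1 + δ d.1 + δ e.1 + δ n.1)
        * (|c a.1 b.1 n.1| * |c n.1 d.1 e.1|)) := by
    rw [Fintype.sum_prod_type, pairSum, Finset.mul_sum]
    refine Finset.sum_congr rfl fun n _ => ?_
    rw [Fintype.sum_bool]
    ring
  rw [e1, compT, compT, ← Finset.sum_sub_distrib]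
  refine (norm_sum_le _ _).trans (Finset.sum_le_sum fun n _ => ?_)
  rw [← mul_sub, norm_mul, norm_mul, norm_sgn, Complex.norm_I, one_mul, one_mul]
  have e2 : h a b n * g (bar n) d e - h' a b n * g' (bar n) d e
      = (h a b n - h' a b n) * g (bar n) d e + h' a b n * (g (bar n) d e - g' (bar n) d e) := by
    ring
  rw [e2]
  refine (norm_add_le _ _).trans ?_
  rw [norm_mul, norm_mul]
  have := hδ a.1
  have := hδ b.1
  have := hδ d.1
  have := hδ e.1
  have := hδ n.1
  have t1 : ‖h a b n - h' a b n‖ * ‖g (bar n) d e‖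
      ≤ A' * ((δ a.1 + δ b.1 + δ n.1) * |c a.1 b.1 n.1|) * (B * |c n.1 d.1 e.1|) :=
    mul_le_mul (hh' a b n) (hg (bar n) d e) (norm_nonneg _) (by positivity)
  have t2 : ‖h' a b n‖ * ‖g (bar n) d e - g' (bar n) d e‖
      ≤ A * |c a.1 b.1 n.1| * (B' * ((δ n.1 + δ d.1 + δ e.1) * |c n.1 d.1 e.1|)) :=
    mul_le_mul (hh a b n) (hg' (bar n) d e) (norm_nonneg _) (by positivity)
  refine (add_le_add t1 t2).trans ?_
  have s1 : δ a.1 + δ b.1 + δ n.1 ≤ δ a.1 + δ b.1 + δ d.1 + δ e.1 + δ n.1 := by linarith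
  have s2 : δ n.1 + δ d.1 + δ e.1 ≤ δ a.1 + δ b.1 + δ d.1 + δ e.1 + δ n.1 := by linarith
  calc A' * ((δ a.1 + δ b.1 + δ n.1) * |c a.1 b.1 n.1|) * (B * |c n.1 d.1 e.1|)
        + A * |c a.1 b.1 n.1| * (B' * ((δ n.1 + δ d.1 + δ e.1) * |c n.1 d.1 e.1|))
      = A' * B * ((δ a.1 + δ b.1 + δ n.1) * (|c a.1 b.1 n.1| * |c n.1 d.1 e.1|))
        + A * B' * ((δ n.1 + δ d.1 + δ e.1) * (|c a.1 b.1 n.1| * |c n.1 d.1 e.1|)) := by ring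
    _ ≤ A' * B * ((δ a.1 + δ b.1 + δ d.1 + δ e.1 + δ n.1)
          * (|c a.1 b.1 n.1| * |c n.1 d.1 e.1|))
        + A * B' * ((δ a.1 + δ b.1 + δ d.1 + δ e.1 + δ n.1)
          * (|c a.1 b.1 n.1| * |c n.1 d.1 e.1|)) := by gcongr
    _ = _ := by ring

theorem norm_symBrT_le {h g : ι × Bool → ι × Bool → ι × Bool → ℂ} {F : ι → ι → ι → ι → ℝ}
    (hF : ∀ a b d e, ‖brT h g a b d e‖ ≤ F a.1 b.1 d.1 e.1) (a b d e : ι × Bool) :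
    ‖symBrT h g a b d e‖
      ≤ 1 / 3 * (F a.1 b.1 d.1 e.1 + F a.1 d.1 b.1 e.1 + F a.1 e.1 b.1 d.1) := by
  rw [symBrT, norm_mul]
  have : ‖(1 / 3 : ℂ)‖ = 1 / 3 := by norm_num
  rw [this]
  gcongr
  exact (norm_add₃_le).trans (add_le_add (add_le_add (hF a b d e) (hF a d b e)) (hF a e b d))

theorem norm_totT_le (hα : 0 ≤ α) (hβ : 0 ≤ β) (hc : IsContraction c c₄)
    (hω : IsNonresonant ω γ) (a b d e : ι × Bool) : ‖totT α β c c₄ ω a b d e‖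
      ≤ (β + 4 * α ^ 2 / γ) * pairSums c (fun _ => 1) a.1 b.1 d.1 e.1 := by
  have hγ := hω.pos
  have n := pairSum_nonneg c (δ := fun _ : ι => 1) (fun _ => zero_le_one)
  have hq : ‖quaT β c₄ ω a b d e‖ ≤ β * pairSum c (fun _ => 1) a.1 b.1 d.1 e.1 :=
    (norm_quaT_le β hβ c₄ hω a b d e).trans <| mul_le_mul_of_nonneg_left
      ((abs_quadC_le hc _ _ _ _).trans (sum_le_pairSum_one _ _ _ _)) hβ
  have hbr : ∀ a b d e, ‖brT (cubT α c ω) (genT α c ω) a b d e‖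
      ≤ 4 * α ^ 2 / γ * pairSum c (fun _ => 1) a.1 b.1 d.1 e.1 := by
    intro a b d e
    have h1 := norm_compT_le (c := c) hα (norm_cubT_le α c hα hω) (norm_genT_le α c hα hω) a b d e
    have h2 := norm_compT_le (c := c) (by positivity) (norm_genT_le α c hα hω)
      (norm_cubT_le α c hα hω) a b d e
    have h3 : 4 * α ^ 2 / γ * (∑ n, |c a.1 b.1 n| * |c n d.1 e.1|)
        ≤ 4 * α ^ 2 / γ * pairSum c (fun _ => 1) a.1 b.1 d.1 e.1 :=
      mul_le_mul_of_nonneg_left (sum_le_pairSum_one _ _ _ _) (by positivity)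
    rw [brT]
    refine (norm_sub_le _ _).trans ((add_le_add h1 h2).trans (le_trans (le_of_eq ?_) h3))
    ring
  have hsy := norm_symBrT_le (F := fun k l m p => 4 * α ^ 2 / γ * pairSum c (fun _ => 1) k l m p)
    hbr a b d e
  rw [totT, pairSums]
  refine (norm_add_le _ _).trans ((add_le_add hq hsy).trans ?_)
  have n1 := n a.1 b.1 d.1 e.1
  have n2 := n a.1 d.1 b.1 e.1
  have n3 := n a.1 e.1 b.1 d.1
  have hk : 0 ≤ 4 * α ^ 2 / γ := by positivity
  nlinarith [mul_nonneg hk n1, mul_nonneg hk n2, mul_nonneg hk n3, mul_nonneg hβ n1,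
    mul_nonneg hβ n2, mul_nonneg hβ n3]

/-- The quartic tensor is Lipschitz in the frequencies, the inner mode of the contraction
included. -/
theorem norm_totT_sub_le (hα : 0 ≤ α) (hβ : 0 ≤ β) (hc : IsContraction c c₄)
    (hω : IsNonresonant ω γ) (a b d e : ι × Bool) :
    ‖totT α β c c₄ ω a b d e - totT α β c c₄ (fun _ => 1) a b d e‖
      ≤ (β + 4 * α ^ 2 / γ) * pairSums c (fun k => ω k - 1) a.1 b.1 d.1 e.1 := by
  have hγ := hω.pos
  have hγ1 : γ ≤ 1 := by linarith [hω.one_le a.1, hω.le a.1]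
  have hδ : ∀ k, 0 ≤ ω k - 1 := fun k => sub_nonneg.2 (hω.one_le k)
  have n := pairSum_nonneg c hδ
  have hg1 : ∀ a b d, ‖genT α c (fun _ => 1) a b d‖ ≤ α / γ * |c a.1 b.1 d.1| := fun a b d =>
    (norm_genT_le α c hα isNonresonant_one a b d).trans <| mul_le_mul_of_nonneg_right
      (div_le_div_of_nonneg_left hα hγ hγ1) (abs_nonneg _)
  have hq : ‖quaT β c₄ ω a b d e - quaT β c₄ (fun _ => 1) a b d e‖
      ≤ β * pairSum c (fun k => ω k - 1) a.1 b.1 d.1 e.1 := by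
    refine (norm_quaT_sub_le β hβ c₄ hω a b d e).trans (mul_le_mul_of_nonneg_left ?_ hβ)
    have h1 := hδ a.1
    have h2 := hδ b.1
    have h3 := hδ d.1
    have h4 := hδ e.1
    refine (mul_le_mul_of_nonneg_left (abs_quadC_le hc a.1 b.1 d.1 e.1) (by positivity)).trans ?_
    rw [Finset.mul_sum]
    refine Finset.sum_le_sum fun n _ => mul_le_mul_of_nonneg_right ?_ (by positivity)
    linarith [hδ n]
  have hbr : ∀ a b d e, ‖brT (cubT α c ω) (genT α c ω) a b d e
      - brT (cubT α c (fun _ => 1)) (genT α c (fun _ => 1)) a b d e‖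
      ≤ 12 * α ^ 2 / γ * pairSum c (fun k => ω k - 1) a.1 b.1 d.1 e.1 := by
    intro a b d e
    have h1 := norm_compT_sub_le hδ hα hα (by positivity) (by positivity)
      (norm_cubT_le α c hα isNonresonant_one) (norm_genT_le α c hα hω)
      (norm_cubT_sub_le α c hα hω) (norm_genT_sub_le α c hα hω) a b d e
    have h2 := norm_compT_sub_le hδ (by positivity) (by positivity) hα hα hg1
      (norm_cubT_le α c hα hω) (norm_genT_sub_le α c hα hω) (norm_cubT_sub_le α c hα hω) a b d e
    rw [brT, brT, sub_sub_sub_comm]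
    refine (norm_sub_le _ _).trans ((add_le_add h1 h2).trans (le_of_eq ?_))
    ring
  have hsy : ‖symBrT (cubT α c ω) (genT α c ω) a b d e
      - symBrT (cubT α c (fun _ => 1)) (genT α c (fun _ => 1)) a b d e‖
      ≤ 4 * α ^ 2 / γ * pairSums c (fun k => ω k - 1) a.1 b.1 d.1 e.1 := by
    rw [symBrT, symBrT, ← mul_sub, norm_mul]
    have h3 : ‖(1 / 3 : ℂ)‖ = 1 / 3 := by norm_num
    have e3 : ∀ x y z x' y' z' : ℂ, x + y + z - (x' + y' + z') = (x - x') + (y - y') + (z - z') :=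
      fun x y z x' y' z' => by ring
    rw [h3, e3]
    have := (norm_add₃_le).trans (add_le_add (add_le_add (hbr a b d e) (hbr a d b e))
      (hbr a e b d))
    refine (mul_le_mul_of_nonneg_left this (by norm_num)).trans (le_of_eq ?_)
    rw [pairSums]
    ring
  have e4 : totT α β c c₄ ω a b d e - totT α β c c₄ (fun _ => 1) a b d e
      = (quaT β c₄ ω a b d e - quaT β c₄ (fun _ => 1) a b d e)
        + (symBrT (cubT α c ω) (genT α c ω) a b d e
          - symBrT (cubT α c (fun _ => 1)) (genT α c (fun _ => 1)) a b d e) := by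
    rw [totT, totT]
    ring
  rw [e4]
  refine (norm_add_le _ _).trans ((add_le_add hq hsy).trans ?_)
  rw [add_mul]
  refine add_le_add (mul_le_mul_of_nonneg_left ?_ hβ) le_rfl
  rw [pairSums]
  linarith [n a.1 d.1 b.1 e.1, n a.1 e.1 b.1 d.1]

theorem pairSums_nonneg {δ : ι → ℝ} (hδ : ∀ k, 0 ≤ δ k) (k l m p : ι) :
    0 ≤ pairSums c δ k l m p :=
  add_nonneg (add_nonneg (pairSum_nonneg c hδ _ _ _ _) (pairSum_nonneg c hδ _ _ _ _))
    (pairSum_nonneg c hδ _ _ _ _)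

theorem norm_resT_le (hα : 0 ≤ α) (hβ : 0 ≤ β) (hc : IsContraction c c₄)
    (hω : IsNonresonant ω γ) (a b d e : ι × Bool) : ‖resT α β c c₄ ω a b d e‖
      ≤ (β + 4 * α ^ 2 / γ) * pairSums c (fun _ => 1) a.1 b.1 d.1 e.1 := by
  have hγ := hω.pos
  have n := pairSums_nonneg (c := c) (δ := fun _ : ι => 1) (fun _ => zero_le_one)
    a.1 b.1 d.1 e.1
  rw [resT]
  split_ifs
  · exact norm_totT_le α β hα hβ hc hω a b d e
  · rw [norm_zero]
    positivity

theorem norm_resT_sub_le (hα : 0 ≤ α) (hβ : 0 ≤ β) (hc : IsContraction c c₄)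
    (hω : IsNonresonant ω γ) (a b d e : ι × Bool) :
    ‖resT α β c c₄ ω a b d e - resT α β c c₄ (fun _ => 1) a b d e‖
      ≤ (β + 4 * α ^ 2 / γ) * pairSums c (fun k => ω k - 1) a.1 b.1 d.1 e.1 := by
  have hγ := hω.pos
  have n := pairSums_nonneg (c := c) (fun k => sub_nonneg.2 (hω.one_le k)) a.1 b.1 d.1 e.1
  rw [resT, resT]
  split_ifs
  · exact norm_totT_sub_le α β hα hβ hc hω a b d e
  · rw [sub_zero, norm_zero]
    positivity

theorem norm_gen₄T_le (hα : 0 ≤ α) (hβ : 0 ≤ β) (hc : IsContraction c c₄)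
    (hω : IsNonresonant ω γ) (a b d e : ι × Bool) : ‖gen₄T α β c c₄ ω a b d e‖
      ≤ (β + 4 * α ^ 2 / γ) / γ * pairSums c (fun _ => 1) a.1 b.1 d.1 e.1 := by
  have hγ := hω.pos
  have n := pairSums_nonneg (c := c) (δ := fun _ : ι => 1) (fun _ => zero_le_one)
    a.1 b.1 d.1 e.1
  rw [gen₄T]
  split_ifs with h
  · rw [norm_zero]
    positivity
  · rw [norm_div, norm_mul, Complex.norm_I, one_mul, Complex.norm_real, Real.norm_eq_abs,
      div_mul_eq_mul_div]
    exact div_le_div₀ (by positivity) (norm_totT_le α β hα hβ hc hω a b d e) hγ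
      (hω.le_abs_add₄ h)

end TensorBounds

/-! ### Bounds on the fields -/

section WeightedNorms

variable {ι : Type*} [Fintype ι]

/-- The `ℓ²` norm with weight `w`. -/
noncomputable def wl2 (w x : ι → ℝ) : ℝ := l2 fun k => w k * x k

theorem wl2_nonneg (w x : ι → ℝ) : 0 ≤ wl2 w x := l2_nonneg _

theorem wl2_add_le (w x y : ι → ℝ) : wl2 w (fun k => x k + y k) ≤ wl2 w x + wl2 w y := by
  have h := l2_add_le (fun k => w k * x k) (fun k => w k * y k)
  simp only [← mul_add] at h
  exact h

theorem wl2_mono {w x y : ι → ℝ} (hw : ∀ k, 0 ≤ w k) (hx : ∀ k, 0 ≤ x k) (h : ∀ k, x k ≤ y k) :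
    wl2 w x ≤ wl2 w y :=
  l2_mono (fun k => mul_nonneg (hw k) (hx k)) fun k => mul_le_mul_of_nonneg_left (h k) (hw k)

theorem wl2_const_mul {r : ℝ} (hr : 0 ≤ r) (w x : ι → ℝ) :
    wl2 w (fun k => r * x k) = r * wl2 w x := by
  rw [wl2, wl2, ← l2_const_mul hr]
  simp only [mul_left_comm]

/-- The product of two sequences of Fourier coefficients, with absolute values throughout. -/
def cprod (c : ι → ι → ι → ℝ) (x y : ι → ℝ) (k : ι) : ℝ := ∑ l, ∑ m, |c k l m| * (x l * y m)

theorem cprod_nonneg (c : ι → ι → ι → ℝ) {x y : ι → ℝ} (hx : ∀ k, 0 ≤ x k) (hy : ∀ k, 0 ≤ y k)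
    (k : ι) : 0 ≤ cprod c x y k :=
  Finset.sum_nonneg fun l _ => Finset.sum_nonneg fun m _ =>
    mul_nonneg (abs_nonneg _) (mul_nonneg (hx l) (hy m))

/-- Both weights `w` and `w'` define algebra norms for `cprod`, and multiplication by `δ` costs
the passage from `w` to the weaker weight `w'`, with a small factor `ε`. With `w' = w`, `δ = 1` and
`ε = 1` this is the algebra property alone. -/
structure IsLossy (c : ι → ι → ι → ℝ) (w w' δ : ι → ℝ) (C ε : ℝ) : Prop where
  C_nonneg : 0 ≤ C
  ε_nonneg : 0 ≤ ε
  δ_nonneg : ∀ k, 0 ≤ δ k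
  w_nonneg : ∀ k, 0 ≤ w' k
  le : ∀ k, w' k ≤ w k
  loss : ∀ k, w' k * δ k ≤ ε * w k
  alg : ∀ x y : ι → ℝ, (∀ k, 0 ≤ x k) → (∀ k, 0 ≤ y k) →
    wl2 w (cprod c x y) ≤ C * wl2 w x * wl2 w y
  alg' : ∀ x y : ι → ℝ, (∀ k, 0 ≤ x k) → (∀ k, 0 ≤ y k) →
    wl2 w' (cprod c x y) ≤ C * wl2 w' x * wl2 w' y

variable {c : ι → ι → ι → ℝ} {w w' δ : ι → ℝ} {C ε : ℝ}

theorem IsLossy.wl2_le (H : IsLossy c w w' δ C ε) {x : ι → ℝ} (hx : ∀ k, 0 ≤ x k) :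
    wl2 w' x ≤ wl2 w x :=
  l2_mono (fun k => mul_nonneg (H.w_nonneg k) (hx k)) fun k =>
    mul_le_mul_of_nonneg_right (H.le k) (hx k)

theorem IsLossy.wl2_mul_le (H : IsLossy c w w' δ C ε) {x : ι → ℝ} (hx : ∀ k, 0 ≤ x k) :
    wl2 w' (fun k => δ k * x k) ≤ ε * wl2 w x := by
  rw [← wl2_const_mul H.ε_nonneg]
  refine l2_mono (fun k => mul_nonneg (H.w_nonneg k) (mul_nonneg (H.δ_nonneg k) (hx k)))
    fun k => ?_
  have := mul_le_mul_of_nonneg_right (H.loss k) (hx k)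
  linarith

theorem IsLossy.wl2_cprod_le (H : IsLossy c w w' δ C ε) {x y : ι → ℝ} (hx : ∀ k, 0 ≤ x k)
    (hy : ∀ k, 0 ≤ y k) {A B : ℝ} (hA : wl2 w' x ≤ A) (hB : wl2 w' y ≤ B) :
    wl2 w' (cprod c x y) ≤ C * A * B := by
  have := H.C_nonneg
  have h1 := wl2_nonneg w' x
  have h2 := wl2_nonneg w' y
  have h3 := h1.trans hA
  refine (H.alg' x y hx hy).trans ?_
  gcongr

/-- The multiplier `δ` is placed on one of the three modes at a time. -/
theorem IsLossy.quadratic_le (H : IsLossy c w w' δ C ε) {x y : ι → ℝ} (hx : ∀ k, 0 ≤ x k)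
    (hy : ∀ k, 0 ≤ y k) :
    wl2 w' (fun k => ∑ l, ∑ m, (δ k + δ l + δ m) * |c k l m| * (x l * y m))
      ≤ 3 * C * ε * wl2 w x * wl2 w y := by
  have hδ := H.δ_nonneg
  have e : ∀ k, ∑ l, ∑ m, (δ k + δ l + δ m) * |c k l m| * (x l * y m)
      = δ k * cprod c x y k + cprod c (fun l => δ l * x l) y k
        + cprod c x (fun m => δ m * y m) k := by
    intro k
    simp only [cprod, Finset.mul_sum, ← Finset.sum_add_distrib]
    exact Finset.sum_congr rfl fun l _ => Finset.sum_congr rfl fun m _ => by ring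
  have hδx : ∀ k, 0 ≤ δ k * x k := fun k => mul_nonneg (hδ k) (hx k)
  have hδy : ∀ k, 0 ≤ δ k * y k := fun k => mul_nonneg (hδ k) (hy k)
  have h1 := (H.wl2_mul_le (cprod_nonneg c hx hy)).trans
    (mul_le_mul_of_nonneg_left (H.alg x y hx hy) H.ε_nonneg)
  have h2 := H.wl2_cprod_le hδx hy (H.wl2_mul_le hx) (H.wl2_le hy)
  have h3 := H.wl2_cprod_le hx hδy (H.wl2_le hx) (H.wl2_mul_le hy)
  simp only [e]
  refine (wl2_add_le _ _ _).trans ((add_le_add (wl2_add_le _ _ _) le_rfl).trans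
    ((add_le_add (add_le_add h1 h2) h3).trans (le_of_eq ?_)))
  ring

/-- The multiplier `δ` is placed on one of the four outer modes or on the inner mode at a time. -/
theorem IsLossy.cubic_le (H : IsLossy c w w' δ C ε) {x y z : ι → ℝ} (hx : ∀ k, 0 ≤ x k)
    (hy : ∀ k, 0 ≤ y k) (hz : ∀ k, 0 ≤ z k) :
    wl2 w' (fun k => ∑ l, ∑ m, ∑ p, pairSum c δ k l m p * (x l * (y m * z p)))
      ≤ 5 * C ^ 2 * ε * wl2 w x * wl2 w y * wl2 w z := by
  have hδ := H.δ_nonneg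
  have hC := H.C_nonneg
  have hε := H.ε_nonneg
  have e : ∀ k, ∑ l, ∑ m, ∑ p, pairSum c δ k l m p * (x l * (y m * z p))
      = δ k * cprod c x (cprod c y z) k + cprod c (fun l => δ l * x l) (cprod c y z) k
        + cprod c x (cprod c (fun m => δ m * y m) z) k
        + cprod c x (cprod c y (fun p => δ p * z p)) k
        + cprod c x (fun n => δ n * cprod c y z n) k := by
    intro k
    simp only [pairSum, cprod, Finset.mul_sum, Finset.sum_mul, ← Finset.sum_add_distrib]
    refine Finset.sum_congr rfl fun l _ => ?_
    refine (Finset.sum_congr rfl fun m _ => Finset.sum_comm).trans (Finset.sum_comm.trans ?_)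
    exact Finset.sum_congr rfl fun n _ => Finset.sum_congr rfl fun m _ =>
      Finset.sum_congr rfl fun p _ => by ring
  have hδx : ∀ k, 0 ≤ δ k * x k := fun k => mul_nonneg (hδ k) (hx k)
  have hδy : ∀ k, 0 ≤ δ k * y k := fun k => mul_nonneg (hδ k) (hy k)
  have hδz : ∀ k, 0 ≤ δ k * z k := fun k => mul_nonneg (hδ k) (hz k)
  have hyz := cprod_nonneg c hy hz
  have hδyz : ∀ k, 0 ≤ δ k * cprod c y z k := fun k => mul_nonneg (hδ k) (hyz k)
  have x0 := wl2_nonneg w x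
  have y0 := wl2_nonneg w y
  have z0 := wl2_nonneg w z
  have a1 := H.alg y z hy hz
  have h1 : wl2 w' (fun k => δ k * cprod c x (cprod c y z) k)
      ≤ ε * (C * wl2 w x * (C * wl2 w y * wl2 w z)) :=
    (H.wl2_mul_le (cprod_nonneg c hx hyz)).trans <| mul_le_mul_of_nonneg_left
      ((H.alg x _ hx hyz).trans (mul_le_mul_of_nonneg_left a1 (by positivity))) hε
  have h2 := H.wl2_cprod_le hδx hyz (H.wl2_mul_le hx) ((H.wl2_le hyz).trans a1)
  have h3 := H.wl2_cprod_le hx (cprod_nonneg c hδy hz) (H.wl2_le hx)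
    (H.wl2_cprod_le hδy hz (H.wl2_mul_le hy) (H.wl2_le hz))
  have h4 := H.wl2_cprod_le hx (cprod_nonneg c hy hδz) (H.wl2_le hx)
    (H.wl2_cprod_le hy hδz (H.wl2_le hy) (H.wl2_mul_le hz))
  have h5 := H.wl2_cprod_le hx hδyz (H.wl2_le hx)
    ((H.wl2_mul_le hyz).trans (mul_le_mul_of_nonneg_left a1 hε))
  simp only [e]
  refine (wl2_add_le _ _ _).trans ((add_le_add ((wl2_add_le _ _ _).trans
    (add_le_add ((wl2_add_le _ _ _).trans (add_le_add (wl2_add_le _ _ _) le_rfl)) le_rfl))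
    le_rfl).trans ((add_le_add (add_le_add (add_le_add (add_le_add h1 h2) h3) h4) h5).trans
      (le_of_eq ?_)))
  ring

theorem norm_field₂_le {h : ι × Bool → ι × Bool → ι × Bool → ℂ} {M : ι → ι → ι → ℝ}
    (hM : ∀ a b d, ‖h a b d‖ ≤ M a.1 b.1 d.1) (u v : ι → ℂ) (k : ι) :
    ‖field₂ h u v k‖ ≤ 4 * ∑ l, ∑ m, M k l m * (‖u l‖ * ‖v m‖) := by
  have e : 4 * ∑ l, ∑ m, M k l m * (‖u l‖ * ‖v m‖)
      = ∑ b : ι × Bool, ∑ d : ι × Bool, M k b.1 d.1 * (‖coord b u‖ * ‖coord d v‖) := by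
    simp only [norm_coord, Fintype.sum_prod_type, Fintype.sum_bool, ← Finset.sum_add_distrib,
      Finset.mul_sum]
    exact Finset.sum_congr rfl fun l _ => Finset.sum_congr rfl fun m _ => by ring
  rw [field₂_apply, norm_mul, Complex.norm_I, one_mul, e]
  refine (norm_sum_le _ _).trans (Finset.sum_le_sum fun b _ => (norm_sum_le _ _).trans
    (Finset.sum_le_sum fun d _ => ?_))
  rw [norm_mul, norm_mul]
  exact mul_le_mul_of_nonneg_right (hM (k, false) b d) (by positivity)

theorem norm_field₃_le {t : ι × Bool → ι × Bool → ι × Bool → ι × Bool → ℂ}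
    {M : ι → ι → ι → ι → ℝ} (hM : ∀ a b d e, ‖t a b d e‖ ≤ M a.1 b.1 d.1 e.1)
    (u v x : ι → ℂ) (k : ι) :
    ‖field₃ t u v x k‖ ≤ 8 * ∑ l, ∑ m, ∑ p, M k l m p * (‖u l‖ * (‖v m‖ * ‖x p‖)) := by
  have e : 8 * ∑ l, ∑ m, ∑ p, M k l m p * (‖u l‖ * (‖v m‖ * ‖x p‖))
      = ∑ b : ι × Bool, ∑ d : ι × Bool, ∑ e : ι × Bool,
        M k b.1 d.1 e.1 * (‖coord b u‖ * (‖coord d v‖ * ‖coord e x‖)) := by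
    simp only [norm_coord, Fintype.sum_prod_type, Fintype.sum_bool, ← Finset.sum_add_distrib,
      Finset.mul_sum]
    exact Finset.sum_congr rfl fun l _ => Finset.sum_congr rfl fun m _ =>
      Finset.sum_congr rfl fun p _ => by ring
  rw [field₃_apply, norm_mul, Complex.norm_I, one_mul, e]
  refine (norm_sum_le _ _).trans (Finset.sum_le_sum fun b _ => (norm_sum_le _ _).trans
    (Finset.sum_le_sum fun d _ => (norm_sum_le _ _).trans (Finset.sum_le_sum fun e _ => ?_)))
  rw [norm_mul, norm_mul, norm_mul]
  exact mul_le_mul_of_nonneg_right (hM (k, false) b d e) (by positivity)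

theorem IsLossy.field₂_le (H : IsLossy c w w' δ C ε)
    {h : ι × Bool → ι × Bool → ι × Bool → ℂ} {κ : ℝ} (hκ : 0 ≤ κ)
    (hh : ∀ a b d, ‖h a b d‖ ≤ κ * ((δ a.1 + δ b.1 + δ d.1) * |c a.1 b.1 d.1|)) (u v : ι → ℂ) :
    wl2 w' (fun k => ‖field₂ h u v k‖)
      ≤ 12 * κ * C * ε * wl2 w (fun k => ‖u k‖) * wl2 w (fun k => ‖v k‖) := by
  have h1 : ∀ k, ‖field₂ h u v k‖
      ≤ (4 * κ) * ∑ l, ∑ m, (δ k + δ l + δ m) * |c k l m| * (‖u l‖ * ‖v m‖) := by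
    intro k
    refine (norm_field₂_le (M := fun k l m => κ * ((δ k + δ l + δ m) * |c k l m|)) hh u v k).trans
      (le_of_eq ?_)
    simp only [Finset.mul_sum]
    exact Finset.sum_congr rfl fun l _ => Finset.sum_congr rfl fun m _ => by ring
  refine (wl2_mono H.w_nonneg (fun k => norm_nonneg _) h1).trans ?_
  rw [wl2_const_mul (by positivity)]
  refine (mul_le_mul_of_nonneg_left (H.quadratic_le (fun k => norm_nonneg (u k))
    fun k => norm_nonneg (v k)) (by positivity)).trans (le_of_eq ?_)
  ring

theorem IsLossy.field₃_le (H : IsLossy c w w' δ C ε)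
    {t : ι × Bool → ι × Bool → ι × Bool → ι × Bool → ℂ} {κ : ℝ} (hκ : 0 ≤ κ)
    (ht : ∀ a b d e, ‖t a b d e‖ ≤ κ * pairSums c δ a.1 b.1 d.1 e.1) (u v x : ι → ℂ) :
    wl2 w' (fun k => ‖field₃ t u v x k‖) ≤ 120 * κ * C ^ 2 * ε * wl2 w (fun k => ‖u k‖)
      * wl2 w (fun k => ‖v k‖) * wl2 w (fun k => ‖x k‖) := by
  have hu : ∀ k, 0 ≤ ‖u k‖ := fun k => norm_nonneg _
  have hv : ∀ k, 0 ≤ ‖v k‖ := fun k => norm_nonneg _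
  have hx : ∀ k, 0 ≤ ‖x k‖ := fun k => norm_nonneg _
  have h1 : ∀ k, ‖field₃ t u v x k‖ ≤ (8 * κ) * (
      ∑ l, ∑ m, ∑ p, pairSum c δ k l m p * (‖u l‖ * (‖v m‖ * ‖x p‖))
      + ∑ l, ∑ m, ∑ p, pairSum c δ k l m p * (‖v l‖ * (‖u m‖ * ‖x p‖))
      + ∑ l, ∑ m, ∑ p, pairSum c δ k l m p * (‖x l‖ * (‖u m‖ * ‖v p‖))) := by
    intro k
    have e2 : ∑ l, ∑ m, ∑ p, pairSum c δ k l m p * (‖v l‖ * (‖u m‖ * ‖x p‖))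
        = ∑ l, ∑ m, ∑ p, pairSum c δ k m l p * (‖u l‖ * (‖v m‖ * ‖x p‖)) := by
      rw [Finset.sum_comm]
      exact Finset.sum_congr rfl fun l _ => Finset.sum_congr rfl fun m _ =>
        Finset.sum_congr rfl fun p _ => by ring
    have e3 : ∑ l, ∑ m, ∑ p, pairSum c δ k l m p * (‖x l‖ * (‖u m‖ * ‖v p‖))
        = ∑ l, ∑ m, ∑ p, pairSum c δ k p l m * (‖u l‖ * (‖v m‖ * ‖x p‖)) := by
      refine Finset.sum_comm.trans (Finset.sum_congr rfl fun l _ => Finset.sum_comm.trans ?_)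
      exact Finset.sum_congr rfl fun m _ => Finset.sum_congr rfl fun p _ => by ring
    refine (norm_field₃_le (M := fun k l m p => κ * pairSums c δ k l m p) ht u v x k).trans
      (le_of_eq ?_)
    rw [e2, e3]
    simp only [Finset.mul_sum, ← Finset.sum_add_distrib, pairSums]
    exact Finset.sum_congr rfl fun l _ => Finset.sum_congr rfl fun m _ =>
      Finset.sum_congr rfl fun p _ => by ring
  refine (wl2_mono H.w_nonneg (fun k => norm_nonneg _) h1).trans ?_
  rw [wl2_const_mul (by positivity)]
  refine (mul_le_mul_of_nonneg_left ((wl2_add_le _ _ _).trans (add_le_add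
    ((wl2_add_le _ _ _).trans (add_le_add (H.cubic_le hu hv hx) (H.cubic_le hv hu hx)))
      (H.cubic_le hx hu hv))) (by positivity)).trans (le_of_eq ?_)
  ring

end WeightedNorms

/-! ### The norms of the phase space -/

section PhaseNorm

variable {bc : BC} {N : ℕ}

theorem weight_pos (hN : 1 ≤ N) (s σ : ℝ) (k : ↥(idx bc N)) : 0 < weight bc N s σ k := by
  have : (0 : ℝ) < N := by exact_mod_cast hN
  have hmu : 0 < mu N := by unfold mu; positivity
  exact mul_pos (Real.sqrt_pos.2 hmu) (wt_pos s σ k)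

theorem weight_nonneg (s σ : ℝ) (k : ↥(idx bc N)) : 0 ≤ weight bc N s σ k :=
  mul_nonneg (Real.sqrt_nonneg _) (wt_pos s σ k).le

theorem wnorm_eq (s σ : ℝ) (ψ : Phase bc N) :
    wnorm s σ ψ = wl2 (weight bc N s σ) (fun k => ‖ψ k‖) := by
  have hmu : 0 ≤ mu N := by unfold mu; positivity
  rw [wnorm, wl2, l2, Finset.mul_sum]
  congr 1
  refine Finset.sum_congr rfl fun k _ => ?_
  have h1 : (br (k : ℤ) ^ s) ^ 2 = br (k : ℤ) ^ (2 * s) := by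
    rw [← Real.rpow_natCast, ← Real.rpow_mul (br_pos _).le, mul_comm s]
    norm_num
  have h2 : Real.exp (σ * |((k : ℤ) : ℝ)|) ^ 2 = Real.exp (2 * σ * |((k : ℤ) : ℝ)|) := by
    rw [← Real.exp_nat_mul]
    congr 1
    push_cast
    ring
  rw [weight, wt, mul_pow, mul_pow, mul_pow, Real.sq_sqrt hmu, h1, h2, br]
  ring

theorem wnorm_nonneg (s σ : ℝ) (ψ : Phase bc N) : 0 ≤ wnorm s σ ψ := Real.sqrt_nonneg _

/-- The norm `‖·‖_{s,σ}` as a seminorm. -/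
noncomputable def wSeminorm (bc : BC) (N : ℕ) (s σ : ℝ) : Seminorm ℝ (Phase bc N) :=
  Seminorm.of (wnorm s σ)
    (fun x y => by
      rw [wnorm_eq, wnorm_eq, wnorm_eq]
      exact (wl2_mono (weight_nonneg s σ) (fun k => norm_nonneg _)
        fun k => norm_add_le (x k) (y k)).trans (wl2_add_le _ _ _))
    (fun r x => by
      rw [wnorm_eq, wnorm_eq, ← wl2_const_mul (norm_nonneg r)]
      simp only [Pi.smul_apply, norm_smul])

theorem wSeminorm_apply (s σ : ℝ) (ψ : Phase bc N) : wSeminorm bc N s σ ψ = wnorm s σ ψ := rfl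

theorem isAdmissibleNorm_wSeminorm (hN : 1 ≤ N) (s σ : ℝ) :
    IsAdmissibleNorm (wSeminorm bc N s σ) := by
  refine ⟨?_, ∑ k : ↥(idx bc N), 1 / weight bc N s σ k, fun ψ => ?_⟩
  · change Continuous fun ψ : Phase bc N => wnorm s σ ψ
    unfold wnorm
    fun_prop
  · rw [wSeminorm_apply]
    have hw : ∀ k : ↥(idx bc N), 0 < weight bc N s σ k := weight_pos hN s σ
    have h0 : 0 ≤ ∑ k : ↥(idx bc N), 1 / weight bc N s σ k :=
      Finset.sum_nonneg fun k _ => (one_div_pos.2 (hw k)).le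
    refine (pi_norm_le_iff_of_nonneg (mul_nonneg h0 (wnorm_nonneg s σ ψ))).2 fun k => ?_
    have h1 : weight bc N s σ k * ‖ψ k‖ ≤ wnorm s σ ψ := by
      rw [wnorm_eq, wl2, l2]
      refine Real.le_sqrt_of_sq_le ?_
      exact Finset.single_le_sum (f := fun k => (weight bc N s σ k * ‖ψ k‖) ^ 2)
        (fun i _ => sq_nonneg _) (Finset.mem_univ k)
    have h2 : 1 / weight bc N s σ k ≤ ∑ k : ↥(idx bc N), 1 / weight bc N s σ k :=
      Finset.single_le_sum (f := fun k : ↥(idx bc N) => 1 / weight bc N s σ k)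
        (fun i _ => (one_div_pos.2 (hw i)).le) (Finset.mem_univ k)
    calc ‖ψ k‖ = 1 / weight bc N s σ k * (weight bc N s σ k * ‖ψ k‖) := by
          have := (hw k).ne'
          field_simp
      _ ≤ _ := mul_le_mul h2 h1 (mul_nonneg (hw k).le (norm_nonneg _)) h0

theorem wl2_cprod_triC (w x y : ↥(idx bc N) → ℝ) :
    wl2 w (cprod (triC bc N) x y) = l2 fun m => w m * prodMaj bc N x y m := by
  rw [wl2]
  congr 1
  funext k
  congr 1
  refine Finset.sum_congr rfl fun l _ => Finset.sum_congr rfl fun m _ => ?_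
  rw [triC_eq, mul_assoc]

/-- The algebra property of the norm `‖·‖_{s,σ}`, as an instance of `IsLossy` without loss. -/
theorem isLossy_self {s σ : ℝ} (h : Admissible bc s σ) : ∃ C : ℝ, ∀ N : ℕ, 1 ≤ N →
    IsLossy (triC bc N) (weight bc N s σ) (weight bc N s σ) (fun _ => 1) C 1 := by
  obtain ⟨C, hC, H⟩ := prodMaj_bdd h
  refine ⟨C, fun N hN => ?_⟩
  have alg : ∀ x y : ↥(idx bc N) → ℝ, (∀ k, 0 ≤ x k) → (∀ k, 0 ≤ y k) →
      wl2 (weight bc N s σ) (cprod (triC bc N) x y)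
        ≤ C * wl2 (weight bc N s σ) x * wl2 (weight bc N s σ) y := fun x y hx hy => by
    rw [wl2_cprod_triC]
    exact H N hN x y hx hy
  exact ⟨hC, zero_le_one, fun _ => zero_le_one, weight_nonneg s σ, fun _ => le_rfl,
    fun k => by rw [mul_one, one_mul], alg, alg⟩

/-- The deviation of the frequencies from `1` is quadratic in `μ [k]` and bounded, hence controlled
by every power of `μ [k]` with exponent in `[0, 2]`. -/
theorem freq_sub_one_le {a : ℝ} (ha : 0 ≤ a) (hN : 1 ≤ N) {r : ℝ} (hr0 : 0 ≤ r) (hr2 : r ≤ 2)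
    (k : ℤ) : freq N a k - 1 ≤ 8 * a * (mu N * br k) ^ r := by
  have hN' : (1 : ℝ) ≤ N := by exact_mod_cast hN
  have hmu : 0 < mu N := by unfold mu; positivity
  set t := mu N * br k with ht
  have ht0 : 0 < t := mul_pos hmu (br_pos k)
  have h1 := one_le_freq (N := N) ha k
  have h2 := freq_sq (N := N) ha k
  have h3 : freq N a k - 1 ≤ 2 * a * Real.sin (k * ang N) ^ 2 := by nlinarith
  have h4 := Real.sin_sq_le_one (k * ang N)
  have h5 : Real.sin (k * ang N) ^ 2 ≤ 4 * t ^ 2 := by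
    have h6 : |Real.sin (k * ang N)| ≤ 2 * t := by
      refine Real.abs_sin_le_abs.trans ?_
      rw [abs_mul, abs_of_pos (ang_pos N)]
      have h7 : |(k : ℝ)| ≤ br k := le_max_right _ _
      have h8 : ang N ≤ 2 * mu N := by
        unfold ang mu
        have := Real.pi_le_four
        rw [mul_one_div, div_le_div_iff₀ (by positivity) (by positivity)]
        nlinarith
      calc |(k : ℝ)| * ang N ≤ br k * (2 * mu N) :=
            mul_le_mul h7 h8 (ang_pos N).le (br_pos k).le
        _ = 2 * t := by rw [ht]; ring
    rw [← sq_abs]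
    have := abs_nonneg (Real.sin (k * ang N))
    nlinarith
  rcases le_total t 1 with h | h
  · have h9 : t ^ 2 ≤ t ^ r := by
      rw [← Real.rpow_natCast]
      exact Real.rpow_le_rpow_of_exponent_ge ht0 h (by exact_mod_cast hr2)
    nlinarith
  · have h9 : 1 ≤ t ^ r := Real.one_le_rpow h hr0
    nlinarith

/-- The frequencies differ from `1` by a small amount at the price of `s₁` derivatives. -/
theorem isLossy_freq {s σ s₁ a : ℝ} (ha : 0 ≤ a) (h : Admissible bc s σ)
    (h₁ : AdmissibleLoss bc s s₁) : ∃ C : ℝ, ∀ N : ℕ, 1 ≤ N →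
    IsLossy (triC bc N) (weight bc N s σ) (weight bc N (s - s₁) σ)
      (fun k => modeFreq bc N a k - 1) C (8 * a * mu N ^ s₁) := by
  have hr : 0 ≤ s₁ ∧ s₁ ≤ 2 := by
    cases bc with
    | periodic => exact ⟨h₁.1, h₁.2.2⟩
    | dirichlet => exact ⟨h₁.1, by linarith [h₁.2.1, h₁.2.2]⟩
  have hadm : Admissible bc (s - s₁) σ := by
    cases bc with
    | periodic => exact ⟨by linarith [h₁.2.1], h.2⟩
    | dirichlet => exact ⟨by linarith [h₁.2.1], by linarith [h₁.1, h.2.1], h.2.2⟩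
  obtain ⟨C, hC, H⟩ := prodMaj_bdd h
  obtain ⟨C', hC', H'⟩ := prodMaj_bdd hadm
  refine ⟨C + C', fun N hN => ?_⟩
  have hmu : 0 ≤ mu N := by unfold mu; positivity
  refine ⟨by positivity, by positivity, fun k => sub_nonneg.2 (one_le_freq ha k),
    weight_nonneg _ _, fun k => ?_, fun k => ?_, fun x y hx hy => ?_, fun x y hx hy => ?_⟩
  · unfold weight wt
    have := Real.rpow_le_rpow_of_exponent_le (one_le_br k) (show s - s₁ ≤ s by linarith [hr.1])
    gcongr
  · have h3 := freq_sub_one_le ha hN hr.1 hr.2 k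
    rw [Real.mul_rpow hmu (br_pos k).le] at h3
    have h4 : br (k : ℤ) ^ s = br (k : ℤ) ^ (s - s₁) * br (k : ℤ) ^ s₁ := by
      rw [← Real.rpow_add (br_pos k), sub_add_cancel]
    have h5 := mul_le_mul_of_nonneg_left h3 (weight_nonneg (bc := bc) (s - s₁) σ k)
    rw [modeFreq]
    refine h5.trans (le_of_eq ?_)
    rw [weight, weight, wt, wt, h4]
    ring
  · rw [wl2_cprod_triC]
    refine (H N hN x y hx hy).trans ?_
    have h1 := l2_nonneg fun k => weight bc N s σ k * x k
    have h2 := l2_nonneg fun k => weight bc N s σ k * y k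
    unfold wl2
    gcongr
    linarith
  · rw [wl2_cprod_triC]
    refine (H' N hN x y hx hy).trans ?_
    have h1 := l2_nonneg fun k => weight bc N (s - s₁) σ k * x k
    have h2 := l2_nonneg fun k => weight bc N (s - s₁) σ k * y k
    unfold wl2
    gcongr
    linarith

end PhaseNorm

/-! ### The transformation of the chain -/

theorem Bdd₂.mono {V : Type*} [NormedAddCommGroup V] [NormedSpace ℝ V] {p : Seminorm ℝ V}
    {b b' : ℝ} {Q : V →L[ℝ] V →L[ℝ] V} (h : Bdd₂ p b Q) (hb : b ≤ b') : Bdd₂ p b' Q :=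
  fun u v => (h u v).trans <| mul_le_mul_of_nonneg_right
    (mul_le_mul_of_nonneg_right hb (apply_nonneg p u)) (apply_nonneg p v)

theorem Bdd₃.mono {V : Type*} [NormedAddCommGroup V] [NormedSpace ℝ V] {p : Seminorm ℝ V}
    {b b' : ℝ} {K : V →L[ℝ] V →L[ℝ] V →L[ℝ] V} (h : Bdd₃ p b K) (hb : b ≤ b') : Bdd₃ p b' K :=
  fun u v w => (h u v w).trans <| mul_le_mul_of_nonneg_right (mul_le_mul_of_nonneg_right
    (mul_le_mul_of_nonneg_right hb (apply_nonneg p u)) (apply_nonneg p v)) (apply_nonneg p w)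

section Transformation

variable (bc : BC) (N : ℕ) (a α β : ℝ)

/-- The quadratic part of the generating field. -/
noncomputable def genQ : Phase bc N →L[ℝ] Phase bc N →L[ℝ] Phase bc N :=
  field₂ (genT α (triC bc N) (modeFreq bc N a))

/-- The cubic part of the generating field. -/
noncomputable def genK : Phase bc N →L[ℝ] Phase bc N →L[ℝ] Phase bc N →L[ℝ] Phase bc N :=
  field₃ (gen₄T α β (triC bc N) (quadC bc N) (modeFreq bc N a))

/-- The field of the normal form. -/
noncomputable def nfField : Phase bc N →L[ℝ] Phase bc N →L[ℝ] Phase bc N →L[ℝ] Phase bc N :=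
  field₃ (resT α β (triC bc N) (quadC bc N) (modeFreq bc N a))

/-- The field of `H₁`. -/
noncomputable def cubField : Phase bc N →L[ℝ] Phase bc N →L[ℝ] Phase bc N :=
  field₂ (cubT α (triC bc N) (modeFreq bc N a))

/-- The field of `H₂`. -/
noncomputable def quaField : Phase bc N →L[ℝ] Phase bc N →L[ℝ] Phase bc N →L[ℝ] Phase bc N :=
  field₃ (quaT β (quadC bc N) (modeFreq bc N a))

/-- The canonical transformation: one step of the implicit midpoint rule for the field of the
generator. -/
noncomputable def transform : Phase bc N → Phase bc N :=
  midpointMap (polyField (genQ bc N a α) (genK bc N a α β))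

/-- The normal form `Z`. -/
noncomputable def normalForm : Phase bc N → ℝ :=
  pot₄ (resT α β (triC bc N) (quadC bc N) (modeFreq bc N a))

/-- The remainder `R = H ∘ T - H₀ - Z`. -/
noncomputable def remainder (ψ : Phase bc N) : ℝ :=
  H a α β (transform bc N a α β ψ) - (H0 a ψ + normalForm bc N a α β ψ)

variable {bc N a α β}

theorem H0_eq_fun (ha : 0 ≤ a) : (H0 a : Phase bc N → ℝ)
    = fun φ => -(1 / 2 : ℝ) * sympForm (linField (modeFreq bc N a) φ) φ :=
  funext (H0_eq ha)

theorem hasFDerivAt_H0 (ha : 0 ≤ a) (ψ : Phase bc N) :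
    HasFDerivAt (H0 a) (-sympForm (linField (modeFreq bc N a) ψ)) ψ := by
  rw [H0_eq_fun ha]
  refine hasFDerivAt_quadratic sympForm _ (fun u v => ?_) ψ
  rw [sympForm_linField, sympForm_linField]
  congr 1
  exact Finset.sum_congr rfl fun k _ => by ring

theorem H_eq_fun : (H a α β : Phase bc N → ℝ) = fun φ => H0 a φ
    + pot₃ (cubT α (triC bc N) (modeFreq bc N a)) φ
    + pot₄ (quaT β (quadC bc N) (modeFreq bc N a)) φ := by
  funext φ
  rw [H, latticeH1_eq, latticeH2_eq]

theorem hasFDerivAt_H (ha : 0 ≤ a) (ψ : Phase bc N) :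
    HasFDerivAt (H a α β) (-sympForm (linField (modeFreq bc N a) ψ + cubField bc N a α ψ ψ
      + quaField bc N a β ψ ψ ψ)) ψ := by
  rw [H_eq_fun]
  refine (((hasFDerivAt_H0 ha ψ).add (hasFDerivAt_pot₃
    (isTensor₃_cubT α (isSymmCoef₃_triC bc N) _) ψ)).add (hasFDerivAt_pot₄
    (isTensor₄_quaT β (isContraction_quadC bc N) _) ψ)).congr_fderiv ?_
  rw [map_add, map_add, neg_add, neg_add]
  rfl

theorem hasFDerivAt_normalForm (ψ : Phase bc N) :
    HasFDerivAt (normalForm bc N a α β) (-sympForm (nfField bc N a α β ψ ψ ψ)) ψ :=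
  hasFDerivAt_pot₄
    (isTensor₄_resT α β (isSymmCoef₃_triC bc N) (isContraction_quadC bc N) _) ψ

theorem hasFDerivAt_H0_add (ha : 0 ≤ a) (ψ : Phase bc N) :
    HasFDerivAt (fun φ => H0 a φ + normalForm bc N a α β φ)
      (-sympForm (linField (modeFreq bc N a) ψ + nfField bc N a α β ψ ψ ψ)) ψ := by
  refine ((hasFDerivAt_H0 ha ψ).add (hasFDerivAt_normalForm ψ)).congr_fderiv ?_
  rw [map_add, neg_add]

section Analytic

open scoped ContDiff

theorem contDiff_pot₃ (h : ↥(idx bc N) × Bool → ↥(idx bc N) × Bool → ↥(idx bc N) × Bool → ℂ) :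
    ContDiff ℝ ω (pot₃ h) := by
  unfold pot₃
  fun_prop

theorem contDiff_pot₄ (t : ↥(idx bc N) × Bool → ↥(idx bc N) × Bool → ↥(idx bc N) × Bool →
    ↥(idx bc N) × Bool → ℂ) : ContDiff ℝ ω (pot₄ t) := by
  unfold pot₄
  fun_prop

theorem analyticAt_H0 (ha : 0 ≤ a) (ψ : Phase bc N) : AnalyticAt ℝ (H0 a) ψ := by
  have : ContDiff ℝ ω (H0 a : Phase bc N → ℝ) := by
    rw [H0_eq_fun ha]
    fun_prop
  exact this.contDiffAt.analyticAt

theorem analyticAt_normalForm (ψ : Phase bc N) : AnalyticAt ℝ (normalForm bc N a α β) ψ :=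
  (contDiff_pot₄ _).contDiffAt.analyticAt

theorem analyticAt_H (ha : 0 ≤ a) (ψ : Phase bc N) : AnalyticAt ℝ (H a α β) ψ := by
  rw [H_eq_fun]
  exact ((analyticAt_H0 ha ψ).add (contDiff_pot₃ _).contDiffAt.analyticAt).add
    (contDiff_pot₄ _).contDiffAt.analyticAt

end Analytic

/-- The bounds on all fields of the construction, in one norm and with one constant. -/
structure FieldBounds (bc : BC) (N : ℕ) (a α β b : ℝ) (p : Seminorm ℝ (Phase bc N)) : Prop where
  one_le : 1 ≤ b
  norm : IsAdmissibleNorm p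
  cub : Bdd₂ p b (cubField bc N a α)
  gen : Bdd₂ p b (genQ bc N a α)
  qua : Bdd₃ p b (quaField bc N a β)
  gen₄ : Bdd₃ p b (genK bc N a α β)
  nf : Bdd₃ p b (nfField bc N a α β)

theorem bdd₂_field₂ {s σ C κ : ℝ} (H : IsLossy (triC bc N) (weight bc N s σ) (weight bc N s σ)
    (fun _ => 1) C 1) (hκ : 0 ≤ κ)
    {h : ↥(idx bc N) × Bool → ↥(idx bc N) × Bool → ↥(idx bc N) × Bool → ℂ}
    (hh : ∀ a b d, ‖h a b d‖ ≤ κ * |triC bc N a.1 b.1 d.1|) :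
    Bdd₂ (wSeminorm bc N s σ) (12 * κ * C) (field₂ h) := by
  intro u v
  rw [wSeminorm_apply, wSeminorm_apply, wSeminorm_apply, wnorm_eq, wnorm_eq, wnorm_eq]
  have := H.field₂_le hκ (h := h) (fun x y z => (hh x y z).trans <|
    mul_le_mul_of_nonneg_left (by linarith [abs_nonneg (triC bc N x.1 y.1 z.1)]) hκ) u v
  rwa [mul_one] at this

theorem bdd₃_field₃ {s σ C κ : ℝ} (H : IsLossy (triC bc N) (weight bc N s σ) (weight bc N s σ)
    (fun _ => 1) C 1) (hκ : 0 ≤ κ)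
    {t : ↥(idx bc N) × Bool → ↥(idx bc N) × Bool → ↥(idx bc N) × Bool → ↥(idx bc N) × Bool → ℂ}
    (ht : ∀ a b d e, ‖t a b d e‖
      ≤ κ * pairSums (triC bc N) (fun _ => 1) a.1 b.1 d.1 e.1) :
    Bdd₃ (wSeminorm bc N s σ) (120 * κ * C ^ 2) (field₃ t) := by
  intro u v x
  rw [wSeminorm_apply, wSeminorm_apply, wSeminorm_apply, wSeminorm_apply, wnorm_eq, wnorm_eq,
    wnorm_eq, wnorm_eq]
  have := H.field₃_le hκ ht u v x
  rwa [mul_one] at this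

/-- The bound on the fields holds with a constant that does not depend on `N`. -/
theorem exists_fieldBounds (ha : 0 ≤ a) (hα : 0 ≤ α) (hβ : 0 ≤ β) (ha3 : a < 1 / 3) {s σ : ℝ}
    (h : Admissible bc s σ) :
    ∃ b : ℝ, ∀ N : ℕ, 1 ≤ N → FieldBounds bc N a α β b (wSeminorm bc N s σ) := by
  obtain ⟨C, HC⟩ := isLossy_self h
  have hC : 0 ≤ C := (HC 1 le_rfl).C_nonneg
  set γ := 2 - √(1 + 4 * a)
  have hω : ∀ N, IsNonresonant (modeFreq bc N a) γ := fun N => isNonresonant_modeFreq ha ha3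
  have hγ : 0 < γ := (hω 1).pos
  have q1 : 0 ≤ 12 * α * C := by positivity
  have q2 : 0 ≤ 12 * (α / γ) * C := by positivity
  have q3 : 0 ≤ 120 * β * C ^ 2 := by positivity
  have q4 : 0 ≤ 120 * (β + 4 * α ^ 2 / γ) * C ^ 2 := by positivity
  have q5 : 0 ≤ 120 * ((β + 4 * α ^ 2 / γ) / γ) * C ^ 2 := by positivity
  refine ⟨1 + 12 * α * C + 12 * (α / γ) * C + 120 * β * C ^ 2
    + 120 * (β + 4 * α ^ 2 / γ) * C ^ 2 + 120 * ((β + 4 * α ^ 2 / γ) / γ) * C ^ 2,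
    fun N hN => ?_⟩
  have hc := isContraction_quadC bc N
  have n := pairSum_nonneg (triC bc N) (δ := fun _ => 1) (fun _ => zero_le_one)
  refine ⟨by linarith, isAdmissibleNorm_wSeminorm hN s σ, ?_, ?_, ?_, ?_, ?_⟩
  · exact (bdd₂_field₂ (HC N hN) hα (norm_cubT_le α _ hα (hω N))).mono (by linarith)
  · exact (bdd₂_field₂ (HC N hN) (by positivity) (norm_genT_le α _ hα (hω N))).mono (by linarith)
  · refine (bdd₃_field₃ (HC N hN) hβ fun x y z v => ?_).mono (by linarith)
    refine (norm_quaT_le β hβ _ (hω N) x y z v).trans (mul_le_mul_of_nonneg_left ?_ hβ)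
    refine ((abs_quadC_le hc _ _ _ _).trans (sum_le_pairSum_one _ _ _ _)).trans ?_
    rw [pairSums]
    linarith [n x.1 z.1 y.1 v.1, n x.1 v.1 y.1 z.1]
  · exact (bdd₃_field₃ (HC N hN) (by positivity)
      (norm_gen₄T_le α β hα hβ hc (hω N))).mono (by linarith)
  · exact (bdd₃_field₃ (HC N hN) (by positivity)
      (norm_resT_le α β hα hβ hc (hω N))).mono (by linarith)

namespace FieldBounds

variable {b : ℝ} {p : Seminorm ℝ (Phase bc N)}

theorem isSymm_genQ : IsSymm₂ (genQ bc N a α) :=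
  isSymm_field₂ (isTensor₃_genT α (isSymmCoef₃_triC bc N) _)

theorem isSymm_genK : IsSymm₃ (genK bc N a α β) :=
  isSymm_field₃ (isTensor₄_gen₄T α β (isSymmCoef₃_triC bc N) (isContraction_quadC bc N) _)

theorem pos (h : FieldBounds bc N a α β b p) : 0 < b := one_pos.trans_le h.one_le

theorem half_radius (h : FieldBounds bc N a α β b p) : 1 / (5 * b) / 2 = 1 / (10 * b) := by
  have := h.pos.ne'
  field_simp
  norm_num

theorem nonexpansive (h : FieldBounds bc N a α β b p) :
    IsNonexpansive p (1 / (5 * b)) (polyField (genQ bc N a α) (genK bc N a α β)) :=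
  isNonexpansive_polyField h.one_le h.gen h.gen₄

theorem radius_le_one (h : FieldBounds bc N a α β b p) : 1 / (5 * b) ≤ 1 := by
  rw [div_le_one (by linarith [h.pos])]
  linarith [h.one_le]

theorem midpoint (h : FieldBounds bc N a α β b p) {ψ : Phase bc N} (hψ : p ψ < 1 / (10 * b)) :
    ∃ m, p m ≤ 2 * p ψ ∧ p m ≤ 1
      ∧ m = ψ + (1 / 2 : ℝ) • polyField (genQ bc N a α) (genK bc N a α β) m
      ∧ transform bc N a α β ψ - ψ = polyField (genQ bc N a α) (genK bc N a α β) m := by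
  have hψ' : p ψ ≤ 1 / (5 * b) / 2 := by rw [h.half_radius]; exact hψ.le
  obtain ⟨h1, h2⟩ := midpointOf_spec h.norm h.nonexpansive
    (contDiff_polyField (genQ bc N a α) (genK bc N a α β)).continuous hψ'
  refine ⟨midpointOf (polyField (genQ bc N a α) (genK bc N a α β)) ψ, h1,
    by linarith [h.radius_le_one], h2, ?_⟩
  rw [transform, midpointMap]
  nth_rewrite 1 [h2]
  module

theorem deriv_le (h : FieldBounds bc N a α β b p) (m : Phase bc N) (hm : p m ≤ 1 / (5 * b))
    (v : Phase bc N) : p (polyFieldDeriv (genQ bc N a α) (genK bc N a α β) m v) ≤ p v := by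
  have h1 := polyFieldDeriv_le h.pos.le h.gen h.gen₄ (hm.trans h.radius_le_one) v
  refine h1.trans ?_
  have h2 : 5 * b * p m ≤ 1 := by
    have := h.pos
    calc 5 * b * p m ≤ 5 * b * (1 / (5 * b)) := by gcongr
      _ = 1 := by field_simp
  exact mul_le_of_le_one_left (apply_nonneg p v) h2

theorem analyticAt_transform (h : FieldBounds bc N a α β b p) {ψ : Phase bc N}
    (hψ : p ψ < 1 / (10 * b)) : AnalyticAt ℝ (transform bc N a α β) ψ :=
  (midpointMap_fderiv h.norm h.nonexpansive (contDiff_polyField _ _)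
    (fun m => hasFDerivAt_polyField isSymm_genQ isSymm_genK m) h.deriv_le
    (by rwa [h.half_radius])).1

theorem isAnalyticCanonicalOn (h : FieldBounds bc N a α β b p) :
    IsAnalyticCanonicalOn (transform bc N a α β) {ψ | p ψ < 1 / (10 * b)} := by
  refine ⟨fun ψ hψ => h.analyticAt_transform hψ, ?_, fun ψ hψ u v => ?_⟩
  · rw [← h.half_radius]
    exact midpointMap_injOn h.norm h.nonexpansive (contDiff_polyField _ _).continuous
  · rw [symp_eq, symp_eq]
    exact midpointMap_symplectic h.norm h.nonexpansive (contDiff_polyField _ _)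
      (fun m => hasFDerivAt_polyField isSymm_genQ isSymm_genK m) h.deriv_le sympForm
      (sympForm_polyFieldDeriv (isTensor₃_genT α (isSymmCoef₃_triC bc N) _)
        (isTensor₄_gen₄T α β (isSymmCoef₃_triC bc N) (isContraction_quadC bc N) _))
      (by rw [h.half_radius]; exact hψ) u v

theorem analyticAt_remainder (h : FieldBounds bc N a α β b p) (ha : 0 ≤ a) {ψ : Phase bc N}
    (hψ : p ψ < 1 / (10 * b)) : AnalyticAt ℝ (remainder bc N a α β) ψ :=
  ((analyticAt_H ha _).comp (h.analyticAt_transform hψ)).sub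
    ((analyticAt_H0 ha ψ).add (analyticAt_normalForm ψ))

theorem transform_sub_le (h : FieldBounds bc N a α β b p) {ψ : Phase bc N}
    (hψ : p ψ < 1 / (10 * b)) : p (transform bc N a α β ψ - ψ) ≤ 8 * b * p ψ ^ 2 := by
  obtain ⟨m, h1, h2, -, h4⟩ := h.midpoint hψ
  rw [h4]
  have hb := h.pos
  have h0 := apply_nonneg p m
  calc p (polyField (genQ bc N a α) (genK bc N a α β) m) ≤ 2 * b * p m ^ 2 :=
        polyField_le h.pos.le h.gen h.gen₄ h2
    _ ≤ 2 * b * (2 * p ψ) ^ 2 := by gcongr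
    _ = 8 * b * p ψ ^ 2 := by ring

/-- The Hamiltonian field of the remainder is of order four: `remainder_bound`, fed with the two
homological equations. -/
theorem hamVF_remainder_le (h : FieldBounds bc N a α β b p) (ha : 0 ≤ a) (ha3 : a < 1 / 3)
    {ψ : Phase bc N} (hψ : p ψ < 1 / (10 * b)) :
    p (hamVF (remainder bc N a α β) ψ) ≤ 2560 * b ^ 4 * p ψ ^ 4 := by
  have hs := isSymmCoef₃_triC bc N
  have hc := isContraction_quadC bc N
  have hω : IsNonresonant (modeFreq bc N a) (2 - √(1 + 4 * a)) := isNonresonant_modeFreq ha ha3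
  have key := remainder_bound h.norm h.one_le (L := linField (modeFreq bc N a))
    (isSymm_field₂ (isTensor₃_cubT α hs _)) isSymm_genQ isSymm_genK h.cub h.gen h.qua h.gen₄ h.nf
    (homological_cubic α hs hω) (homological_quartic α β hs hc hω) sympForm
    (fun u hu => eq_zero_of_sympForm hu)
    (sympForm_polyFieldDeriv (isTensor₃_genT α hs _) (isTensor₄_gen₄T α β hs hc _))
    (H := H a α β) (F := fun φ => H0 a φ + normalForm bc N a α β φ)
    (fun φ => (hasFDerivAt_H ha φ).differentiableAt)
    (fun φ => (hasFDerivAt_H0_add ha φ).differentiableAt)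
    (fun φ w => by rw [(hasFDerivAt_H ha φ).fderiv]; rfl)
    (fun φ w => by rw [(hasFDerivAt_H0_add ha φ).fderiv]; rfl) hψ
    (Y := hamVF (remainder bc N a α β) ψ)
    (fun w => fderiv_eq_sympForm_hamVF (remainder bc N a α β) ψ w)
  rwa [mul_assoc]

/-- The distance of the transformation from the identity, beyond the leading quadratic term. -/
theorem transform_sub_genQ_le (h : FieldBounds bc N a α β b p) {ψ : Phase bc N}
    (hψ : p ψ < 1 / (10 * b)) :
    p (transform bc N a α β ψ - ψ - genQ bc N a α ψ ψ) ≤ (12 * b ^ 2 + 8 * b) * p ψ ^ 3 := by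
  obtain ⟨m, h1, h2, h3, h4⟩ := h.midpoint hψ
  have hb := h.pos
  have p0 := apply_nonneg p ψ
  have h5 : p (m - ψ) ≤ 4 * b * p ψ ^ 2 := by
    have e : m - ψ = (1 / 2 : ℝ) • polyField (genQ bc N a α) (genK bc N a α β) m := by
      nth_rewrite 1 [h3]
      rw [add_sub_cancel_left]
    have := h.transform_sub_le hψ
    rw [h4] at this
    rw [e, seminorm_half_smul]
    linarith
  have e : transform bc N a α β ψ - ψ - genQ bc N a α ψ ψ
      = genQ bc N a α (m - ψ) m + genQ bc N a α ψ (m - ψ) + genK bc N a α β m m m := by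
    rw [h4, polyField]
    simp only [map_sub, sub_apply]
    abel
  rw [e]
  have t1 : p (genQ bc N a α (m - ψ) m) ≤ b * (4 * b * p ψ ^ 2) * (2 * p ψ) :=
    (h.gen _ _).trans (by gcongr)
  have t2 : p (genQ bc N a α ψ (m - ψ)) ≤ b * p ψ * (4 * b * p ψ ^ 2) :=
    (h.gen _ _).trans (by gcongr)
  have t3 : p (genK bc N a α β m m m) ≤ b * (2 * p ψ) * (2 * p ψ) * (2 * p ψ) :=
    (h.gen₄ _ _ _).trans (by gcongr)
  refine (map_add_le_add p _ _).trans ((add_le_add (map_add_le_add p _ _) le_rfl).trans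
    ((add_le_add (add_le_add t1 t2) t3).trans (le_of_eq ?_)))
  ring

end FieldBounds

/-- The field of `χ₀₁` approximates the quadratic part of the generating field. -/
theorem genQ_sub_le (ha : 0 ≤ a) (hα : 0 ≤ α) (ha3 : a < 1 / 3) {w w' : ↥(idx bc N) → ℝ} {C ε : ℝ}
    (H : IsLossy (triC bc N) w w' (fun k => modeFreq bc N a k - 1) C ε) (ψ : Phase bc N) :
    wl2 w' (fun k => ‖(genQ bc N a α ψ ψ - hamVF (chi01 α) ψ) k‖)
      ≤ 12 * (2 * α / (2 - √(1 + 4 * a))) * C * ε * wl2 w (fun k => ‖ψ k‖)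
        * wl2 w (fun k => ‖ψ k‖) := by
  have hω : IsNonresonant (modeFreq bc N a) (2 - √(1 + 4 * a)) := isNonresonant_modeFreq ha ha3
  have hγ := hω.pos
  rw [hamVF_chi01, genQ, ← field₂_sub]
  exact H.field₂_le (by positivity) (norm_genT_sub_le α _ hα hω) ψ ψ

theorem hamVF_normalForm (ψ : Phase bc N) :
    hamVF (normalForm bc N a α β) ψ = nfField bc N a α β ψ ψ ψ :=
  hamVF_pot₄ (isTensor₄_resT α β (isSymmCoef₃_triC bc N) (isContraction_quadC bc N) _) ψ

/-- The field of `Z₀` approximates the field of the normal form. -/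
theorem normalForm_sub_le (ha : 0 ≤ a) (hα : 0 ≤ α) (hβ : 0 ≤ β) (ha3 : a < 1 / 3)
    {w w' : ↥(idx bc N) → ℝ} {C ε : ℝ}
    (H : IsLossy (triC bc N) w w' (fun k => modeFreq bc N a k - 1) C ε) (ψ : Phase bc N) :
    wl2 w' (fun k => ‖hamVF (fun φ => normalForm bc N a α β φ - Z0 α β φ) ψ k‖)
      ≤ 120 * (β + 4 * α ^ 2 / (2 - √(1 + 4 * a))) * C ^ 2 * ε * wl2 w (fun k => ‖ψ k‖)
        * wl2 w (fun k => ‖ψ k‖) * wl2 w (fun k => ‖ψ k‖) := by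
  have hω : IsNonresonant (modeFreq bc N a) (2 - √(1 + 4 * a)) := isNonresonant_modeFreq ha ha3
  have hγ := hω.pos
  have hs := isSymmCoef₃_triC bc N
  have hc := isContraction_quadC bc N
  have e : hamVF (fun φ => normalForm bc N a α β φ - Z0 α β φ) ψ
      = field₃ (fun x y z v => resT α β (triC bc N) (quadC bc N) (modeFreq bc N a) x y z v
        - resT α β (triC bc N) (quadC bc N) (fun _ => 1) x y z v) ψ ψ ψ := by
    refine hamVF_eq_of_fderiv fun v => ?_
    have h1 := (hasFDerivAt_pot₄ (isTensor₄_resT α β hs hc (modeFreq bc N a)) ψ).sub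
      (hasFDerivAt_pot₄ (isTensor₄_resT α β hs hc (fun _ => 1)) ψ)
    rw [← Z0_eq] at h1
    have h2 : fderiv ℝ (fun φ => normalForm bc N a α β φ - Z0 α β φ) ψ = _ := h1.fderiv
    rw [h2, field₃_sub, map_sub, neg_sub_neg, sub_apply, sub_apply, neg_sub]
  rw [e]
  exact H.field₃_le (by positivity) (norm_resT_sub_le α β hα hβ hc hω) ψ ψ ψ

end Transformation

end KGChain

theorem theorem3p1 (bc : BC) (a α β : ℝ) (ha : 0 ≤ a) (hα : 0 ≤ α) (hβ : 0 ≤ β)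
    (ha3 : a < 1 / 3) :
    ∃ (T : ∀ N : ℕ, Phase bc N → Phase bc N) (Z R : ∀ N : ℕ, Phase bc N → ℝ),
      (∀ N : ℕ, 1 ≤ N → IsHomPoly 4 (Z N) ∧ IsNormalForm (Z N)) ∧
      ∀ s σ : ℝ, Admissible bc s σ →
        ∃ ρ CR CZ CT : ℝ, 0 < ρ ∧
          (∀ N : ℕ, 1 ≤ N →
            IsAnalyticCanonicalOn (T N) (wball bc N s σ ρ) ∧
            AnalyticOnNhd ℝ (R N) (wball bc N s σ ρ) ∧
            (∀ ψ ∈ wball bc N s σ ρ,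
              H a α β (T N ψ) = H0 a ψ + Z N ψ + R N ψ ∧
              wnorm s σ (hamVF (R N) ψ) ≤ CR * wnorm s σ ψ ^ 4 ∧
              wnorm s σ (ψ - T N ψ) ≤ CT * wnorm s σ ψ ^ 2) ∧
            (∀ ψ, wnorm s σ (hamVF (Z N) ψ) ≤ CZ * wnorm s σ ψ ^ 3)) ∧
          ∀ s₁ : ℝ, AdmissibleLoss bc s s₁ →
            ∃ CRT Cr : ℝ, ∀ N : ℕ, 1 ≤ N →
              (∀ ψ ∈ wball bc N s σ ρ,
                wnorm (s - s₁) σ (T N ψ - ψ - hamVF (chi01 α) ψ) ≤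
                  CRT * (mu N ^ s₁ * wnorm s σ ψ ^ 2 + wnorm s σ ψ ^ 3)) ∧
              (∀ ψ ∈ wball bc N s σ (ρ * mu N ^ s₁),
                wnorm (s - s₁) σ (T N ψ - ψ - hamVF (chi01 α) ψ) ≤
                  CRT * mu N ^ s₁ * wnorm s σ ψ ^ 2) ∧
              (∀ ψ, wnorm (s - s₁) σ (hamVF (fun φ => Z N φ - Z0 α β φ) ψ) ≤
                Cr * mu N ^ s₁ * wnorm s σ ψ ^ 3) := by
  refine ⟨fun N => transform bc N a α β, fun N => normalForm bc N a α β,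
    fun N => remainder bc N a α β, fun N _ => ⟨isHomPoly_pot₄ _,
      isNormalForm_resT α β (isSymmCoef₃_triC bc N) (isContraction_quadC bc N) _⟩,
    fun s σ h => ?_⟩
  obtain ⟨b, hb⟩ := exists_fieldBounds ha hα hβ ha3 h
  have hb0 : 0 < b := (hb 1 le_rfl).pos
  -- the generating field is nonexpansive up to radius `1 / (5 * b)`, and midpoints can be twice
  -- as large as the point
  refine ⟨1 / (10 * b), 2560 * b ^ 4, b, 8 * b, by positivity, fun N hN => ?_, fun s₁ h₁ => ?_⟩
  · have F := hb N hN
    refine ⟨F.isAnalyticCanonicalOn, fun ψ hψ => F.analyticAt_remainder ha hψ,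
      fun ψ hψ => ⟨(add_sub_cancel _ _).symm, F.hamVF_remainder_le ha ha3 hψ, ?_⟩, fun ψ => ?_⟩
    · have := F.transform_sub_le hψ
      rwa [map_sub_rev] at this
    · rw [hamVF_normalForm]
      refine (F.nf ψ ψ ψ).trans (le_of_eq ?_)
      rw [wSeminorm_apply]
      ring
  · obtain ⟨C, HC⟩ := isLossy_freq ha h h₁
    have hC := (HC 1 le_rfl).C_nonneg
    have hγ : 0 < 2 - √(1 + 4 * a) := (isNonresonant_modeFreq (bc := bc) (N := 1) ha ha3).pos
    set γ := 2 - √(1 + 4 * a)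
    have hs₁ : 0 ≤ s₁ := by
      cases bc with
      | periodic => exact h₁.1
      | dirichlet => exact h₁.1
    -- `A` bounds the effect of the frequencies in the quadratic terms, `B` the terms of higher
    -- order, where no power of `μ` is gained
    set A := 12 * (2 * α / γ) * C * (8 * a)
    set B := 12 * b ^ 2 + 8 * b
    have hA : 0 ≤ A := by positivity
    have hB : 0 ≤ B := by positivity
    have key : ∀ N : ℕ, 1 ≤ N → ∀ ψ ∈ wball bc N s σ (1 / (10 * b)),
        wnorm (s - s₁) σ (transform bc N a α β ψ - ψ - hamVF (chi01 α) ψ)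
          ≤ A * mu N ^ s₁ * wnorm s σ ψ ^ 2 + B * wnorm s σ ψ ^ 3 := by
      intro N hN ψ hψ
      have t1 := (hb N hN).transform_sub_genQ_le hψ
      have t2 := genQ_sub_le ha hα ha3 (HC N hN) ψ
      have t3 := (HC N hN).wl2_le
        (fun k => norm_nonneg ((transform bc N a α β ψ - ψ - genQ bc N a α ψ ψ) k))
      rw [← wnorm_eq, ← wnorm_eq] at t2 t3
      have e : transform bc N a α β ψ - ψ - hamVF (chi01 α) ψ
          = (genQ bc N a α ψ ψ - hamVF (chi01 α) ψ)
            + (transform bc N a α β ψ - ψ - genQ bc N a α ψ ψ) := by abel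
      rw [e]
      refine (map_add_le_add (wSeminorm bc N (s - s₁) σ) _ _).trans
        ((add_le_add t2 (t3.trans t1)).trans (le_of_eq ?_))
      rw [wSeminorm_apply]
      ring
    refine ⟨A + B, 120 * (β + 4 * α ^ 2 / γ) * C ^ 2 * (8 * a), fun N hN => ⟨fun ψ hψ => ?_,
      fun ψ hψ => ?_, fun ψ => ?_⟩⟩
    · have hmu : 0 ≤ mu N ^ s₁ := Real.rpow_nonneg (by unfold mu; positivity) _
      have p0 := wnorm_nonneg s σ ψ
      have q1 : 0 ≤ B * (mu N ^ s₁ * wnorm s σ ψ ^ 2) := by positivity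
      have q2 : 0 ≤ A * wnorm s σ ψ ^ 3 := by positivity
      linarith [key N hN ψ hψ]
    · -- on the ball of radius `ρ μ^{s₁}` one factor `‖ψ‖` of the cubic term supplies `μ^{s₁}`
      have hN' : (1 : ℝ) ≤ N := by exact_mod_cast hN
      have hmu0 : 0 ≤ mu N := by unfold mu; positivity
      have hmu : 0 ≤ mu N ^ s₁ := Real.rpow_nonneg hmu0 _
      have hmu1 : mu N ^ s₁ ≤ 1 := Real.rpow_le_one hmu0
        (by rw [mu, div_le_one (by linarith)]; exact hN') hs₁
      have p0 := wnorm_nonneg s σ ψ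
      have hρ : 1 / (10 * b) ≤ 1 := by
        rw [div_le_one (by positivity)]
        linarith [(hb 1 le_rfl).one_le]
      have hψ' : wnorm s σ ψ < 1 / (10 * b) * mu N ^ s₁ := hψ
      have h2 : ψ ∈ wball bc N s σ (1 / (10 * b)) :=
        hψ'.trans_le (mul_le_of_le_one_right (by positivity) hmu1)
      have h3 : wnorm s σ ψ ≤ mu N ^ s₁ := hψ'.le.trans (mul_le_of_le_one_left hmu hρ)
      have h4 : wnorm s σ ψ ^ 3 ≤ mu N ^ s₁ * wnorm s σ ψ ^ 2 := by
        rw [pow_succ']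
        gcongr
      have h5 := mul_le_mul_of_nonneg_left h4 hB
      linarith [key N hN ψ h2]
    · have t := normalForm_sub_le ha hα hβ ha3 (HC N hN) ψ
      rw [← wnorm_eq, ← wnorm_eq] at t
      refine t.trans (le_of_eq ?_)
      ring
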